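/- Let $q>0$ and let $\mathcal H=L^2[0,1]$ (complex valued). Let $$Af=-if'',\qquad D(A)=\{f\in H^2(0,1)\mid f'(0)=-iqf(0),\ f'(1)=0\}.$$ Then $A$ is densely defined, and its adjoint is $A^*f=if''$ with $D(A^*)=\{f\in H^2(0,1)\mid f'(0)=iqf(0),\ f'(1)=0\}$. Let $\mathcal H_{-1}$ be the space of bounded conjugate-linear functionals on $D(A^*)$ (with the graph norm), into which $\mathcal H$ is embedded by $x\mapsto(\psi\mapsto\langle x,\psi\rangle)$. The resolvent set of $A$ is non-empty, $\mathcal H$ is dense in $\mathcal H_{-1}$, and on $\mathcal H$ the norm of $\mathcal H_{-1}$ is equivalent to $\|(\beta I-A)^{-1}x\|_{\mathcal H}$ for every $\beta\in\rho(A)$; that is, $\mathcal H_{-1}$ is the completion of $\mathcal H$ for this norm. The bounded operator $\mathcal H\to\mathcal H_{-1}$, $x\mapsto(\psi\mapsto\langle x,A^*\psi\rangle)$, extends $A$ and is again denoted by $A$. Let $B_l=i\delta$ and $B_r=-i\delta(\cdot-1)$ in $\mathcal H_{-1}$, i.e. $\langle B_l,\psi\rangle=i\overline{\psi(0)}$ and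 $\langle B_r,\psi\rangle=-i\overline{\psi(1)}$ for $\psi\in D(A^*)$. For $f\in\mathcal H$ and $a,b\in\mathbb C$ one has $Af+B_la+B_rb\in\mathcal H$ if and only if $f\in H^2(0,1)$, $f'(0)=-iqf(0)+a$ and $f'(1)=b$. (i) $A$ generates a strongly continuous group $\mathbb T=(\mathbb T_t)_{t\in\mathbb R}$ on $\mathcal H$, and $B_l$, $B_r$ are admissible control operators for $\mathbb T$: $\mathbb T_t$ extends to bounded operators on $\mathcal H_{-1}$, and $\int_0^\tau\mathbb T_{\tau-s}Bu(s)\,ds\in\mathcal H$ for all $\tau>0$, all $u\in L^2[0,\infty)$ and $B\in\{B_l,B_r\}$. (ii) For every $z_0\in\mathcal H$ and all $d_2,u\in L^2_{loc}[0,\infty)$, the equation $$\dot z(t)=Az(t)+B_ld_2(t)+B_ru(t),\qquad z(0)=z_0,$$ has a unique solution in $\mathcal H_{-1}$, i.e. a unique $z\in L^1_{loc}([0,\infty);\mathcal H)\cap C([0,\infty);\mathcal H_{-1})$ with $z(0)=z_0$ and $z(t)-z(0)=\int_0^t[Az(s)+B_ld_2(s)+B_ru(s)]\,ds$ in $\mathcal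 H_{-1}$ for all $t\ge0$. Moreover $z\in C([0,\infty);\mathcal H)$. (iii) If $d_2,u\in H^1_{loc}(0,\infty)$ (identified with their continuous representatives on $[0,\infty)$; the restrictions to $(0,\tau)$ are in $H^1(0,\tau)$ for all $\tau>0$) and $z_0\in\mathcal H$ are such that $Az_0+B_ld_2(0)+B_ru(0)\in\mathcal H$, then this solution satisfies $$z\in C([0,\infty);H^2(0,1))\cap C^1([0,\infty);\mathcal H).$$ In this case, for every bounded linear functional $C_e$ on $H^2(0,1)$, the outputs $y(t)=C_e[z(t)]$ and $y_m(t)=z(1,t)$ are well defined and continuous, and $(z,(d_2,u),(y,y_m))$ is a classical solution of the abstract system $\dot z=Az+B_ld_2+B_ru$, $y=C_ez$, $y_m=z(1,\cdot)$, and of $$z_t=-iz_{xx},\quad z_x(0,t)=-iqz(0,t)+d_2(t),\quad z_x(1,t)=u(t),\quad z(\cdot,0)=z_0,\quad y(t)=C_e[z(\cdot,t)],\quad y_m(t)=z(1,t).$$ Here a classical solution has $z\in C^1([0,\infty);\mathcal H)$, continuous $d_2,u,y,y_m$ on $[0,\infty)$, $z(t)\in H^2(0,1)$ with $Az(t)+B_ld_2(t)+B_ru(t)\in\mathcal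 H$, and satisfies the equations for all $t\ge0$. -/

import Mathlib

open MeasureTheory Set Filter Topology

noncomputable section

namespace Schrod

/-- The state space `L²[0,1]` (complex valued). -/
abbrev H : Type := Lp ℂ 2 (volume.restrict (Icc (0 : ℝ) 1))

/-! ### Sobolev functions on the unit interval -/

/-- `f ∈ H¹(0,1)` with derivative `g ∈ L²`: `f` is (a.e. equal to) the absolutely continuous
function `x ↦ c + ∫₀ˣ g`. -/
def HasDerivL2 (f g : H) : Prop :=
  ∃ c : ℂ, ∀ᵐ x ∂(volume.restrict (Icc (0 : ℝ) 1)), f x = c + ∫ y in (0 : ℝ)..x, g y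

open Classical in
/-- `f(x)` for `x ∈ [0,1]`, meaning the value at `x` of the continuous representative of `f`
(and `0` if the class `f` has no representative that is continuous on `[0,1]`). -/
def pointValue (f : H) (x : ℝ) : ℂ :=
  if h : ∃ F : ℝ → ℂ, ContinuousOn F (Icc 0 1) ∧
      ∀ᵐ y ∂(volume.restrict (Icc (0 : ℝ) 1)), f y = F y
  then Classical.choose h x else 0

theorem intervalIntegrable_of_mem (g : H) {x : ℝ} (hx : x ∈ Icc (0 : ℝ) 1) :
    IntervalIntegrable (fun y => g y) volume 0 x := by
  rw [intervalIntegrable_iff_integrableOn_Icc_of_le hx.1]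
  have h : IntegrableOn (fun y => g y) (Icc 0 1) volume :=
    (Lp.memLp g).integrable (by norm_num)
  exact h.mono_set (Icc_subset_Icc_right hx.2)

theorem continuousOn_primitive (c : ℂ) (g : H) :
    ContinuousOn (fun x : ℝ => c + ∫ y in (0 : ℝ)..x, g y) (Icc 0 1) := by
  have h := intervalIntegral.continuousOn_primitive_interval'
    (intervalIntegrable_of_mem g (x := 1) (by simp)) (a := 0) (by simp)
  rw [uIcc_of_le zero_le_one] at h
  exact continuousOn_const.add h

theorem pointValue_eq {f : H} {F : ℝ → ℂ} (hF : ContinuousOn F (Icc 0 1))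
    (h : ∀ᵐ y ∂(volume.restrict (Icc (0 : ℝ) 1)), f y = F y) {x : ℝ} (hx : x ∈ Icc (0 : ℝ) 1) :
    pointValue f x = F x := by
  have hex : ∃ F : ℝ → ℂ, ContinuousOn F (Icc 0 1) ∧
      ∀ᵐ y ∂(volume.restrict (Icc (0 : ℝ) 1)), f y = F y := ⟨F, hF, h⟩
  rw [pointValue, dif_pos hex]
  obtain ⟨h1, h2⟩ := Classical.choose_spec hex
  refine Measure.eqOn_Icc_of_ae_eq volume zero_ne_one ?_ h1 hF hx
  filter_upwards [h2, h] with y hy1 hy2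
  rw [← hy1, hy2]

theorem HasDerivL2.pointValue_eq {f g : H} (h : HasDerivL2 f g) {x : ℝ}
    (hx : x ∈ Icc (0 : ℝ) 1) :
    pointValue f x = pointValue f 0 + ∫ y in (0 : ℝ)..x, g y := by
  obtain ⟨c, hc⟩ := h
  rw [Schrod.pointValue_eq (continuousOn_primitive c g) hc hx,
    Schrod.pointValue_eq (continuousOn_primitive c g) hc (x := 0) (by simp)]
  simp

theorem HasDerivL2.ae_eq {f g : H} (h : HasDerivL2 f g) :
    ∀ᵐ x ∂(volume.restrict (Icc (0 : ℝ) 1)), f x = pointValue f x := by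
  obtain ⟨c, hc⟩ := h
  filter_upwards [hc, ae_restrict_mem measurableSet_Icc] with x hx hm
  rw [hx, Schrod.pointValue_eq (continuousOn_primitive c g) hc hm]

theorem HasDerivL2.continuousOn {f g : H} (h : HasDerivL2 f g) :
    ContinuousOn (pointValue f) (Icc 0 1) :=
  (continuousOn_primitive (pointValue f 0) g).congr fun _ hx => h.pointValue_eq hx

theorem integral_add_of_mem (f g : H) {x : ℝ} (hx : x ∈ Icc (0 : ℝ) 1) :
    ∫ y in (0 : ℝ)..x, (f + g : H) y = (∫ y in (0 : ℝ)..x, f y) + ∫ y in (0 : ℝ)..x, g y := by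
  rw [← intervalIntegral.integral_add (intervalIntegrable_of_mem f hx)
    (intervalIntegrable_of_mem g hx), intervalIntegral.integral_of_le hx.1,
    intervalIntegral.integral_of_le hx.1]
  refine integral_congr_ae ?_
  have hs : Ioc 0 x ⊆ Icc (0 : ℝ) 1 := fun y hy => ⟨hy.1.le, hy.2.trans hx.2⟩
  exact ae_restrict_of_ae_restrict_of_subset hs (Lp.coeFn_add f g)

theorem integral_smul_of_mem (a : ℂ) (f : H) {x : ℝ} (hx : x ∈ Icc (0 : ℝ) 1) :
    ∫ y in (0 : ℝ)..x, (a • f : H) y = a * ∫ y in (0 : ℝ)..x, f y := by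
  rw [← intervalIntegral.integral_const_mul, intervalIntegral.integral_of_le hx.1,
    intervalIntegral.integral_of_le hx.1]
  refine integral_congr_ae ?_
  have hs : Ioc 0 x ⊆ Icc (0 : ℝ) 1 := fun y hy => ⟨hy.1.le, hy.2.trans hx.2⟩
  exact ae_restrict_of_ae_restrict_of_subset hs (Lp.coeFn_smul a f)

theorem HasDerivL2.add {f g f' g' : H} (h : HasDerivL2 f g) (h' : HasDerivL2 f' g') :
    HasDerivL2 (f + f') (g + g') := by
  obtain ⟨c, hc⟩ := h
  obtain ⟨d, hd⟩ := h'
  refine ⟨c + d, ?_⟩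
  filter_upwards [hc, hd, Lp.coeFn_add f f', ae_restrict_mem measurableSet_Icc] with x h1 h2 h3 h4
  rw [h3, Pi.add_apply, h1, h2, integral_add_of_mem g g' h4]
  ring

theorem HasDerivL2.smul (a : ℂ) {f g : H} (h : HasDerivL2 f g) :
    HasDerivL2 (a • f) (a • g) := by
  obtain ⟨c, hc⟩ := h
  refine ⟨a * c, ?_⟩
  filter_upwards [hc, Lp.coeFn_smul a f, ae_restrict_mem measurableSet_Icc] with x h1 h2 h3
  rw [h2, Pi.smul_apply, h1, integral_smul_of_mem a g h3, smul_eq_mul]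
  ring

theorem hasDerivL2_zero : HasDerivL2 0 0 := by
  have h : ∀ᵐ x ∂(volume.restrict (Icc (0 : ℝ) 1)), (0 : H) x = 0 := Lp.coeFn_zero _ _ _
  refine ⟨0, ?_⟩
  filter_upwards [h, ae_restrict_mem measurableSet_Icc] with x h1 h2
  have := integral_smul_of_mem 0 0 h2
  rw [zero_smul, zero_mul] at this
  rw [h1, this, add_zero]

theorem pointValue_add {f g f' g' : H} (h : HasDerivL2 f g) (h' : HasDerivL2 f' g') {x : ℝ}
    (hx : x ∈ Icc (0 : ℝ) 1) :
    pointValue (f + f') x = pointValue f x + pointValue f' x := by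
  refine pointValue_eq (F := fun x => pointValue f x + pointValue f' x)
    (h.continuousOn.add h'.continuousOn) ?_ hx
  filter_upwards [h.ae_eq, h'.ae_eq, Lp.coeFn_add f f'] with y h1 h2 h3
  rw [h3, Pi.add_apply, h1, h2]

theorem pointValue_smul (a : ℂ) {f g : H} (h : HasDerivL2 f g) {x : ℝ}
    (hx : x ∈ Icc (0 : ℝ) 1) : pointValue (a • f) x = a * pointValue f x := by
  refine pointValue_eq (F := fun x => a * pointValue f x)
    (continuousOn_const.mul h.continuousOn) ?_ hx
  filter_upwards [h.ae_eq, Lp.coeFn_smul a f] with y h1 h3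
  rw [h3, Pi.smul_apply, h1, smul_eq_mul]

theorem pointValue_zero {x : ℝ} (hx : x ∈ Icc (0 : ℝ) 1) : pointValue 0 x = 0 := by
  have := pointValue_smul 0 hasDerivL2_zero hx
  rwa [zero_smul, zero_mul] at this

/-- The weak derivative is unique. -/
theorem HasDerivL2.eq_zero {g : H} (h : HasDerivL2 0 g) : g = 0 := by
  have h0 : ∀ x ∈ Icc (0 : ℝ) 1, ∫ y in (0 : ℝ)..x, g y = 0 := fun x hx => by
    have := h.pointValue_eq hx
    rw [pointValue_zero hx, pointValue_zero (by simp), zero_add] at this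
    exact this.symm
  have hd := (intervalIntegrable_of_mem g (x := 1) (by simp)).ae_hasDerivAt_integral
  rw [Lp.eq_zero_iff_ae_eq_zero]
  have h1 : ∀ᵐ x ∂(volume.restrict (Icc (0 : ℝ) 1)), x ∈ Ioo (0 : ℝ) 1 := by
    rw [← restrict_Ioo_eq_restrict_Icc]
    exact ae_restrict_mem measurableSet_Ioo
  filter_upwards [ae_restrict_of_ae hd, h1] with x hx hx1
  have hx2 : x ∈ uIcc (0 : ℝ) 1 := by
    rw [uIcc_of_le zero_le_one]; exact Ioo_subset_Icc_self hx1
  have h3 := hx hx2 0 (by simp)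
  have h4 : (fun x => ∫ y in (0 : ℝ)..x, g y) =ᶠ[𝓝 x] fun _ => 0 := by
    filter_upwards [isOpen_Ioo.mem_nhds hx1] with y hy
    exact h0 y (Ioo_subset_Icc_self hy)
  exact (h3.congr_of_eventuallyEq h4.symm).unique (hasDerivAt_const x 0)

/-- The Sobolev space `H²(0,1)`, as the space of triples `(f, f', f'')` in `L² × L² × L²`, with
the norm of the product (equivalent to the usual norm of `H²(0,1)`). -/
def H2 : Submodule ℂ (H × H × H) where
  carrier := {p | HasDerivL2 p.1 p.2.1 ∧ HasDerivL2 p.2.1 p.2.2}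
  add_mem' h h' := ⟨h.1.add h'.1, h.2.add h'.2⟩
  zero_mem' := ⟨hasDerivL2_zero, hasDerivL2_zero⟩
  smul_mem' a _ h := ⟨h.1.smul a, h.2.smul a⟩

/-! ### The Schrödinger operators -/

/-- The graph of `f ↦ c f''` with domain
`{f ∈ H²(0,1) | f'(0) = κ f(0), f'(1) = 0}`. -/
def bvpGraph (c κ : ℂ) : Submodule ℂ (H × H) where
  carrier := {p | ∃ ζ ∈ H2, p.1 = ζ.1 ∧ p.2 = c • ζ.2.2 ∧
    pointValue ζ.2.1 0 = κ * pointValue ζ.1 0 ∧ pointValue ζ.2.1 1 = 0}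
  add_mem' := by
    rintro p p' ⟨ζ, hζ, h1, h2, h3, h4⟩ ⟨ζ', hζ', h1', h2', h3', h4'⟩
    refine ⟨ζ + ζ', H2.add_mem hζ hζ', ?_, ?_, ?_, ?_⟩
    · simp [h1, h1']
    · simp [h2, h2']
    · simp only [Prod.fst_add, Prod.snd_add]
      rw [pointValue_add hζ.1 hζ'.1 (by simp), pointValue_add hζ.2 hζ'.2 (by simp), h3, h3']
      ring
    · simp only [Prod.fst_add, Prod.snd_add]
      rw [pointValue_add hζ.2 hζ'.2 (by simp), h4, h4', add_zero]
  zero_mem' := ⟨0, H2.zero_mem, rfl, by simp, by simp [pointValue_zero],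
    by simp [pointValue_zero]⟩
  smul_mem' := by
    rintro a p ⟨ζ, hζ, h1, h2, h3, h4⟩
    refine ⟨a • ζ, H2.smul_mem a hζ, ?_, ?_, ?_, ?_⟩
    · simp [h1]
    · simp [h2, smul_comm a c]
    · simp only [Prod.smul_fst, Prod.smul_snd]
      rw [pointValue_smul a hζ.1 (by simp), pointValue_smul a hζ.2 (by simp), h3]
      ring
    · simp only [Prod.smul_fst, Prod.smul_snd]
      rw [pointValue_smul a hζ.2 (by simp), h4, mul_zero]

/-- The unbounded operator `f ↦ c f''` on `L²[0,1]` with domain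
`{f ∈ H²(0,1) | f'(0) = κ f(0), f'(1) = 0}`. -/
def bvpOp (c κ : ℂ) : H →ₗ.[ℂ] H := (bvpGraph c κ).toLinearPMap

theorem graph_bvpOp (c κ : ℂ) : (bvpOp c κ).graph = bvpGraph c κ := by
  refine Submodule.toLinearPMap_graph_eq _ ?_
  rintro ⟨f, h⟩ ⟨⟨f0, f1, f2⟩, ⟨hd1, hd2⟩, h1, h2, -, -⟩ (hf : f = 0)
  simp only at h1 h2 hd1 hd2 ⊢
  rw [hf] at h1
  subst h1
  have := hd1.eq_zero
  subst this
  rw [h2, hd2.eq_zero, smul_zero]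

/-- `A f = -i f''`, `D(A) = {f ∈ H²(0,1) | f'(0) = -iq f(0), f'(1) = 0}`. -/
def A (q : ℝ) : H →ₗ.[ℂ] H := bvpOp (-Complex.I) (-Complex.I * q)

/-- `A* f = i f''`, `D(A*) = {f ∈ H²(0,1) | f'(0) = iq f(0), f'(1) = 0}`. -/
def Astar (q : ℝ) : H →ₗ.[ℂ] H := bvpOp Complex.I (Complex.I * q)

/-- `T` is a strongly continuous group of bounded operators on `L²[0,1]`. -/
structure IsC0Group (T : ℝ → H →L[ℂ] H) : Prop where
  zero : T 0 = ContinuousLinearMap.id ℂ H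
  add : ∀ s t, T (s + t) = (T s).comp (T t)
  cont : ∀ x, Continuous fun t => T t x

/-- `G` is the infinitesimal generator of `T`: `x ∈ D(G)` with `G x = y` if and only if
`(T_t x - x) / t → y` as `t ↓ 0`. -/
def IsGenerator (T : ℝ → H →L[ℂ] H) (G : H →ₗ.[ℂ] H) : Prop :=
  ∀ x y : H, (x, y) ∈ G.graph ↔
    Tendsto (fun t : ℝ => t⁻¹ • (T t x - x)) (𝓝[>] 0) (𝓝 y)

/-- `β` belongs to the resolvent set of `G` and `R = (β I - G)⁻¹`. -/
def IsResolvent (G : H →ₗ.[ℂ] H) (β : ℂ) (R : H →L[ℂ] H) : Prop :=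
  ∀ x y : H, R x = y ↔ (y, β • y - x) ∈ G.graph

/-! ### The extrapolation space `X₋₁` -/

/-- The space `X₋₁` for `A`, realised as the space of bounded conjugate-linear functionals on
`D(A*)`, where `D(A*)` carries the graph norm; it is the dual of `D(A*)` with respect to the pivot
space `L²[0,1]`. An element `p` of the graph of `A*` is the pair `(ψ, A*ψ)`. -/
def Xm1 (q : ℝ) : Type := (Astar q).graph →SL[starRingEnd ℂ] ℂ

instance (q : ℝ) : NormedAddCommGroup (Xm1 q) :=
  inferInstanceAs (NormedAddCommGroup ((Astar q).graph →SL[starRingEnd ℂ] ℂ))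

instance (q : ℝ) : NormedSpace ℂ (Xm1 q) :=
  inferInstanceAs (NormedSpace ℂ ((Astar q).graph →SL[starRingEnd ℂ] ℂ))

instance (q : ℝ) : CompleteSpace (Xm1 q) :=
  inferInstanceAs (CompleteSpace ((Astar q).graph →SL[starRingEnd ℂ] ℂ))

instance (q : ℝ) : FunLike (Xm1 q) (Astar q).graph ℂ :=
  inferInstanceAs (FunLike ((Astar q).graph →SL[starRingEnd ℂ] ℂ) (Astar q).graph ℂ)

/-- The embedding of `L²[0,1]` into `X₋₁`: `x ↦ (ψ ↦ ∫₀¹ x ψ̄)`. -/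
def emb (q : ℝ) : H →L[ℂ] Xm1 q :=
  (ContinuousLinearMap.precomp ℂ
    ((ContinuousLinearMap.fst ℂ H H).comp (Astar q).graph.subtypeL)).comp (innerSLFlip ℂ)

theorem emb_apply (q : ℝ) (x : H) (p : (Astar q).graph) :
    emb q x p = inner ℂ p.1.1 x := rfl

/-- The extension of `A` to a bounded operator `L²[0,1] → X₋₁`: `x ↦ (ψ ↦ ⟨x, A*ψ⟩)`. -/
def Aext (q : ℝ) : H →L[ℂ] Xm1 q :=
  (ContinuousLinearMap.precomp ℂ
    ((ContinuousLinearMap.snd ℂ H H).comp (Astar q).graph.subtypeL)).comp (innerSLFlip ℂ)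

theorem Aext_apply (q : ℝ) (x : H) (p : (Astar q).graph) :
    Aext q x p = inner ℂ p.1.2 x := rfl

theorem norm_integral_le (g : H) {x : ℝ} (hx : x ∈ Icc (0 : ℝ) 1) :
    ‖∫ y in (0 : ℝ)..x, g y‖ ≤ ‖g‖ := by
  have hsub : Ioc 0 x ⊆ Icc (0 : ℝ) 1 := fun y hy => ⟨hy.1.le, hy.2.trans hx.2⟩
  have hfin : (volume.restrict (Icc (0 : ℝ) 1)) (Ioc 0 x) ≠ ⊤ := measure_ne_top _ _
  have h := L2.inner_indicatorConstLp_one (𝕜 := ℂ) measurableSet_Ioc hfin g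
  rw [Measure.restrict_restrict_of_subset hsub] at h
  rw [intervalIntegral.integral_of_le hx.1, ← h]
  refine (norm_inner_le_norm _ _).trans ?_
  refine mul_le_of_le_one_left (norm_nonneg _) ?_
  refine norm_indicatorConstLp_le.trans ?_
  have : (volume.restrict (Icc (0 : ℝ) 1)).real (Ioc 0 x) ≤ 1 := by
    rw [Measure.real, Measure.restrict_apply measurableSet_Ioc,
      inter_eq_self_of_subset_left hsub, Real.volume_Ioc, sub_zero, ENNReal.toReal_ofReal hx.1]
    exact hx.2
  rw [norm_one, one_mul]
  exact Real.rpow_le_one measureReal_nonneg this (by norm_num)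

theorem mem_Astar_graph {q : ℝ} (p : (Astar q).graph) : ∃ ζ ∈ H2, p.1.1 = ζ.1 ∧
    p.1.2 = Complex.I • ζ.2.2 ∧
    pointValue ζ.2.1 0 = Complex.I * q * pointValue ζ.1 0 ∧ pointValue ζ.2.1 1 = 0 := by
  have h : p.1 ∈ (bvpOp Complex.I (Complex.I * q)).graph := p.2
  rw [graph_bvpOp] at h
  exact h

/-- Point evaluation is continuous on `D(A*)` for the graph norm. -/
theorem norm_pointValue_le {q : ℝ} (hq : 0 < q) (p : (Astar q).graph) {x : ℝ}
    (hx : x ∈ Icc (0 : ℝ) 1) : ‖pointValue p.1.1 x‖ ≤ (q⁻¹ + 2) * ‖p‖ := by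
  obtain ⟨⟨f, f1, f2⟩, ⟨hd1, hd2⟩, h1, h2, h3, h4⟩ := mem_Astar_graph p
  simp only at h1 h2 h3 h4 hd1 hd2
  have hn : ‖f2‖ ≤ ‖p‖ := by
    have : ‖p.1.2‖ ≤ ‖p‖ := norm_snd_le p.1
    rwa [h2, norm_smul, Complex.norm_I, one_mul] at this
  rw [h1]
  have e0 : ‖pointValue f1 0‖ ≤ ‖f2‖ := by
    have := hd2.pointValue_eq (x := 1) (by simp)
    rw [h4] at this
    rw [eq_neg_of_add_eq_zero_left this.symm, norm_neg]
    exact norm_integral_le f2 (by simp)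
  have e1 : ∀ y ∈ Icc (0 : ℝ) 1, ‖pointValue f1 y‖ ≤ 2 * ‖f2‖ := fun y hy => by
    rw [hd2.pointValue_eq hy]
    have := norm_add_le (pointValue f1 0) (∫ z in (0 : ℝ)..y, f2 z)
    have := norm_integral_le f2 hy
    linarith
  have e2 : ‖pointValue f 0‖ ≤ q⁻¹ * ‖f2‖ := by
    rw [h3, norm_mul, norm_mul, Complex.norm_I, one_mul, Complex.norm_real, Real.norm_eq_abs,
      abs_of_pos hq] at e0
    rw [inv_mul_eq_div, le_div_iff₀ hq]
    linarith
  have e3 : ‖∫ y in (0 : ℝ)..x, f1 y‖ ≤ 2 * ‖f2‖ := by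
    have hsub : Ioc 0 x ⊆ Icc (0 : ℝ) 1 := fun y hy => ⟨hy.1.le, hy.2.trans hx.2⟩
    have := intervalIntegral.norm_integral_le_of_norm_le_const_ae (a := 0) (b := x)
      (f := fun y => f1 y) (C := 2 * ‖f2‖) ?_
    · refine this.trans ?_
      rw [sub_zero, abs_of_nonneg hx.1]
      exact mul_le_of_le_one_right (by positivity) hx.2
    · have hae := hd2.ae_eq
      rw [ae_restrict_iff' measurableSet_Icc] at hae
      filter_upwards [hae] with y hy hy1
      rw [uIoc_of_le hx.1] at hy1
      rw [hy (hsub hy1)]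
      exact e1 y (hsub hy1)
  rw [hd1.pointValue_eq hx]
  have h5 := norm_add_le (pointValue f 0) (∫ z in (0 : ℝ)..x, f1 z)
  have h6 : (q⁻¹ + 2) * ‖f2‖ ≤ (q⁻¹ + 2) * ‖p‖ := by gcongr
  linarith

/-- The Dirac mass at `x ∈ [0,1]` as an element of `X₋₁`: `ψ ↦ conj (ψ(x))`. -/
def dirac {q : ℝ} (hq : 0 < q) (x : Icc (0 : ℝ) 1) : Xm1 q :=
  LinearMap.mkContinuous
    { toFun := fun p => starRingEnd ℂ (pointValue p.1.1 x)
      map_add' := fun p p' => by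
        obtain ⟨ζ, hζ, h1, -⟩ := mem_Astar_graph p
        obtain ⟨ζ', hζ', h1', -⟩ := mem_Astar_graph p'
        rw [Submodule.coe_add, Prod.fst_add, h1, h1', pointValue_add hζ.1 hζ'.1 x.2, map_add]
      map_smul' := fun a p => by
        obtain ⟨ζ, hζ, h1, -⟩ := mem_Astar_graph p
        rw [Submodule.coe_smul, Prod.smul_fst, h1, pointValue_smul a hζ.1 x.2, map_mul,
          smul_eq_mul] }
    (q⁻¹ + 2) fun p => by
      simpa using norm_pointValue_le hq p x.2

theorem dirac_apply {q : ℝ} (hq : 0 < q) (x : Icc (0 : ℝ) 1) (p : (Astar q).graph) :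
    dirac hq x p = starRingEnd ℂ (pointValue p.1.1 x) := rfl

/-- `B_l = i δ`; a control operator `ℂ → X₋₁` is identified with its value at `1`. -/
def Bl {q : ℝ} (hq : 0 < q) : Xm1 q := Complex.I • dirac hq 0

/-- `B_r = -i δ(· - 1)`. -/
def Br {q : ℝ} (hq : 0 < q) : Xm1 q := -Complex.I • dirac hq 1

/-- `b` is an admissible control operator for `T`: with `S` the extension of `T` to `X₋₁`, for
every `τ > 0` and every `u ∈ L²[0,∞)`, the integral `∫₀^τ S_{τ-s} b u(s) ds`, computed in `X₋₁`,
belongs to `L²[0,1]`. -/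
def IsAdmissibleControl {q : ℝ} (T : ℝ → H →L[ℂ] H) (b : Xm1 q) : Prop :=
  ∃ S : ℝ → Xm1 q →L[ℂ] Xm1 q, (∀ t x, S t (emb q x) = emb q (T t x)) ∧
    ∀ τ : ℝ, 0 < τ → ∀ u : ℝ → ℂ, MemLp u 2 (volume.restrict (Ici 0)) →
      IntervalIntegrable (fun s => u s • S (τ - s) b) volume 0 τ ∧
      ∃ x : H, ∫ s in (0 : ℝ)..τ, u s • S (τ - s) b = emb q x

/-! ### Inputs and solutions -/

/-- `u ∈ L²_loc[0,∞)`. -/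
def IsL2loc (u : ℝ → ℂ) : Prop := ∀ τ : ℝ, 0 < τ → MemLp u 2 (volume.restrict (Icc 0 τ))

/-- `u ∈ H¹_loc(0,∞)`, i.e. the restriction of `u` to `(0,τ)` is in `H¹(0,τ)` for all `τ > 0`;
`u` stands for its continuous representative on `[0,∞)`. -/
def IsH1loc (u : ℝ → ℂ) : Prop :=
  ∃ v : ℝ → ℂ, IsL2loc v ∧ ∀ t : ℝ, 0 ≤ t → u t = u 0 + ∫ s in (0 : ℝ)..t, v s

/-- `A z + B_l d + B_r u`, an element of `X₋₁`. -/
def rhs {q : ℝ} (hq : 0 < q) (z : H) (d u : ℂ) : Xm1 q :=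
  Aext q z + d • Bl hq + u • Br hq

/-- `z` (restricted to `[0,∞)`) is a solution in `X₋₁` of `ż = A z + B_l d + B_r u`:
`z ∈ L¹_loc([0,∞); L²) ∩ C([0,∞); X₋₁)` and
`z(t) - z(0) = ∫₀ᵗ (A z + B_l d + B_r u) ds` in `X₋₁` for all `t ≥ 0`. -/
structure IsSolution {q : ℝ} (hq : 0 < q) (d u : ℝ → ℂ) (z : ℝ → H) : Prop where
  integrable : ∀ τ : ℝ, 0 < τ → IntegrableOn z (Icc 0 τ)
  cont : ContinuousOn (fun t => emb q (z t)) (Ici 0)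
  eqn : ∀ t : ℝ, 0 ≤ t →
    emb q (z t) - emb q (z 0) = ∫ s in (0 : ℝ)..t, rhs hq (z s) (d s) (u s)

/-- `(z, (d, u), (y, ym))` is a classical solution on `[0,∞)` of the abstract system
`ż = A z + B_l d + B_r u`, `y = C_e z`, `ym = C_m z` with `C_m f = f(1)`. -/
structure IsClassicalAbstract {q : ℝ} (hq : 0 < q) (Ce : H2 →L[ℂ] ℂ)
    (z : ℝ → H) (d u y ym : ℝ → ℂ) : Prop where
  smooth : ContDiffOn ℝ 1 z (Ici 0)
  cont_d : ContinuousOn d (Ici 0)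
  cont_u : ContinuousOn u (Ici 0)
  cont_y : ContinuousOn y (Ici 0)
  cont_ym : ContinuousOn ym (Ici 0)
  mem : ∀ t : ℝ, 0 ≤ t → ∃ h : H, rhs hq (z t) (d t) (u t) = emb q h
  eqn : ∀ t : ℝ, 0 ≤ t → emb q (derivWithin z (Ici 0) t) = rhs hq (z t) (d t) (u t)
  out : ∀ t : ℝ, 0 ≤ t → ∃ ζ : H2, ζ.1.1 = z t ∧ y t = Ce ζ ∧ ym t = pointValue ζ.1.1 1

/-- `(z, (d, u), (y, ym))` is a classical solution on `[0,∞)` of the boundary control system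
`z_t = -i z_xx`, `z_x(0,t) = -iq z(0,t) + d(t)`, `z_x(1,t) = u(t)`, `z(·,0) = z₀`,
`y(t) = C_e[z(·,t)]`, `ym(t) = z(1,t)`. Below, `ζ = (z(t), z_x(t), z_xx(t))`. -/
structure IsClassicalPDE (q : ℝ) (Ce : H2 →L[ℂ] ℂ) (z₀ : H)
    (z : ℝ → H) (d u y ym : ℝ → ℂ) : Prop where
  smooth : ContDiffOn ℝ 1 z (Ici 0)
  cont_d : ContinuousOn d (Ici 0)
  cont_u : ContinuousOn u (Ici 0)
  cont_y : ContinuousOn y (Ici 0)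
  cont_ym : ContinuousOn ym (Ici 0)
  init : z 0 = z₀
  eqn : ∀ t : ℝ, 0 ≤ t → ∃ ζ : H2, ζ.1.1 = z t ∧
    derivWithin z (Ici 0) t = -Complex.I • ζ.1.2.2 ∧
    pointValue ζ.1.2.1 0 = -Complex.I * q * pointValue ζ.1.1 0 + d t ∧
    pointValue ζ.1.2.1 1 = u t ∧
    y t = Ce ζ ∧ ym t = pointValue ζ.1.1 1

end Schrod

end

/-! The proof works with the bounded inverse `R = A⁻¹`. With `V g (x) = ∫ₓ¹ g` it is `R g = q⁻¹⟨1,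
g⟩ 1 - i V*V g`, and reversing the sign `σ` of `i` gives the inverse of `A*`. The extension `Aext :
H → X₋₁` is an isomorphism with `emb = Aext ∘ R`. Every equation in `X₋₁` therefore becomes an
equation in `H`, in which `B_l` and `B_r` are replaced by two explicit functions of degree at most
one.

Generation. The energy identity `Re⟨A f, f⟩ = q|f(0)|²` makes `-A` dissipative, so the backward
evolution is contractive. Forward in time the boundary term has the wrong sign. The multiplier `1 -
x` provides an equivalent quadratic form, `energyForm`, whose derivative along the flow contains an
extra `-2q|f(0)|²`. The other terms are bounded by `‖f‖²` and `|f(0)| ‖f‖`, so `A` is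
quasi-dissipative for this form (`VolterraRel.quasiDissipative`). The Yosida approximations `(R -
ε)⁻¹` then converge to a semigroup in each time direction (`exists_semigroup`), and the two are
glued into a group.

Admissibility. By duality, the traces at `0` and `1` along the adjoint group have to be bounded in
`L²(0, τ)` by the norm of the initial state. At `0` this is the integrated energy identity
(`VolterraRel.obsBound_one`). At `1` it comes from the multiplier `1`
(`VolterraRel.obsBound_trace_one`). A Hahn-Banach and Riesz argument turns these bounds into
reachable states in `H` that depend continuously on time (`IsGroupOf.exists_reachable`).

Solutions. Existence is the variation of constants formula `z(t) = T_t (z₀ + Ψ(t))`, where `Ψ`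
collects the reachable states. Uniqueness is that of the homogeneous equation. For `H¹` inputs, the
equation with differentiated inputs is solved from the initial velocity. The primitive of its
solution solves the original equation and so equals `z`, which gives `C¹` regularity. Solving the
stationary boundary value problem at each time then gives continuity in `H²`. -/

open MeasureTheory Set Filter Topology

noncomputable section

namespace Schrod

/-! ### Quasi-dissipative operators given by their inverse, and their Yosida approximations -/

section Generation

open NormedSpace ContinuousLinearMap

variable {E : Type*} [NormedAddCommGroup E] [InnerProductSpace ℂ E] [CompleteSpace E]

/-- The inverse `R⁻¹` of `R` is dissipative up to `w`, for the form given by `G`. -/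
structure QuasiDissipative (R G : E →L[ℂ] E) (w : ℝ) : Prop where
  nonneg : 0 ≤ w
  symm : ∀ x y, inner ℂ (G x) y = inner ℂ x (G y)
  lower : ∀ x, ‖x‖ ^ 2 / 2 ≤ (inner ℂ (G x) x).re
  diss : ∀ g, (inner ℂ (G g) (R g)).re ≤ w * ‖R g‖ ^ 2

theorem norm_sq_le_of_sub_smul (R : E →L[ℂ] E) (ε : ℝ) (g : E) :
    ‖R g‖ ^ 2 ≤ 2 * ‖R g - ε • g‖ ^ 2 + 2 * ε ^ 2 * ‖g‖ ^ 2 := by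
  have h : ‖R g‖ ≤ ‖R g - ε • g‖ + |ε| * ‖g‖ := by
    have := norm_add_le (R g - ε • g) (ε • g)
    rwa [sub_add_cancel, norm_smul, Real.norm_eq_abs] at this
  have h2 : ‖R g‖ ^ 2 ≤ (‖R g - ε • g‖ + |ε| * ‖g‖) ^ 2 := by gcongr
  have h3 := sq_nonneg (‖R g - ε • g‖ - |ε| * ‖g‖)
  have h4 : (|ε| * ‖g‖) ^ 2 = ε ^ 2 * ‖g‖ ^ 2 := by rw [mul_pow, sq_abs]
  nlinarith

/-- With `x = R g - ε g`, the vector `g` is the Yosida approximation `(R - ε)⁻¹` applied to `x`. The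
approximation therefore inherits the dissipativity estimate with `w` doubled. The gain `-ε⟨G g, g⟩`
absorbs the error made in replacing `R g` by `x`, provided `ε` is small, and a quarter of `ε‖g‖²` is
left over. -/
theorem QuasiDissipative.re_inner_le {R G : E →L[ℂ] E} {w : ℝ} (h : QuasiDissipative R G w)
    {ε : ℝ} (hε : 0 < ε) (hw : 8 * w * ε ≤ 1) (g : E) :
    (inner ℂ (G g) (R g - ε • g)).re + ε / 4 * ‖g‖ ^ 2 ≤ 2 * w * ‖R g - ε • g‖ ^ 2 := by
  have h1 := h.diss g
  have h2 := h.lower g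
  have h3 := norm_sq_le_of_sub_smul R ε g
  have e : (inner ℂ (G g) (R g - ε • g)).re =
      (inner ℂ (G g) (R g)).re - ε * (inner ℂ (G g) g).re := by
    rw [inner_sub_right, inner_smul_right_eq_smul, Complex.sub_re, Complex.real_smul,
      Complex.re_ofReal_mul]
  rw [e]
  have h4 : ε * (‖g‖ ^ 2 / 2) ≤ ε * (inner ℂ (G g) g).re := by gcongr
  have h5 := mul_le_mul_of_nonneg_left h3 h.nonneg
  have h6 : w * (2 * ε ^ 2 * ‖g‖ ^ 2) ≤ ε / 4 * ‖g‖ ^ 2 := by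
    have : 0 ≤ (1 - 8 * w * ε) * (ε * ‖g‖ ^ 2) := by
      apply mul_nonneg (by linarith); positivity
    nlinarith
  nlinarith

/-- The Yosida approximation `(R - ε)⁻¹` of `R⁻¹` is bounded by a multiple of `1 / ε`. -/
theorem QuasiDissipative.norm_le {R G : E →L[ℂ] E} {w : ℝ} (h : QuasiDissipative R G w)
    {ε : ℝ} (hε : 0 < ε) (hw : 8 * w * ε ≤ 1) (g : E) :
    ε * ‖g‖ ≤ (1 + 4 * ‖G‖) * ‖R g - ε • g‖ := by
  have h1 := h.re_inner_le hε hw g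
  set x := R g - ε • g
  have h2 : -(inner ℂ (G g) x).re ≤ ‖G‖ * ‖g‖ * ‖x‖ := by
    have := (Complex.abs_re_le_norm _).trans (norm_inner_le_norm (𝕜 := ℂ) (G g) x)
    have h3 : ‖G g‖ * ‖x‖ ≤ ‖G‖ * ‖g‖ * ‖x‖ := by gcongr; exact G.le_opNorm g
    linarith [neg_abs_le (inner ℂ (G g) x).re]
  have hw' := h.nonneg
  by_contra! hc
  have hG := norm_nonneg G
  have hx := norm_nonneg x
  have hg := norm_nonneg g
  -- with `a = ε ‖g‖`, `a² ≤ ‖x‖² + 4 ‖G‖ a ‖x‖`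
  have h5 : (ε * ‖g‖) ^ 2 ≤ ‖x‖ ^ 2 + 4 * ‖G‖ * (ε * ‖g‖) * ‖x‖ := by
    have h6 : 4 * ε * (ε / 4 * ‖g‖ ^ 2) ≤ 4 * ε * (2 * w * ‖x‖ ^ 2 + ‖G‖ * ‖g‖ * ‖x‖) := by
      gcongr; linarith
    have h7 : 8 * w * ε * ‖x‖ ^ 2 ≤ 1 * ‖x‖ ^ 2 := by gcongr
    nlinarith
  have h8 : ‖x‖ < ε * ‖g‖ := by nlinarith [mul_nonneg hG hx]
  have h9 : (1 + 4 * ‖G‖) * ‖x‖ * (ε * ‖g‖) < (ε * ‖g‖) * (ε * ‖g‖) := by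
    apply mul_lt_mul_of_pos_right hc; linarith
  nlinarith

/-- The lower bound for `R - ε` gives injectivity and closed range. The same bound for the adjoint
shows that nothing is orthogonal to the range. -/
theorem QuasiDissipative.isUnit {R G G' : E →L[ℂ] E} {w w' : ℝ} (h : QuasiDissipative R G w)
    (h' : QuasiDissipative (adjoint R) G' w') {ε : ℝ} (hε : 0 < ε) (hw : 8 * w * ε ≤ 1)
    (hw' : 8 * w' * ε ≤ 1) : IsUnit (R - ε • (1 : E →L[ℂ] E)) := by
  rw [isUnit_iff_bijective, bijective_iff_dense_range_and_antilipschitz]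
  constructor
  · rw [Submodule.topologicalClosure_eq_top_iff, Submodule.eq_bot_iff]
    intro x hx
    have h0 : adjoint R x - ε • x = 0 := by
      refine ext_inner_left ℂ fun v => ?_
      have := hx ((R - ε • (1 : E →L[ℂ] E)) v) ⟨v, rfl⟩
      rw [inner_zero_right, inner_sub_right, adjoint_inner_right, ← this]
      simp [inner_sub_left, inner_smul_left_eq_smul, inner_smul_right_eq_smul]
    have := h'.norm_le hε hw' x
    rw [h0, norm_zero, mul_zero] at this
    have h1 : ‖x‖ ≤ 0 := by
      by_contra! hc
      nlinarith [mul_pos hε hc]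
    simpa using h1
  · refine ⟨Real.toNNReal ((1 + 4 * ‖G‖) / ε), ?_⟩
    refine (R - ε • (1 : E →L[ℂ] E)).antilipschitz_of_bound fun x => ?_
    have := h.norm_le hε hw x
    rw [Real.coe_toNNReal _ (by positivity), div_mul_eq_mul_div, le_div_iff₀ hε, mul_comm ‖x‖]
    exact this

theorem hasDerivAt_exp_apply (B : E →L[ℂ] E) (x : E) (t : ℝ) :
    HasDerivAt (fun s : ℝ => exp (s • B) x) (B (exp (t • B) x)) t := by
  have h := hasDerivAt_exp_smul_const' (𝕂 := ℝ) B t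
  exact ((ContinuousLinearMap.apply ℂ E x).restrictScalars ℝ).hasFDerivAt.comp_hasDerivAt t h

/-- Gronwall for the energy `e = ⟨G x, x⟩` along an orbit: `e' ≤ 2c‖x‖² ≤ 4c e`, the second step by
the lower bound on `G`. The constants do not involve `‖B‖`, so the estimate is uniform over the
Yosida approximations. -/
theorem norm_exp_le {B G : E →L[ℂ] E} {c : ℝ} (hc : 0 ≤ c)
    (symm : ∀ x y, inner ℂ (G x) y = inner ℂ x (G y))
    (lower : ∀ x, ‖x‖ ^ 2 / 2 ≤ (inner ℂ (G x) x).re)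
    (hB : ∀ x, (inner ℂ (G (B x)) x).re ≤ c * ‖x‖ ^ 2) {t : ℝ} (ht : 0 ≤ t) :
    ‖exp (t • B)‖ ≤ (1 + 2 * ‖G‖) * Real.exp (2 * c * t) := by
  refine opNorm_le_bound _ (by positivity) fun x => ?_
  set e : ℝ → ℝ := fun s => (inner ℂ (G (exp (s • B) x)) (exp (s • B) x)).re
  have hd : ∀ s, HasDerivAt e (2 * (inner ℂ (G (B (exp (s • B) x))) (exp (s • B) x)).re) s := by
    intro s
    have h1 := hasDerivAt_exp_apply B x s
    have h2 : HasDerivAt (fun s : ℝ => G (exp (s • B) x)) (G (B (exp (s • B) x))) s :=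
      (G.restrictScalars ℝ).hasFDerivAt.comp_hasDerivAt s h1
    have h3 := h2.inner ℂ h1
    have h4 := Complex.reCLM.hasFDerivAt.comp_hasDerivAt s h3
    refine h4.congr_deriv ?_
    rw [Complex.reCLM_apply, Complex.add_re, symm (exp (s • B) x), ← inner_conj_symm,
      Complex.conj_re]
    ring
  have hanti : Antitone fun s : ℝ => Real.exp (-(4 * c * s)) * e s := by
    have hd2 : ∀ s, HasDerivAt (fun s : ℝ => Real.exp (-(4 * c * s)) * e s)
        (Real.exp (-(4 * c * s)) * (-(4 * c)) * e s + Real.exp (-(4 * c * s)) *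
          (2 * (inner ℂ (G (B (exp (s • B) x))) (exp (s • B) x)).re)) s := by
      intro s
      have h1 : HasDerivAt (fun s : ℝ => -(4 * c * s)) (-(4 * c)) s := by
        simpa using ((hasDerivAt_id' s).const_mul (4 * c)).fun_neg
      exact h1.exp.mul (hd s)
    refine antitone_of_deriv_nonpos (fun s => (hd2 s).differentiableAt) fun s => ?_
    rw [(hd2 s).deriv]
    have h1 := lower (exp (s • B) x)
    have h2 := hB (exp (s • B) x)
    have h3 : c * (‖exp (s • B) x‖ ^ 2 / 2) ≤ c * e s := by gcongr
    have h4 : 0 ≤ Real.exp (-(4 * c * s)) *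
        (4 * (c * e s) - 2 * (inner ℂ (G (B (exp (s • B) x))) (exp (s • B) x)).re) := by
      apply mul_nonneg (Real.exp_pos _).le; linarith
    linarith
  have h5 := hanti ht
  simp only [mul_zero, neg_zero, Real.exp_zero, one_mul] at h5
  have h6 : e 0 ≤ ‖G‖ * ‖x‖ ^ 2 := by
    have : e 0 = (inner ℂ (G x) x).re := by simp [e]
    rw [this]
    have h7 := (Complex.re_le_norm _).trans (norm_inner_le_norm (𝕜 := ℂ) (G x) x)
    have h8 : ‖G x‖ * ‖x‖ ≤ ‖G‖ * ‖x‖ * ‖x‖ := by gcongr; exact G.le_opNorm x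
    linarith
  have h9 : ‖exp (t • B) x‖ ^ 2 ≤ 2 * ‖G‖ * Real.exp (4 * c * t) * ‖x‖ ^ 2 := by
    have h10 := lower (exp (t • B) x)
    have h11 : e t ≤ Real.exp (4 * c * t) * (‖G‖ * ‖x‖ ^ 2) := by
      have h12 : Real.exp (4 * c * t) * (Real.exp (-(4 * c * t)) * e t) ≤
          Real.exp (4 * c * t) * (‖G‖ * ‖x‖ ^ 2) :=
        mul_le_mul_of_nonneg_left (h5.trans h6) (Real.exp_pos _).le
      rwa [← mul_assoc, ← Real.exp_add, add_neg_cancel, Real.exp_zero, one_mul] at h12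
    have : ‖exp (t • B) x‖ ^ 2 / 2 ≤ e t := h10
    linarith
  have h13 : Real.exp (4 * c * t) = Real.exp (2 * c * t) ^ 2 := by
    rw [← Real.exp_nat_mul]; congr 1; push_cast; ring
  refine abs_le_of_sq_le_sq' ?_ (by positivity) |>.2
  refine h9.trans ?_
  rw [h13, mul_pow, mul_pow]
  have : 2 * ‖G‖ ≤ (1 + 2 * ‖G‖) ^ 2 := by nlinarith [norm_nonneg G]
  gcongr

theorem exp_add_of_commute_clm {X Z : E →L[ℂ] E} (h : Commute X Z) :
    exp (X + Z) = exp X * exp Z := by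
  let _ : NormedAlgebra ℚ (E →L[ℂ] E) := NormedAlgebra.restrictScalars ℚ ℂ _
  exact exp_add_of_commute h

/-- Comparison of the orbits of two commuting bounded generators. -/
theorem norm_exp_sub_exp_le {X Z : E →L[ℂ] E} (hXZ : Commute X Z) {C D : ℝ}
    (hX : ∀ r ∈ Icc (0 : ℝ) 1, ‖exp (r • X)‖ ≤ C) (hZ : ∀ r ∈ Icc (0 : ℝ) 1, ‖exp (r • Z)‖ ≤ D)
    (x : E) : ‖exp X x - exp Z x‖ ≤ C * D * ‖(X - Z) x‖ := by
  have mul_app : ∀ (S T : E →L[ℂ] E) (y : E), S (T y) = (S * T) y := fun _ _ _ => rfl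
  -- The path `r ↦ exp(r(X - Z)) exp(Z) x` joins `exp(Z) x` to `exp(X) x`. By commutativity its
  -- velocity is `exp(rX) exp((1 - r)Z) (X - Z) x`, which the hypotheses bound.
  have hd : ∀ r : ℝ, HasDerivAt (fun r : ℝ => exp (r • (X - Z)) (exp Z x))
      ((X - Z) (exp (r • (X - Z)) (exp Z x))) r := fun r => hasDerivAt_exp_apply _ _ r
  have key : ∀ r : ℝ, (X - Z) (exp (r • (X - Z)) (exp Z x)) =
      (exp (r • X) * exp ((1 - r) • Z)) ((X - Z) x) := by
    intro r
    have c1 : Commute (r • (X - Z)) Z :=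
      ((hXZ.sub_left (Commute.refl Z)).smul_left r)
    have c2 : Commute (r • X) ((1 - r) • Z) := (hXZ.smul_left r).smul_right (1 - r)
    have c3 : Commute (X - Z) (exp (r • X + (1 - r) • Z)) := by
      refine Commute.exp_right ?_
      exact ((((Commute.refl X).sub_left hXZ.symm).smul_right r).add_right
        ((hXZ.sub_left (Commute.refl Z)).smul_right (1 - r)))
    rw [mul_app, mul_app, mul_app, mul_assoc, ← exp_add_of_commute_clm c1,
      ← exp_add_of_commute_clm c2, ← c3.eq]
    congr 3
    module
  have h := (convex_Icc (0 : ℝ) 1).norm_image_sub_le_of_norm_hasDerivWithin_le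
    (f := fun r : ℝ => exp (r • (X - Z)) (exp Z x)) (C := C * D * ‖(X - Z) x‖)
    (fun r _ => (hd r).hasDerivWithinAt) (fun r hr => ?_) (x := 0) (y := 1) (by simp) (by simp)
  · have c1 : Commute (X - Z) Z := (hXZ.sub_left (Commute.refl Z))
    have e1 : exp (X - Z) (exp Z x) = exp X x := by
      rw [mul_app, ← exp_add_of_commute_clm c1, sub_add_cancel]
    simpa [e1] using h
  · rw [key r]
    refine (le_opNorm _ _).trans ?_
    gcongr
    refine (norm_mul_le _ _).trans ?_
    have h0 := hX r hr
    gcongr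
    · exact (norm_nonneg _).trans h0
    · exact hZ _ ⟨by linarith [hr.2], by linarith [hr.1]⟩

end Generation

end Schrod

end

open MeasureTheory Set Filter Topology

noncomputable section

namespace Schrod

/-! ### Passage to the limit, and generation of a group by `R⁻¹` -/

section Limit

open NormedSpace ContinuousLinearMap

variable {E : Type*} [NormedAddCommGroup E] [InnerProductSpace ℂ E] [CompleteSpace E]

theorem cauchySeq_of_dense {E : Type*} [NormedAddCommGroup E] [InnerProductSpace ℂ E] {S : ℕ → E →L[ℂ] E} {C : ℝ} (hS : ∀ n, ‖S n‖ ≤ C)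
    {R : E →L[ℂ] E} (hR : DenseRange R) (h : ∀ g, CauchySeq fun n => S n (R g)) (x : E) :
    CauchySeq fun n => S n x := by
  rw [Metric.cauchySeq_iff]
  intro ε hε
  have hC : 0 ≤ C := (norm_nonneg _).trans (hS 0)
  obtain ⟨g, hg⟩ := hR.exists_dist_lt x (show 0 < ε / (3 * (C + 1)) by positivity)
  obtain ⟨N, hN⟩ := Metric.cauchySeq_iff.1 (h g) (ε / 3) (by positivity)
  have h1 : ∀ n, dist (S n x) (S n (R g)) < ε / 3 := by
    intro n
    rw [dist_eq_norm, ← map_sub]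
    rw [dist_eq_norm] at hg
    calc ‖S n (x - R g)‖ ≤ C * ‖x - R g‖ := (S n).le_of_opNorm_le (hS n) _
      _ ≤ (C + 1) * ‖x - R g‖ := by gcongr; linarith
      _ < (C + 1) * (ε / (3 * (C + 1))) := by gcongr
      _ = ε / 3 := by field_simp
  refine ⟨N, fun m hm n hn => ?_⟩
  have h2 := dist_triangle4 (S m x) (S m (R g)) (S n (R g)) (S n x)
  have h3 := h1 m
  have h4 := h1 n
  rw [dist_comm] at h4
  linarith [hN m hm n hn]

/-- The limit of the semigroups generated by the bounded approximations `B n` of `R⁻¹`. -/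
theorem exists_semigroup {R : E →L[ℂ] E} (hR : DenseRange R) {B : ℕ → E →L[ℂ] E}
    (hBB : ∀ m n, Commute (B m) (B n)) (hBR : ∀ n, Commute (B n) R) {K c : ℝ} (hc : 0 ≤ c)
    (hK : ∀ n, ∀ t : ℝ, 0 ≤ t → ‖exp (t • B n)‖ ≤ K * Real.exp (c * t))
    (hlim : ∀ g, Tendsto (fun n => B n (R g)) atTop (𝓝 g)) :
    ∃ T : ℝ → E →L[ℂ] E, T 0 = 1 ∧ (∀ t, 0 ≤ t → ‖T t‖ ≤ K * Real.exp (c * t)) ∧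
      (∀ t, 0 ≤ t → ∀ x, T t (R x) = R (T t x)) ∧
      (∀ x, ContinuousOn (fun t => T t x) (Ici 0)) ∧
      ∀ t, 0 ≤ t → ∀ g, T t (R g) - R g = ∫ s in (0 : ℝ)..t, T s g := by
  have hK0 : 0 ≤ K := by
    have := (norm_nonneg _).trans (hK 0 0 le_rfl)
    simpa using this
  have hK' : ∀ n, ∀ t τ : ℝ, 0 ≤ t → t ≤ τ → ‖exp (t • B n)‖ ≤ K * Real.exp (c * τ) :=
    fun n t τ h0 h1 => (hK n t h0).trans (by gcongr)
  have hscale : ∀ n, ∀ t τ : ℝ, 0 ≤ t → t ≤ τ → ∀ r ∈ Icc (0 : ℝ) 1,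
      ‖exp (r • (t • B n))‖ ≤ K * Real.exp (c * τ) := by
    intro n t τ h0 h1 r hr
    rw [smul_smul]
    refine hK' n _ _ (mul_nonneg hr.1 h0) (le_trans ?_ h1)
    exact mul_le_of_le_one_left h0 hr.2
  have hcau : ∀ t : ℝ, 0 ≤ t → ∀ x, CauchySeq fun n => exp (t • B n) x := by
    intro t ht
    refine cauchySeq_of_dense (fun n => hK n t ht) hR fun g => ?_
    -- On the range of `R`, differences of orbits are bounded by differences of `B n (R g)`, and
    -- this sequence converges to `g`. Uniform boundedness and density give the other vectors.
    have h1 := (hlim g).cauchySeq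
    rw [Metric.cauchySeq_iff'] at h1 ⊢
    intro ε hε
    set D := K * Real.exp (c * t) * (K * Real.exp (c * t)) * t with hD
    have hD0 : 0 ≤ D := by positivity
    obtain ⟨N, hN⟩ := h1 (ε / (D + 1)) (by positivity)
    refine ⟨N, fun n hn => ?_⟩
    have h2 := norm_exp_sub_exp_le (((hBB n N).smul_left t).smul_right t)
      (hscale n t t ht le_rfl) (hscale N t t ht le_rfl) (R g)
    have h3 := hN n hn
    rw [dist_eq_norm] at h3 ⊢
    calc _ ≤ _ := h2
      _ = D * ‖B n (R g) - B N (R g)‖ := by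
        rw [← smul_sub, smul_apply, norm_smul, Real.norm_eq_abs, abs_of_nonneg ht, sub_apply]
        ring
      _ ≤ (D + 1) * ‖B n (R g) - B N (R g)‖ := by gcongr; linarith
      _ < (D + 1) * (ε / (D + 1)) := by gcongr
      _ = ε := by field_simp
  choose L hL using fun (t : ℝ) (ht : 0 ≤ t) (x : E) => cauchySeq_tendsto_of_complete (hcau t ht x)
  have hop : ∀ t : ℝ, ∃ S : E →L[ℂ] E, ∀ ht : 0 ≤ t, ∀ x, S x = L t ht x := by
    intro t
    by_cases ht : 0 ≤ t
    · have hp : Tendsto (fun n x => exp (t • B n) x) atTop (𝓝 (L t ht)) :=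
        tendsto_pi_nhds.2 (hL t ht)
      exact ⟨continuousLinearMapOfTendsto (fun n => exp (t • B n)) hp, fun _ x => rfl⟩
    · exact ⟨0, fun h => absurd h ht⟩
  choose T hT using hop
  have hlimT : ∀ t : ℝ, 0 ≤ t → ∀ x, Tendsto (fun n => exp (t • B n) x) atTop (𝓝 (T t x)) :=
    fun t ht x => by rw [hT t ht x]; exact hL t ht x
  have hbd : ∀ t, 0 ≤ t → ‖T t‖ ≤ K * Real.exp (c * t) := by
    intro t ht
    refine opNorm_le_bound _ (by positivity) fun x => ?_
    exact le_of_tendsto (hlimT t ht x).norm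
      (Eventually.of_forall fun n => le_of_opNorm_le _ (hK n t ht) x)
  have hcont : ∀ x, ContinuousOn (fun t => T t x) (Ici 0) := by
    intro x
    have hloc : ∀ τ : ℝ, ContinuousOn (fun t => T t x) (Icc 0 τ) := by
      intro τ
      have hLip : ∀ g, ContinuousOn (fun t => T t (R g)) (Icc 0 τ) := by
        intro g
        have : LipschitzOnWith (Real.toNNReal (K * Real.exp (c * τ) * (K * Real.exp (c * τ)) * ‖g‖))
            (fun t => T t (R g)) (Icc 0 τ) := by
          refine LipschitzOnWith.of_dist_le_mul fun t ht s hs => ?_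
          rw [Real.coe_toNNReal _ (by positivity), dist_eq_norm]
          have h1 : Tendsto (fun n => K * Real.exp (c * τ) * (K * Real.exp (c * τ)) *
              (|t - s| * ‖B n (R g)‖)) atTop (𝓝 (K * Real.exp (c * τ) * (K * Real.exp (c * τ)) *
              (|t - s| * ‖g‖))) := ((hlim g).norm.const_mul _).const_mul _
          have h2 := ((hlimT t ht.1 (R g)).sub (hlimT s hs.1 (R g))).norm
          have h3 := le_of_tendsto_of_tendsto' h2 h1 fun n => by
            have := norm_exp_sub_exp_le (((Commute.refl (B n)).smul_left t).smul_right s)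
              (hscale n t τ ht.1 ht.2) (hscale n s τ hs.1 hs.2) (R g)
            rwa [← sub_smul, smul_apply, norm_smul, Real.norm_eq_abs] at this
          rw [Real.dist_eq]
          linarith
        exact this.continuousOn
      -- On `[0, τ]` the orbit of `x` is a uniform limit of the Lipschitz orbits starting in the
      -- range of `R`.
      refine continuousOn_of_uniform_approx_of_continuousOn fun u hu => ?_
      obtain ⟨ε, hε, hεu⟩ := Metric.mem_uniformity_dist.1 hu
      obtain ⟨g, hg⟩ := hR.exists_dist_lt x
        (show 0 < ε / (K * Real.exp (c * τ) + 1) by positivity)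
      refine ⟨_, hLip g, fun t ht => hεu ?_⟩
      rw [dist_eq_norm] at hg ⊢
      rw [← map_sub]
      have h1 : ‖T t‖ ≤ K * Real.exp (c * τ) :=
        (hbd t ht.1).trans (by gcongr; exact ht.2)
      calc _ ≤ K * Real.exp (c * τ) * ‖x - R g‖ := le_of_opNorm_le _ h1 _
        _ ≤ (K * Real.exp (c * τ) + 1) * ‖x - R g‖ := by gcongr; linarith
        _ < (K * Real.exp (c * τ) + 1) * (ε / (K * Real.exp (c * τ) + 1)) := by gcongr
        _ = ε := by field_simp
    intro t ht
    have := hloc (t + 1) t ⟨ht, by linarith⟩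
    refine this.mono_of_mem_nhdsWithin ?_
    rw [← Ici_inter_Iic]
    exact inter_mem self_mem_nhdsWithin (mem_nhdsWithin_of_mem_nhds (Iic_mem_nhds (by linarith)))
  refine ⟨T, ?_, hbd, ?_, hcont, ?_⟩
  · ext x
    have h1 := hlimT 0 le_rfl x
    simp only [zero_smul, exp_zero] at h1
    exact tendsto_nhds_unique h1 tendsto_const_nhds
  · intro t ht x
    have h1 := hlimT t ht (R x)
    have h2 := (R.continuous.tendsto _).comp (hlimT t ht x)
    refine tendsto_nhds_unique h1 (h2.congr fun n => ?_)
    have : Commute R (exp (t • B n)) := Commute.exp_right ((hBR n).symm.smul_right t)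
    exact congrArg (fun S : E →L[ℂ] E => S x) this.eq
  · intro t ht g
    have h1 : ∀ n, exp (t • B n) (R g) - R g = ∫ s in (0 : ℝ)..t, exp (s • B n) (B n (R g)) := by
      intro n
      have hc : ∀ s : ℝ, B n (exp (s • B n) (R g)) = exp (s • B n) (B n (R g)) := fun s => by
        have : Commute (B n) (exp (s • B n)) :=
          Commute.exp_right ((Commute.refl (B n)).smul_right s)
        exact congrArg (fun S : E →L[ℂ] E => S (R g)) this.eq
      rw [intervalIntegral.integral_eq_sub_of_hasDerivAt
        (fun s _ => (hc s) ▸ hasDerivAt_exp_apply (B n) (R g) s)]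
      · simp
      · refine Continuous.intervalIntegrable ?_ _ _
        exact continuous_iff_continuousAt.2 fun s =>
          (hasDerivAt_exp_apply (B n) (B n (R g)) s).continuousAt
    have h2 : Tendsto (fun n => exp (t • B n) (R g) - R g) atTop (𝓝 (T t (R g) - R g)) :=
      (hlimT t ht (R g)).sub_const _
    refine tendsto_nhds_unique h2 ?_
    simp_rw [h1]
    obtain ⟨D, hD⟩ := (hlim g).norm.bddAbove_range
    have hD' : ∀ n, ‖B n (R g)‖ ≤ D := fun n => hD ⟨n, rfl⟩
    have hmem : ∀ s ∈ uIoc 0 t, 0 ≤ s ∧ s ≤ t := fun s hs => by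
      rw [uIoc_of_le ht] at hs
      exact ⟨hs.1.le, hs.2⟩
    refine intervalIntegral.tendsto_integral_filter_of_dominated_convergence
      (fun _ => K * Real.exp (c * t) * D) ?_ ?_ ?_ ?_
    · refine Eventually.of_forall fun n => Continuous.aestronglyMeasurable ?_
      exact continuous_iff_continuousAt.2 fun s =>
        (hasDerivAt_exp_apply (B n) (B n (R g)) s).continuousAt
    · refine Eventually.of_forall fun n => Eventually.of_forall fun s hs => ?_
      refine (le_of_opNorm_le _ (hK' n s t (hmem s hs).1 (hmem s hs).2) _).trans ?_
      gcongr
      exact hD' n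
    · exact intervalIntegrable_const
    · refine Eventually.of_forall fun s hs => ?_
      have h3 := hlimT s (hmem s hs).1 g
      have h4 : Tendsto (fun n => exp (s • B n) (B n (R g) - g)) atTop (𝓝 0) := by
        have h5 : Tendsto (fun n => K * Real.exp (c * t) * ‖B n (R g) - g‖) atTop (𝓝 0) := by
          have := (tendsto_iff_norm_sub_tendsto_zero.1 (hlim g)).const_mul (K * Real.exp (c * t))
          rwa [mul_zero] at this
        exact squeeze_zero_norm
          (fun n => le_of_opNorm_le _ (hK' n s t (hmem s hs).1 (hmem s hs).2) _) h5
      have h6 := h4.add h3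
      rw [zero_add] at h6
      refine h6.congr fun n => ?_
      rw [← map_add, sub_add_cancel]

/-- `T` is the group of operators generated by `R⁻¹`. -/
structure IsGroupOf (R : E →L[ℂ] E) (T : ℝ → E →L[ℂ] E) : Prop where
  zero : T 0 = 1
  comm : ∀ t x, T t (R x) = R (T t x)
  bound : ∀ τ, ∃ K, ∀ t, |t| ≤ τ → ‖T t‖ ≤ K
  cont : ∀ x, Continuous fun t => T t x
  integral : ∀ t g, T t (R g) - R g = ∫ s in (0 : ℝ)..t, T s g

/-- The semigroup of `R` serves for `t ≥ 0`, and that of `-R`, run at `-t`, for `t ≤ 0`. The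
integrated equation has the same form on both halves, which is all that `IsGroupOf` asks. The group
law is derived from it in `IsGroupOf.add`. -/
theorem exists_isGroupOf {R : E →L[ℂ] E} (hR : DenseRange R) {B B' : ℕ → E →L[ℂ] E}
    (hBB : ∀ m n, Commute (B m) (B n)) (hBR : ∀ n, Commute (B n) R)
    (hBB' : ∀ m n, Commute (B' m) (B' n)) (hBR' : ∀ n, Commute (B' n) R)
    {K c : ℝ} (hc : 0 ≤ c)
    (hK : ∀ n, ∀ t : ℝ, 0 ≤ t → ‖exp (t • B n)‖ ≤ K * Real.exp (c * t))
    (hlim : ∀ g, Tendsto (fun n => B n (R g)) atTop (𝓝 g))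
    {K' c' : ℝ} (hc' : 0 ≤ c')
    (hK' : ∀ n, ∀ t : ℝ, 0 ≤ t → ‖exp (t • B' n)‖ ≤ K' * Real.exp (c' * t))
    (hlim' : ∀ g, Tendsto (fun n => B' n (-R g)) atTop (𝓝 g)) :
    ∃ T : ℝ → E →L[ℂ] E, IsGroupOf R T := by
  obtain ⟨P, hP0, hPb, hPR, hPc, hPi⟩ := exists_semigroup hR hBB hBR hc hK hlim
  have hRn : DenseRange (-R) := by
    have : DenseRange (Neg.neg : E → E) := (neg_surjective).denseRange
    exact this.comp hR continuous_neg
  obtain ⟨N, hN0, hNb, hNR, hNc, hNi⟩ := exists_semigroup (R := -R) hRn hBB'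
    (fun n => (hBR' n).neg_right) hc' hK' hlim'
  have hTP : ∀ t : ℝ, 0 ≤ t → (if 0 ≤ t then P t else N (-t)) = P t := fun t ht => if_pos ht
  have hTN : ∀ t : ℝ, t ≤ 0 → (if 0 ≤ t then P t else N (-t)) = N (-t) := fun t ht => by
    rcases ht.eq_or_lt with rfl | h
    · simp [hP0, hN0]
    · rw [if_neg h.not_ge]
  refine ⟨fun t => if 0 ≤ t then P t else N (-t), ?_, ?_, ?_, ?_, ?_⟩
  · simp [hP0]
  · intro t x
    rcases le_total 0 t with ht | ht
    · rw [hTP t ht, hPR t ht]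
    · rw [hTN t ht]
      have := hNR (-t) (by linarith) x
      simpa using this
  · intro τ
    refine ⟨max (K * Real.exp (c * τ)) (K' * Real.exp (c' * τ)), fun t ht => ?_⟩
    have hk0 : 0 ≤ K := by simpa using (norm_nonneg _).trans (hK 0 0 le_rfl)
    have hk0' : 0 ≤ K' := by simpa using (norm_nonneg _).trans (hK' 0 0 le_rfl)
    obtain ⟨h1, h2⟩ := abs_le.1 ht
    rcases le_total 0 t with h | h
    · rw [hTP t h]
      refine ((hPb t h).trans ?_).trans (le_max_left _ _)
      gcongr
    · rw [hTN t h]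
      refine ((hNb (-t) (by linarith)).trans ?_).trans (le_max_right _ _)
      gcongr
      linarith
  · intro x
    rw [← continuousOn_univ, ← Iic_union_Ici (a := (0 : ℝ))]
    refine ContinuousOn.union_of_isClosed ?_ ?_ isClosed_Iic isClosed_Ici
    · have : ContinuousOn (fun t => N (-t) x) (Iic 0) :=
        (hNc x).comp continuousOn_neg fun t ht => by simpa using ht
      exact this.congr fun t ht => by simp only; rw [hTN t ht]
    · exact (hPc x).congr fun t ht => by simp only; rw [hTP t ht]
  · intro t g
    rcases le_total 0 t with ht | ht
    · rw [hTP t ht, hPi t ht]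
      refine intervalIntegral.integral_congr fun s hs => ?_
      rw [uIcc_of_le ht] at hs
      rw [hTP s hs.1]
    · rw [hTN t ht]
      have h1 := hNi (-t) (by linarith) g
      have h2 : ∫ s in (0 : ℝ)..t, (if 0 ≤ s then P s else N (-s)) g =
          ∫ s in (0 : ℝ)..t, N (-s) g := by
        refine intervalIntegral.integral_congr fun s hs => ?_
        rw [uIcc_of_ge ht] at hs
        rw [hTN s hs.2]
      rw [h2, intervalIntegral.integral_comp_neg (fun s => N s g), neg_zero,
        intervalIntegral.integral_symm, ← h1]
      simp only [neg_apply, map_neg]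
      abel

namespace QuasiDissipative

/-- The approximations of `R⁻¹` obtained from the resolvent. -/
theorem exists_approx {R G G' : E →L[ℂ] E} {w w' : ℝ} (hR : DenseRange R)
    (h : QuasiDissipative R G w)
    (h' : QuasiDissipative (adjoint R) G' w') : ∃ B : ℕ → E →L[ℂ] E,
      (∀ m n, Commute (B m) (B n)) ∧ (∀ n S, Commute S R → Commute (B n) S) ∧
      (∀ n, ∀ t : ℝ, 0 ≤ t → ‖exp (t • B n)‖ ≤ (1 + 2 * ‖G‖) * Real.exp (4 * w * t)) ∧
      ∀ g, Tendsto (fun n => B n (R g)) atTop (𝓝 g) := by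
  -- A sequence tending to `0` whose terms all satisfy the smallness conditions for both `w` and
  -- `w'`.
  set ε : ℕ → ℝ := fun n => 1 / (8 * (w + w') + 1) * (1 / ((n : ℝ) + 1)) with hεd
  have hw := h.nonneg
  have hw' := h'.nonneg
  have hε : ∀ n, 0 < ε n := fun n => by positivity
  have hεle : ∀ n, ε n ≤ 1 / (8 * (w + w') + 1) := fun n => by
    have : 1 / ((n : ℝ) + 1) ≤ 1 := by
      rw [div_le_one (by positivity)]; linarith [n.cast_nonneg (α := ℝ)]
    exact mul_le_of_le_one_right (by positivity) this
  have hε1 : ∀ n, (8 * (w + w') + 1) * ε n ≤ 1 := fun n => by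
    have := hεle n
    rwa [le_div_iff₀ (by positivity), mul_comm] at this
  have hε2 : ∀ n, 8 * w * ε n ≤ 1 := fun n => by nlinarith [hε n, hε1 n, mul_nonneg hw' (hε n).le]
  have hε3 : ∀ n, 8 * w' * ε n ≤ 1 := fun n => by nlinarith [hε n, hε1 n, mul_nonneg hw (hε n).le]
  have hε0 : Tendsto ε atTop (𝓝 0) := by
    have := (tendsto_one_div_add_atTop_nhds_zero_nat (𝕜 := ℝ)).const_mul
      (1 / (8 * (w + w') + 1))
    rwa [mul_zero] at this
  choose U hU using fun n => h.isUnit h' (hε n) (hε2 n) (hε3 n)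
  set B : ℕ → E →L[ℂ] E := fun n => ((U n)⁻¹ : (E →L[ℂ] E)ˣ)
  have hB1 : ∀ n x, R (B n x) - ε n • B n x = x := fun n x => by
    have : (U n : E →L[ℂ] E) * B n = 1 := (U n).mul_inv
    rw [hU] at this
    exact congrArg (fun S : E →L[ℂ] E => S x) this
  have hB2 : ∀ n x, B n (R x) - ε n • B n x = x := fun n x => by
    have : B n * (U n : E →L[ℂ] E) = 1 := (U n).inv_mul
    rw [hU] at this
    have := congrArg (fun S : E →L[ℂ] E => S x) this
    simpa [B, map_sub] using this
  have hcomm : ∀ n S, Commute S R → Commute (B n) S := fun n S hS => by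
    have : Commute S (U n : E →L[ℂ] E) := by
      rw [hU]
      exact hS.sub_right ((Commute.one_right S).smul_right _)
    exact this.units_inv_right.symm
  refine ⟨B, fun m n => hcomm m _ (hcomm n R (Commute.refl R)), hcomm, ?_, ?_⟩
  · intro n t ht
    have h1 := norm_exp_le (B := B n) (c := 2 * w) (by positivity) h.symm h.lower
      (fun x => by
        have h2 := h.re_inner_le (hε n) (hε2 n) (B n x)
        rw [hB1] at h2
        have : 0 ≤ ε n / 4 * ‖B n x‖ ^ 2 := by have := hε n; positivity
        linarith) ht
    refine h1.trans (le_of_eq ?_)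
    congr 2; ring
  · -- `ε B_ε → 0` strongly
    have hb : ∀ n x, ‖ε n • B n x‖ ≤ (1 + 4 * ‖G‖) * ‖x‖ := fun n x => by
      have := h.norm_le (hε n) (hε2 n) (B n x)
      rwa [hB1, ← abs_of_pos (hε n), ← Real.norm_eq_abs, ← norm_smul] at this
    have hz : ∀ x, Tendsto (fun n => ε n • B n x) atTop (𝓝 0) := by
      intro x
      rw [Metric.tendsto_atTop]
      intro δ hδ
      set C := 1 + 4 * ‖G‖
      have hC : 0 < C := by positivity
      obtain ⟨g, hg⟩ := hR.exists_dist_lt x (show 0 < δ / (2 * C) by positivity)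
      have hlim : Tendsto (fun n : ℕ => ε n * (1 + C) * ‖g‖) atTop (𝓝 0) := by
        have := (hε0.mul_const (1 + C)).mul_const ‖g‖
        simpa using this
      obtain ⟨N, hN⟩ := (Metric.tendsto_atTop.1 hlim) (δ / 2) (by positivity)
      refine ⟨N, fun n hn => ?_⟩
      rw [dist_zero_right]
      -- Since `B R = 1 + ε B`, the part `R g` of `x` contributes `O(ε)`. The remainder `x - R g` is
      -- small, and `ε B` is uniformly bounded.
      have h1 : ε n • B n x = ε n • B n (x - R g) + ε n • (g + ε n • B n g) := by
        rw [← smul_add]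
        congr 1
        have h3 : B n (R g) = g + ε n • B n g := by
          exact sub_eq_iff_eq_add.1 (hB2 n g)
        rw [← h3, ← map_add, sub_add_cancel]
      have h2 := hN n hn
      rw [Real.dist_eq, sub_zero] at h2
      have h4 : ‖ε n • (g + ε n • B n g)‖ ≤ ε n * (1 + C) * ‖g‖ := by
        rw [norm_smul, Real.norm_eq_abs, abs_of_pos (hε n), mul_assoc (ε n)]
        refine mul_le_mul_of_nonneg_left ?_ (hε n).le
        have h5 := norm_add_le g (ε n • B n g)
        have h6 := hb n g
        linarith
      have h5 := hb n (x - R g)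
      rw [dist_eq_norm] at hg
      have h6 : C * ‖x - R g‖ < δ / 2 := by
        calc C * ‖x - R g‖ < C * (δ / (2 * C)) := by gcongr
          _ = δ / 2 := by field_simp
      rw [h1]
      refine (norm_add_le _ _).trans_lt ?_
      linarith [le_abs_self (ε n * (1 + C) * ‖g‖)]
    intro g
    have := (hz g).const_add g
    rw [add_zero] at this
    refine this.congr fun n => ?_
    exact (sub_eq_iff_eq_add.1 (hB2 n g)).symm

end QuasiDissipative

/-- Generation of a group by `R⁻¹` in the Hilbert space `E`. -/
theorem exists_isGroupOf_of_quasiDissipative {R G G' : E →L[ℂ] E} {w w' : ℝ} (hR : DenseRange R)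
    (h : QuasiDissipative R G w) (h' : QuasiDissipative (adjoint R) G' w')
    (hacc : ∀ g, 0 ≤ (inner ℂ g (R g)).re) : ∃ T : ℝ → E →L[ℂ] E, IsGroupOf R T := by
  -- Accretivity of `R` is dissipativity of `-R` for the original inner product, without growth, and
  -- it passes to the adjoint.
  have hn : QuasiDissipative (-R) 1 0 := by
    refine ⟨le_rfl, fun x y => rfl, fun x => ?_, fun g => ?_⟩
    · change ‖x‖ ^ 2 / 2 ≤ (inner ℂ x x).re
      have : (inner ℂ x x).re = ‖x‖ ^ 2 := inner_self_eq_norm_sq (𝕜 := ℂ) x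
      linarith [sq_nonneg ‖x‖]
    · have := hacc g
      change (inner ℂ g (-R g)).re ≤ _
      simp only [inner_neg_right, Complex.neg_re]
      linarith
  have hn' : QuasiDissipative (adjoint (-R)) 1 0 := by
    refine ⟨le_rfl, fun x y => rfl, fun x => ?_, fun g => ?_⟩
    · exact hn.lower x
    · have := hacc g
      change (inner ℂ g (adjoint (-R) g)).re ≤ _
      simp only [adjoint_inner_right, neg_apply, inner_neg_left, Complex.neg_re]
      rw [← inner_conj_symm, Complex.conj_re]
      linarith
  have hRn : DenseRange (-R) := by
    have : DenseRange (Neg.neg : E → E) := (neg_surjective).denseRange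
    exact this.comp hR continuous_neg
  obtain ⟨B, hB1, hB2, hB3, hB4⟩ := h.exists_approx hR h'
  obtain ⟨N, hN1, hN2, hN3, hN4⟩ := hn.exists_approx hRn hn'
  exact exists_isGroupOf hR hB1 (fun n => hB2 n R (Commute.refl R)) hN1
    (fun n => hN2 n R (Commute.refl R).neg_right) (by have := h.nonneg; positivity) hB3 hB4
    (by simp) hN3 hN4

end Limit

end Schrod

end

/-! ### Calculus of the group: group law, duality, uniqueness, variation of constants -/

open MeasureTheory Set Filter Topology

noncomputable section

namespace Schrod

/-- Interchange of the integrations over a triangle. -/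
theorem integral_bilin_integral {X Y Z : Type*} [NormedAddCommGroup X] [NormedSpace ℂ X]
    [CompleteSpace X] [NormedAddCommGroup Y] [NormedSpace ℂ Y] [CompleteSpace Y]
    [NormedAddCommGroup Z] [NormedSpace ℂ Z] [CompleteSpace Z]
    (B : X →L[ℂ] Y →L[ℂ] Z) {f : ℝ → X} {k : ℝ → Y} {t : ℝ} (ht : 0 ≤ t)
    (hf : IntervalIntegrable f volume 0 t) (hk : IntervalIntegrable k volume 0 t) :
    ∫ s in (0 : ℝ)..t, B (f s) (∫ r in (0 : ℝ)..s, k r) =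
      ∫ r in (0 : ℝ)..t, B (∫ s in r..t, f s) (k r) := by
  have hf' := (intervalIntegrable_iff_integrableOn_Ioc_of_le ht).1 hf
  have hk' := (intervalIntegrable_iff_integrableOn_Ioc_of_le ht).1 hk
  have h1 : Integrable (fun z : ℝ × ℝ => B (f z.1) (k z.2))
      ((volume.restrict (Ioc 0 t)).prod (volume.restrict (Ioc 0 t))) :=
    hf'.op_fst_snd (op := fun x y => B x y) (by fun_prop) ⟨‖B‖, B.le_opNorm₂⟩ hk'
  have hm : MeasurableSet {z : ℝ × ℝ | z.2 ≤ z.1} :=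
    measurableSet_le measurable_snd measurable_fst
  have h2 := integral_integral_swap
    (f := fun s r => ({z : ℝ × ℝ | z.2 ≤ z.1}.indicator (fun z => B (f z.1) (k z.2)) (s, r)))
    (h1.indicator hm)
  rw [intervalIntegral.integral_of_le ht, intervalIntegral.integral_of_le ht]
  have e1 : ∀ s ∈ Ioc 0 t, B (f s) (∫ r in (0 : ℝ)..s, k r) = ∫ r in Ioc 0 t,
      ({z : ℝ × ℝ | z.2 ≤ z.1}.indicator (fun z => B (f z.1) (k z.2)) (s, r)) := by
    intro s hs
    have : ∀ r, ({z : ℝ × ℝ | z.2 ≤ z.1}.indicator (fun z => B (f z.1) (k z.2)) (s, r)) =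
        (Iic s).indicator (fun r => B (f s) (k r)) r := fun r => by
      simp [indicator]
    simp_rw [this]
    rw [setIntegral_indicator measurableSet_Iic, Ioc_inter_Iic, inf_eq_right.2 hs.2,
      ContinuousLinearMap.integral_comp_comm _ (hk'.mono_set (Ioc_subset_Ioc_right hs.2)),
      intervalIntegral.integral_of_le hs.1.le]
  have e2 : ∀ r ∈ Ioc 0 t, B (∫ s in r..t, f s) (k r) = ∫ s in Ioc 0 t,
      ({z : ℝ × ℝ | z.2 ≤ z.1}.indicator (fun z => B (f z.1) (k z.2)) (s, r)) := by
    intro r hr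
    have : ∀ s, ({z : ℝ × ℝ | z.2 ≤ z.1}.indicator (fun z => B (f z.1) (k z.2)) (s, r)) =
        (Ici r).indicator (fun s => B.flip (k r) (f s)) s := fun s => by
      simp [indicator]
    simp_rw [this]
    have hs : Ioc 0 t ∩ Ici r = Icc r t := by
      ext s; simp only [mem_inter_iff, mem_Ioc, mem_Ici, mem_Icc]
      constructor
      · rintro ⟨⟨-, h⟩, h'⟩; exact ⟨h', h⟩
      · rintro ⟨h, h'⟩; exact ⟨⟨hr.1.trans_le h, h'⟩, h⟩
    rw [setIntegral_indicator measurableSet_Ici, hs, integral_Icc_eq_integral_Ioc,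
      ContinuousLinearMap.integral_comp_comm _ (hf'.mono_set (Ioc_subset_Ioc_left hr.1.le)),
      intervalIntegral.integral_of_le hr.2]
    rfl
  rw [setIntegral_congr_fun measurableSet_Ioc e1, setIntegral_congr_fun measurableSet_Ioc e2]
  exact h2

theorem intervalIntegrable_clm_comp {X Y : Type*} [NormedAddCommGroup X] [NormedSpace ℂ X]
    [NormedAddCommGroup Y] [NormedSpace ℂ Y] (L : X →L[ℂ] Y) {f : ℝ → X} {a b : ℝ}
    (hf : IntervalIntegrable f volume a b) : IntervalIntegrable (fun s => L (f s)) volume a b :=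
  ⟨L.integrable_comp hf.1, L.integrable_comp hf.2⟩

theorem continuous_comp_max {X : Type*} [TopologicalSpace X] {w : ℝ → X}
    (hw : ContinuousOn w (Ici 0)) : Continuous fun t => w (max t 0) :=
  hw.comp_continuous (by fun_prop) fun _ => mem_Ici.2 (le_max_right _ _)

namespace IsGroupOf

open ContinuousLinearMap

variable {E : Type*} [NormedAddCommGroup E] [InnerProductSpace ℂ E] [CompleteSpace E]
  {R : E →L[ℂ] E} {T : ℝ → E →L[ℂ] E}

theorem continuousAt (h : IsGroupOf R T) (t : ℝ) (x : E) :
    ContinuousAt (fun p : ℝ × E => T p.1 p.2) (t, x) := by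
  obtain ⟨K, hK⟩ := h.bound (|t| + 1)
  have hK0 : 0 ≤ K := (norm_nonneg _).trans (hK 0 (by simp; positivity))
  rw [ContinuousAt, tendsto_iff_norm_sub_tendsto_zero]
  have h1 : Tendsto (fun p : ℝ × E => K * ‖p.2 - x‖ + ‖T p.1 x - T t x‖) (𝓝 (t, x)) (𝓝 0) := by
    have : Continuous fun p : ℝ × E => K * ‖p.2 - x‖ + ‖T p.1 x - T t x‖ := by
      have h3 : Continuous fun p : ℝ × E => T p.1 x := (h.cont x).comp continuous_fst
      exact ((continuous_snd.sub continuous_const).norm.const_mul K).add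
        (h3.sub continuous_const).norm
    have h2 := this.tendsto (t, x)
    simpa using h2
  refine squeeze_zero' (Eventually.of_forall fun _ => norm_nonneg _) ?_ h1
  have h2 : ∀ᶠ p : ℝ × E in 𝓝 (t, x), |p.1| ≤ |t| + 1 := by
    have : Continuous fun p : ℝ × E => |p.1| := by fun_prop
    exact (this.tendsto (t, x)).eventually (Iic_mem_nhds (by simp))
  filter_upwards [h2] with p hp
  have e : T p.1 p.2 - T t x = T p.1 (p.2 - x) + (T p.1 x - T t x) := by
    rw [map_sub]; abel
  rw [e]
  refine (norm_add_le _ _).trans ?_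
  gcongr
  exact le_of_opNorm_le _ (hK _ hp) _

theorem continuousOn (h : IsGroupOf R T) {y : ℝ → E} {φ : ℝ → ℝ} {S : Set ℝ}
    (hφ : ContinuousOn φ S) (hy : ContinuousOn y S) :
    ContinuousOn (fun t => T (φ t) (y t)) S := by
  intro t ht
  exact (h.continuousAt (φ t) (y t)).comp_continuousWithinAt (f := fun t => (φ t, y t))
    ((hφ t ht).prodMk (hy t ht))

theorem hasDerivAt (h : IsGroupOf R T) (g : E) (t : ℝ) :
    HasDerivAt (fun t => T t (R g)) (T t g) t := by
  have h1 : (fun t => T t (R g)) = fun t => R g + ∫ s in (0 : ℝ)..t, T s g := by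
    funext t
    rw [← h.integral, add_sub_cancel]
  rw [h1]
  refine HasDerivAt.const_add _ ?_
  exact intervalIntegral.integral_hasDerivAt_right ((h.cont g).intervalIntegrable _ _)
    (h.cont g).stronglyMeasurable.stronglyMeasurableAtFilter (h.cont g).continuousAt

/-- Orbits starting in the range of `R` are integrals, so one factor `R` turns strong continuity
into a local Lipschitz bound in operator norm. A second factor gives norm differentiability
(`hasDerivAt_mul`), after which product rules apply without any discussion of domains. -/
theorem continuous_mul (h : IsGroupOf R T) : Continuous fun t => T t * R := by
  rw [continuous_iff_continuousAt]
  intro t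
  obtain ⟨K, hK⟩ := h.bound (|t| + 1)
  have hK0 : 0 ≤ K := (norm_nonneg _).trans (hK 0 (by simp; positivity))
  have hL : LipschitzOnWith (Real.toNNReal K) (fun t => T t * R) (Icc (t - 1) (t + 1)) := by
    refine LipschitzOnWith.of_dist_le_mul fun a ha b hb => ?_
    rw [Real.coe_toNNReal _ hK0, dist_eq_norm]
    refine opNorm_le_bound _ (by positivity) fun g => ?_
    have e : (T a * R - T b * R) g = ∫ s in b..a, T s g := by
      exact (intervalIntegral.integral_eq_sub_of_hasDerivAt (fun s _ => h.hasDerivAt g s)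
        ((h.cont g).intervalIntegrable _ _)).symm
    rw [e]
    have := intervalIntegral.norm_integral_le_of_norm_le_const (a := b) (b := a)
      (f := fun s => T s g) (C := K * ‖g‖) fun s hs => le_of_opNorm_le _ (hK s ?_) g
    · rw [Real.dist_eq]; linarith
    · have h1 : s ∈ Icc (t - 1) (t + 1) :=
        (uIoc_subset_uIcc.trans (uIcc_subset_Icc hb ha)) hs
      have h2 : |s - t| ≤ 1 := abs_le.2 ⟨by linarith [h1.1], by linarith [h1.2]⟩
      have := abs_add_le t (s - t)
      rw [add_sub_cancel] at this
      linarith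
  exact hL.continuousOn.continuousAt (Icc_mem_nhds (by linarith) (by linarith))

theorem integral_mul (h : IsGroupOf R T) (a b : ℝ) :
    ∫ s in a..b, T s * R = T b * R * R - T a * R * R := by
  ext g
  have h1 := (ContinuousLinearMap.apply ℂ E g).intervalIntegral_comp_comm
    (h.continuous_mul.intervalIntegrable (μ := volume) a b)
  refine h1.symm.trans ?_
  change ∫ s in a..b, T s (R g) = T b (R (R g)) - T a (R (R g))
  exact intervalIntegral.integral_eq_sub_of_hasDerivAt (fun s _ => h.hasDerivAt (R g) s)
    ((h.cont (R g)).intervalIntegrable _ _)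

theorem hasDerivAt_mul (h : IsGroupOf R T) (t : ℝ) :
    HasDerivAt (fun t => T t * R * R) (T t * R) t := by
  have h1 : (fun t => T t * R * R) = fun t => T 0 * R * R + ∫ s in (0 : ℝ)..t, T s * R := by
    funext t
    rw [h.integral_mul, add_sub_cancel]
  rw [h1]
  refine HasDerivAt.const_add _ ?_
  exact intervalIntegral.integral_hasDerivAt_right (h.continuous_mul.intervalIntegrable _ _)
    h.continuous_mul.stronglyMeasurable.stronglyMeasurableAtFilter h.continuous_mul.continuousAt

/-- The two halves of `T` were glued without checking compatibility, so the case `s = -t` is also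
where `T (-t)` is shown to invert `T t`. The four factors `R` inserted for differentiability cancel
by injectivity. -/
theorem add (h : IsGroupOf R T) (hR : Function.Injective R) (s t : ℝ) :
    T (s + t) = T s * T t := by
  ext x
  -- `r ↦ T r R² T (s + t - r) R² x` is constant
  have h1 : ∀ r : ℝ, HasDerivAt
      (fun r => (T r * R * R) ((T (s + t - r) * R * R) x)) 0 r := by
    intro r
    have h2 : HasDerivAt (fun r => s + t - r) (-1) r := by
      simpa using (hasDerivAt_id' r).const_sub (s + t)
    have h3 : HasDerivAt (fun r => (T (s + t - r) * R * R) x)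
        (-((T (s + t - r) * R) x)) r := by
      have h4 := (h.hasDerivAt_mul (s + t - r)).scomp r h2
      have h5 := ((ContinuousLinearMap.apply ℂ E x).restrictScalars ℝ).hasFDerivAt.comp_hasDerivAt
        r h4
      refine h5.congr_deriv ?_
      simp
    have h6 := ((ContinuousLinearMap.restrictScalarsL ℂ E E ℝ ℝ).hasFDerivAt.comp_hasDerivAt r
      (h.hasDerivAt_mul r)).clm_apply h3
    refine h6.congr_deriv ?_
    change T r (R (T (s + t - r) (R (R x)))) + T r (R (R (-(T (s + t - r) (R x))))) = 0
    rw [h.comm _ (R x), map_neg, map_neg, map_neg, add_neg_cancel]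
  have h2 := is_const_of_deriv_eq_zero (fun r => (h1 r).differentiableAt) (fun r => (h1 r).deriv)
    s (s + t)
  simp only [add_sub_cancel_left, sub_self] at h2
  have h3 : T s (R (R (T t (R (R x))))) = T (s + t) (R (R (T 0 (R (R x))))) := h2
  rw [h.zero, one_apply_eq_self] at h3
  simp only [h.comm] at h3
  exact (hR (hR (hR (hR h3)))).symm

theorem hasDerivAt_mul_apply (h : IsGroupOf R T) (t : ℝ) (x : E) :
    HasDerivAt (fun t => (T t * R * R) x) ((T t * R) x) t :=
  ((ContinuousLinearMap.apply ℂ E x).restrictScalars ℝ).hasFDerivAt.comp_hasDerivAt t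
    (h.hasDerivAt_mul t)

theorem hasDerivAt_mul_real (h : IsGroupOf R T) (t : ℝ) :
    HasDerivAt (fun t => (T t * R * R).restrictScalars ℝ) ((T t * R).restrictScalars ℝ) t :=
  (ContinuousLinearMap.restrictScalarsL ℂ E E ℝ ℝ).hasFDerivAt.comp_hasDerivAt t
    (h.hasDerivAt_mul t)

theorem hasDerivAt_mul_apply_sub (h : IsGroupOf R T) (a r : ℝ) (x : E) :
    HasDerivAt (fun r => (T (a - r) * R * R) x) (-((T (a - r) * R) x)) r := by
  have h2 : HasDerivAt (fun r => a - r) (-1) r := by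
    simpa using (hasDerivAt_id' r).const_sub a
  refine ((h.hasDerivAt_mul_apply (a - r) x).scomp r h2).congr_deriv ?_
  simp

theorem neg_apply_apply (h : IsGroupOf R T) (hR : Function.Injective R) (t : ℝ) (x : E) :
    T (-t) (T t x) = x := by
  have := h.add hR (-t) t
  rw [neg_add_cancel, h.zero] at this
  exact (congrArg (fun S : E →L[ℂ] E => S x) this).symm

theorem apply_neg_apply (h : IsGroupOf R T) (hR : Function.Injective R) (t : ℝ) (x : E) :
    T t (T (-t) x) = x := by
  have := h.neg_apply_apply hR (-t) x
  rwa [neg_neg] at this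

/-- The function `r ↦ ⟨T_r R² x, T'_{t-r} (R*)² y⟩` has zero derivative. Its values at `r = t` and
`r = 0` give the claim up to factors `R` and `R*`. All four are moved to the left argument and
cancelled there, so only injectivity of `R` is needed. -/
theorem inner_eq (h : IsGroupOf R T) {T' : ℝ → E →L[ℂ] E} (h' : IsGroupOf (adjoint R) T')
    (hR : Function.Injective R) (t : ℝ) (x y : E) :
    inner ℂ (T t x) y = inner ℂ x (T' t y) := by
  have hd : ∀ x y : E, ∀ r : ℝ, HasDerivAt (fun r => inner ℂ ((T r * R * R) x)
      ((T' (t - r) * adjoint R * adjoint R) y)) 0 r := by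
    intro x y r
    refine ((h.hasDerivAt_mul_apply r x).inner ℂ
      (h'.hasDerivAt_mul_apply_sub t r y)).congr_deriv ?_
    change inner ℂ (T r (R (R x))) (-(T' (t - r) (adjoint R y))) +
      inner ℂ (T r (R x)) (T' (t - r) (adjoint R (adjoint R y))) = 0
    rw [h'.comm _ (adjoint R y), adjoint_inner_right, h.comm _ (R x), inner_neg_right,
      neg_add_cancel]
  have h1 : ∀ x y : E, inner ℂ (R (R (T t x))) (adjoint R (adjoint R y)) =
      inner ℂ (R (R x)) (adjoint R (adjoint R (T' t y))) := by
    intro x y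
    have h2 := is_const_of_deriv_eq_zero (fun r => (hd x y r).differentiableAt)
      (fun r => (hd x y r).deriv) t 0
    simp only [sub_self, sub_zero] at h2
    change inner ℂ (T t (R (R x))) (T' 0 (adjoint R (adjoint R y))) =
      inner ℂ (T 0 (R (R x))) (T' t (adjoint R (adjoint R y))) at h2
    rwa [h.zero, h'.zero, one_apply_eq_self, one_apply_eq_self, h.comm, h.comm, h'.comm,
      h'.comm] at h2
  simp only [adjoint_inner_right] at h1
  -- cancel the four factors `R`
  have h3 : R (R (R (R (T t x)))) = R (R (R (R (adjoint (T' t) x)))) := by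
    refine ext_inner_right ℂ fun y => ?_
    rw [h1 x y]
    simp only [← adjoint_inner_right R, adjoint_inner_left (T' t), h'.comm]
  rw [hR (hR (hR (hR h3))), adjoint_inner_left]

/-- Uniqueness of the solution of `w' = R⁻¹ w`, in integrated form. -/
theorem eq_zero_of_integral_eq (h : IsGroupOf R T) (hR : Function.Injective R) {w : ℝ → E}
    (hw : ∀ t, 0 ≤ t → R (w t) = ∫ s in (0 : ℝ)..t, w s)
    (hi : ∀ t, 0 ≤ t → IntervalIntegrable w volume 0 t) {t : ℝ} (ht : 0 ≤ t) : w t = 0 := by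
  set W : ℝ → E := fun t => ∫ s in (0 : ℝ)..t, w s
  have hWc : ContinuousOn W (Ici 0) := by
    intro s hs
    have h1 := intervalIntegral.continuousOn_primitive_interval'
      (hi (s + 1) (by linarith [mem_Ici.1 hs])) (a := 0) (by simp)
    rw [uIcc_of_le (by linarith [mem_Ici.1 hs]), ← Ici_inter_Iic] at h1
    exact (h1 s ⟨hs, by simp⟩).mono_of_mem_nhdsWithin (inter_mem self_mem_nhdsWithin
      (mem_nhdsWithin_of_mem_nhds (Iic_mem_nhds (by linarith))))
  have hWm := continuous_comp_max hWc
  -- As `w` is only integrable, the argument uses its second primitive. It satisfies `V' = W` and `V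
  -- = R W` on `[0, ∞)`, whence `T_{-s} R² V(s)` is constant. The truncation `max r 0` makes the
  -- integrand continuous on the whole line, so that `V` is differentiable everywhere.
  set V : ℝ → E := fun s => ∫ r in (0 : ℝ)..s, W (max r 0)
  have hRW : ∀ s, 0 ≤ s → V s = R (W s) := by
    intro s hs
    refine Eq.trans ?_ (R.intervalIntegral_comp_comm (hi s hs))
    refine intervalIntegral.integral_congr fun r hr => ?_
    rw [uIcc_of_le hs] at hr
    rw [max_eq_left hr.1]
    exact (hw r hr.1).symm
  have hd : ∀ s, HasDerivAt V (W (max s 0)) s := fun s =>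
    intervalIntegral.integral_hasDerivAt_right (hWm.intervalIntegrable _ _)
      hWm.stronglyMeasurable.stronglyMeasurableAtFilter hWm.continuousAt
  have hp : ∀ s, HasDerivAt (fun s => (T (0 - s) * R * R) (V s))
      (-((T (0 - s) * R) (V s)) + (T (0 - s) * R * R) (W (max s 0))) s := by
    intro s
    have h2 : HasDerivAt (fun r : ℝ => 0 - r) (-1) s := by
      simpa using (hasDerivAt_id' s).const_sub 0
    refine (((h.hasDerivAt_mul_real (0 - s)).scomp s h2).clm_apply (hd s)).congr_deriv ?_
    simp
  have hconst := constant_of_has_deriv_right_zero (f := fun s => (T (0 - s) * R * R) (V s))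
    (a := 0) (b := t) (fun s _ => (hp s).continuousAt.continuousWithinAt) fun s hs => by
      refine (hp s).hasDerivWithinAt.congr_deriv ?_
      rw [max_eq_left hs.1, hRW s hs.1]
      exact neg_add_cancel _
  have h0 := hconst t ⟨ht, le_rfl⟩
  have hV0 : V 0 = 0 := intervalIntegral.integral_same
  simp only [hV0, map_zero, hRW t ht] at h0
  have h1 : T (0 - t) (R (R (R (W t)))) = 0 := h0
  rw [h.comm, h.comm, h.comm, zero_sub, ← map_zero R, hR.eq_iff, ← map_zero R, hR.eq_iff,
    ← map_zero R, hR.eq_iff] at h1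
  have h2 := h.apply_neg_apply hR t (W t)
  rw [h1, map_zero] at h2
  have h3 := hw t ht
  change _ = W t at h3
  rw [← h2, ← map_zero R] at h3
  exact hR h3

/-- The variation of constants formula, in integrated form. -/
theorem variation_of_constants (h : IsGroupOf R T) (hR : Function.Injective R) {k Ψ : ℝ → E}
    (z₀ : E) (hΨc : ContinuousOn Ψ (Ici 0))
    (hΨ : ∀ t, 0 ≤ t → R (Ψ t) = ∫ s in (0 : ℝ)..t, T (-s) (k s))
    {t : ℝ} (ht : 0 ≤ t) (hk : IntervalIntegrable k volume 0 t)
    (hTk : IntervalIntegrable (fun s => T (-s) (k s)) volume 0 t) :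
    R (T t (z₀ + Ψ t)) = R z₀ + ∫ s in (0 : ℝ)..t, (T s (z₀ + Ψ s) + k s) := by
  have hcI : ContinuousOn (fun s => T s (Ψ s)) (Icc 0 t) :=
    h.continuousOn continuousOn_id (hΨc.mono Icc_subset_Ici_self)
  have hTΨ : IntervalIntegrable (fun s => T s (Ψ s)) volume 0 t := by
    refine ContinuousOn.intervalIntegrable ?_
    rwa [uIcc_of_le ht]
  -- Fubini on the triangle for the evaluation pairing. The inner integral `∫ᵣᵗ T_s R ds = T_t R² -
  -- T_r R²`, applied to `T_{-r} k(r)`, separates the final state from `R² k(r)`.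
  have h1 := integral_bilin_integral (ContinuousLinearMap.id ℂ (E →L[ℂ] E)) ht
    (h.continuous_mul.intervalIntegrable (μ := volume) 0 t) hTk
  simp only [h.integral_mul] at h1
  have hRR : ∀ {f : ℝ → E}, IntervalIntegrable f volume 0 t →
      ∫ s in (0 : ℝ)..t, R (R (f s)) = R (R (∫ s in (0 : ℝ)..t, f s)) := fun hf =>
    (R * R).intervalIntegral_comp_comm hf
  have h2 : ∫ s in (0 : ℝ)..t, (T s * R) (∫ r in (0 : ℝ)..s, T (-r) (k r)) =
      R (R (∫ s in (0 : ℝ)..t, T s (Ψ s))) := by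
    rw [← hRR hTΨ]
    refine intervalIntegral.integral_congr fun s hs => ?_
    rw [uIcc_of_le ht] at hs
    change T s (R (∫ r in (0 : ℝ)..s, T (-r) (k r))) = R (R (T s (Ψ s)))
    rw [← hΨ s hs.1, h.comm, h.comm]
  have h3 : ∫ r in (0 : ℝ)..t, (T t * R * R - T r * R * R) (T (-r) (k r)) =
      R (R (T t (R (Ψ t)))) - R (R (∫ s in (0 : ℝ)..t, k s)) := by
    have e : ∀ r, (T t * R * R - T r * R * R) (T (-r) (k r)) =
        (T t * R * R) (T (-r) (k r)) - (R * R) (k r) := fun r => by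
      change T t (R (R (T (-r) (k r)))) - T r (R (R (T (-r) (k r)))) = _
      rw [h.comm r, h.comm r, h.apply_neg_apply hR]
      rfl
    simp_rw [e]
    rw [intervalIntegral.integral_sub (intervalIntegrable_clm_comp (T t * R * R) hTk)
      (intervalIntegrable_clm_comp (R * R) hk),
      ContinuousLinearMap.intervalIntegral_comp_comm _ hTk,
      ContinuousLinearMap.intervalIntegral_comp_comm _ hk, ← hΨ t ht]
    change T t (R (R (R (Ψ t)))) - R (R _) = _
    rw [h.comm, h.comm]
  have h4 : ∫ s in (0 : ℝ)..t, (T s * R) (∫ r in (0 : ℝ)..s, T (-r) (k r)) =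
    ∫ r in (0 : ℝ)..t, (T t * R * R - T r * R * R) (T (-r) (k r)) := h1
  rw [h2, h3, eq_sub_iff_add_eq, ← map_add, ← map_add] at h4
  have h5 := hR (hR h4)
  have hz : IntervalIntegrable (fun s => T s z₀) volume 0 t := (h.cont z₀).intervalIntegrable _ _
  simp_rw [map_add]
  rw [intervalIntegral.integral_add (hz.add hTΨ) hk, intervalIntegral.integral_add hz hTΨ,
    ← h.integral, add_assoc, h5, h.comm, h.comm]
  abel

end IsGroupOf

end Schrod

end

/-! ### Multiplier identities in terms of the Volterra operator -/

open MeasureTheory Set Filter Topology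

noncomputable section

namespace Schrod

open ContinuousLinearMap

variable {E : Type*} [NormedAddCommGroup E] [InnerProductSpace ℂ E] [CompleteSpace E]

/-- The algebraic relations between the constant function `e = 1`, the integration operator
`V g (x) = ∫ₓ¹ g` and the multiplication `M` by `1 - x`. -/
structure VolterraRel (e : E) (V M : E →L[ℂ] E) : Prop where
  add_adjoint : ∀ g, V g + adjoint V g = inner ℂ e g • e
  comm : ∀ g, M (V g) - V (M g) = V (V g)
  apply_one : M e = V e
  norm_one : ‖e‖ = 1
  symm : ∀ x y, inner ℂ (M x) y = inner ℂ x (M y)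
  inj : Function.Injective V

/-- The inverse of `f ↦ -iσ f''` with the boundary conditions `f'(0) = -iσq f(0)`, `f'(1) = 0`. -/
def solOp (q σ : ℝ) (e : E) (V : E →L[ℂ] E) : E →L[ℂ] E :=
  (q⁻¹ : ℂ) • (innerSL ℂ e).smulRight e - (Complex.I * σ) • (adjoint V * V)

theorem solOp_apply (q σ : ℝ) (e : E) (V : E →L[ℂ] E) (g : E) :
    solOp q σ e V g = ((q⁻¹ : ℂ) * inner ℂ e g) • e - (Complex.I * σ) • adjoint V (V g) := by
  rw [mul_smul]; rfl

theorem inner_solOp_left (q σ : ℝ) (e : E) (V : E →L[ℂ] E) (x y : E) :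
    inner ℂ (solOp q σ e V x) y = inner ℂ x (solOp q (-σ) e V y) := by
  rw [solOp_apply, solOp_apply, inner_sub_left, inner_sub_right, inner_smul_left,
    inner_smul_left, inner_smul_right, inner_smul_right, adjoint_inner_left, adjoint_inner_right]
  simp only [map_mul, Complex.conj_I, Complex.conj_ofReal, inner_conj_symm, map_inv₀,
    Complex.ofReal_neg]
  ring

theorem adjoint_solOp (q σ : ℝ) (e : E) (V : E →L[ℂ] E) :
    adjoint (solOp q σ e V) = solOp q (-σ) e V := by
  refine ContinuousLinearMap.ext fun y => ext_inner_left ℂ fun x => ?_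
  rw [adjoint_inner_right, inner_solOp_left]

/-- The energy identity for `R = solOp q σ e V`. -/
theorem re_inner_solOp (q σ : ℝ) (e : E) (V : E →L[ℂ] E) (g : E) :
    (inner ℂ g (solOp q σ e V g)).re = q⁻¹ * ‖inner ℂ e g‖ ^ 2 := by
  rw [solOp_apply, inner_sub_right, inner_smul_right, inner_smul_right, adjoint_inner_right,
    ← inner_conj_symm g e, mul_assoc, Complex.mul_conj, inner_self_eq_norm_sq_to_K,
    Complex.normSq_eq_norm_sq]
  norm_cast
  simp [Complex.mul_re]
  simp [← Complex.ofReal_pow]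

namespace VolterraRel

variable {e : E} {V M : E →L[ℂ] E} {q σ : ℝ}

theorem adjoint_apply_apply (hσ : σ ^ 2 = 1) (g : E) :
    adjoint V (V g) = (Complex.I * σ) • (solOp q σ e V g - ((q⁻¹ : ℂ) * inner ℂ e g) • e) := by
  have h : (Complex.I * σ) * (Complex.I * σ) = -1 := by
    have : ((σ : ℂ)) ^ 2 = 1 := by exact_mod_cast hσ
    linear_combination Complex.I ^ 2 * this + Complex.I_sq
  rw [solOp_apply, sub_sub_cancel_left, smul_neg, smul_smul, h, neg_one_smul, neg_neg]

/-- If `R g = 0`, the energy identity gives `⟨e, g⟩ = 0`. What remains is `V*V g = 0`, hence `V g =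
0`. -/
theorem injective (h : VolterraRel e V M) (hq : 0 < q) (hσ : σ ^ 2 = 1) :
    Function.Injective (solOp q σ e V) := by
  rw [injective_iff_map_eq_zero]
  intro g hg
  have h1 := re_inner_solOp q σ e V g
  rw [hg, inner_zero_right, Complex.zero_re] at h1
  have h2 : inner ℂ e g = 0 := by
    have := hq.ne'
    simpa [this] using h1.symm
  have h3 := adjoint_apply_apply (q := q) (e := e) (V := V) hσ g
  rw [hg, h2, mul_zero, zero_smul, sub_zero, smul_zero] at h3
  have h4 : inner ℂ (V g) (V g) = 0 := by rw [← adjoint_inner_right, h3, inner_zero_right]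
  rw [inner_self_eq_zero] at h4
  exact h.inj (by rw [h4, map_zero])

/-- The orthogonal complement of the range is the kernel of the adjoint, which is the same operator
with `-σ`. -/
theorem denseRange (h : VolterraRel e V M) (hq : 0 < q) (hσ : σ ^ 2 = 1) :
    DenseRange (solOp q σ e V) := by
  have h1 : (solOp q σ e V).range.topologicalClosure = ⊤ := by
    rw [Submodule.topologicalClosure_eq_top_iff, Submodule.eq_bot_iff]
    intro x hx
    refine h.injective (q := q) (σ := -σ) hq (by rw [neg_sq, hσ]) ?_
    rw [map_zero]
    refine ext_inner_left ℂ fun v => ?_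
    rw [← inner_solOp_left, inner_zero_right]
    exact hx _ ⟨v, rfl⟩
  exact (Submodule.dense_iff_topologicalClosure_eq_top (s := (solOp q σ e V).range)).2 h1

theorem adjoint_eq (h : VolterraRel e V M) (g : E) : adjoint V g = inner ℂ e g • e - V g := by
  rw [← h.add_adjoint, add_sub_cancel_left]

/-- In the model, with `F = V* y = ∫₀ˣ y`, this is `∫₀¹ (|F|²)' = |F(1)|²`. -/
theorem two_re_inner_adjoint (h : VolterraRel e V M) (y : E) :
    2 * (inner ℂ y (adjoint V y)).re = ‖inner ℂ e y‖ ^ 2 := by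
  have h1 : inner ℂ y (V y) + inner ℂ y (adjoint V y) = inner ℂ e y * inner ℂ y e := by
    rw [← inner_add_right, h.add_adjoint, inner_smul_right]
  rw [← adjoint_inner_left, ← inner_conj_symm, ← inner_conj_symm y e, Complex.mul_conj,
    Complex.normSq_eq_norm_sq] at h1
  have := congrArg Complex.re h1
  simp only [Complex.add_re, Complex.conj_re, Complex.ofReal_re] at this
  linarith

/-- In the model, with `F = V* y`, this is `∫ (1 - x) (|F|²)' = ∫ |F|²`. The boundary terms vanish
because `F(0) = 0` and `1 - x` vanishes at `1`. The relations of `VolterraRel` take the place of the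
integration by parts. -/
theorem two_re_inner_mul_adjoint (h : VolterraRel e V M) (y : E) :
    2 * (inner ℂ y (M (adjoint V y))).re = ‖adjoint V y‖ ^ 2 := by
  have h1 : inner ℂ y (M (adjoint V y)) + inner ℂ y (V (M y)) =
      inner ℂ (adjoint V y) (adjoint V y) := by
    have h2 := h.comm y
    have h3 : V (M y) = M (V y) - V (V y) := by rw [← h2]; abel
    have h4 : V (V y) = inner ℂ e y • V e - V (adjoint V y) := by
      have : V y = inner ℂ e y • e - adjoint V y := by rw [← h.add_adjoint]; abel
      rw [this, map_sub, map_smul]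
    have h5 : M (adjoint V y) = inner ℂ e y • V e - M (V y) := by
      rw [h.adjoint_eq, map_sub, map_smul, h.apply_one]
    rw [← inner_add_right, h3, h4, h5, adjoint_inner_left]
    congr 1; abel
  have h2 : inner ℂ y (V (M y)) = starRingEnd ℂ (inner ℂ y (M (adjoint V y))) := by
    rw [inner_conj_symm, h.symm, adjoint_inner_left]
  rw [h2, inner_self_eq_norm_sq_to_K] at h1
  have := congrArg Complex.re h1
  simp only [Complex.add_re, Complex.conj_re] at this
  rw [two_mul, this]
  norm_cast

/-- The multiplier identity for the multiplier `1`. -/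
theorem im_inner_add_inner (h : VolterraRel e V M) (hσ : σ ^ 2 = 1) (g : E) :
    (inner ℂ (V g) (solOp q σ e V g) + inner ℂ (V (solOp q σ e V g)) g).im =
    σ * (‖(q⁻¹ : ℂ) * inner ℂ e g‖ ^ 2 -
      ‖(q⁻¹ : ℂ) * inner ℂ e g - Complex.I * σ * inner ℂ e (V g)‖ ^ 2) +
    (inner ℂ e g * inner ℂ (solOp q σ e V g) e).im := by
  set z := solOp q σ e V g with hz
  set a := (q⁻¹ : ℂ) * inner ℂ e g with ha
  have h1 : inner ℂ (V z) g = inner ℂ e g * inner ℂ z e - inner ℂ z (V g) := by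
    rw [← adjoint_inner_right, h.adjoint_eq, inner_sub_right, inner_smul_right]
  have h2 : inner ℂ (V g) z = a * inner ℂ (V g) e -
      Complex.I * σ * inner ℂ (V g) (adjoint V (V g)) := by
    rw [hz, solOp_apply, inner_sub_right, inner_smul_right, inner_smul_right]
  have h3 := h.two_re_inner_adjoint (V g)
  rw [h1, ← inner_conj_symm z (V g), h2, ← inner_conj_symm (V g) e]
  rw [← Complex.normSq_eq_norm_sq, Complex.normSq_apply] at h3
  rw [← Complex.normSq_eq_norm_sq, ← Complex.normSq_eq_norm_sq, Complex.normSq_apply,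
    Complex.normSq_apply]
  generalize inner ℂ e (V g) = u at *
  generalize inner ℂ (V g) (adjoint V (V g)) = s at *
  generalize inner ℂ e g * inner ℂ z e = r at *
  simp only [Complex.add_im, Complex.sub_im, Complex.sub_re, Complex.mul_im, Complex.mul_re,
    Complex.conj_re, Complex.conj_im, Complex.I_re, Complex.I_im, Complex.ofReal_re,
    Complex.ofReal_im]
  linear_combination (-σ) * h3 + (σ * (u.re * u.re + u.im * u.im) +
    2 * (a.re * u.im - a.im * u.re)) * hσ

theorem inner_apply_apply (hσ : σ ^ 2 = 1) (g : E) :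
    inner ℂ (V (solOp q σ e V g)) (V g) = Complex.I * σ * (‖solOp q σ e V g‖ ^ 2 -
      (q⁻¹ : ℂ) * inner ℂ e g * inner ℂ (solOp q σ e V g) e) := by
  rw [← adjoint_inner_right, adjoint_apply_apply (q := q) (e := e) hσ, inner_smul_right,
    inner_sub_right, inner_smul_right, inner_self_eq_norm_sq_to_K]
  rfl

/-- The multiplier identity for the multiplier `1 - x`. -/
theorem im_inner_mul_add_inner (h : VolterraRel e V M) (hσ : σ ^ 2 = 1) (g : E) :
    (inner ℂ (V g) (M (solOp q σ e V g)) + inner ℂ (V (solOp q σ e V g)) (M g)).im =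
    σ * (‖(q⁻¹ : ℂ) * inner ℂ e g‖ ^ 2 - 2 * ‖solOp q σ e V g‖ ^ 2 +
      ((q⁻¹ : ℂ) * inner ℂ e g * inner ℂ (solOp q σ e V g) e).re) +
    (inner ℂ e g * inner ℂ (M (solOp q σ e V g) + V (solOp q σ e V g)) e).im := by
  have h6 := inner_apply_apply (q := q) (e := e) (V := V) hσ g
  have h7 := adjoint_apply_apply (q := q) (e := e) (V := V) hσ g
  have hz := solOp_apply q σ e V g
  set z := solOp q σ e V g
  set a := (q⁻¹ : ℂ) * inner ℂ e g with ha
  have h1 : inner ℂ (V z) (M g) = inner ℂ e g * inner ℂ (M z + V z) e -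
      inner ℂ (M z) (V g) - inner ℂ (V z) (V g) := by
    have h3 : M (V z) = V (M z) + V (V z) := by rw [← h.comm z]; abel
    rw [← h.symm, h3, ← map_add, ← adjoint_inner_right, h.adjoint_eq, inner_sub_right,
      inner_smul_right, inner_add_left _ _ (V g)]
    ring
  have h2 : inner ℂ (V g) (M z) = a * inner ℂ (adjoint V (V g)) e -
      Complex.I * σ * inner ℂ (V g) (M (adjoint V (V g))) := by
    rw [hz, map_sub, map_smul, map_smul, inner_sub_right, inner_smul_right, inner_smul_right,
      h.apply_one, adjoint_inner_left]
  have h3 := h.two_re_inner_mul_adjoint (V g)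
  have h4 : ‖adjoint V (V g)‖ ^ 2 = ‖z‖ ^ 2 + ‖a‖ ^ 2 - 2 * (a * inner ℂ z e).re := by
    rw [h7, norm_smul, mul_pow, norm_mul, Complex.norm_I, one_mul, Complex.norm_real,
      Real.norm_eq_abs, sq_abs, hσ, one_mul]
    have := norm_sub_sq (𝕜 := ℂ) z (a • e)
    rw [inner_smul_right, norm_smul, h.norm_one, mul_one] at this
    rw [this]
    change _ - 2 * (a * inner ℂ z e).re + _ = _
    ring
  have h5 : inner ℂ (adjoint V (V g)) e = -Complex.I * σ * (inner ℂ z e - starRingEnd ℂ a) := by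
    rw [h7, inner_smul_left, inner_sub_left, inner_smul_left, inner_self_eq_norm_sq_to_K,
      h.norm_one]
    simp
  have h8 : inner ℂ (M z) (V g) = starRingEnd ℂ (inner ℂ (V g) (M z)) := by
    rw [inner_conj_symm]
  rw [h4] at h3
  rw [h1, h8, h6, h2, h5]
  rw [← Complex.normSq_eq_norm_sq a, Complex.normSq_apply] at h3 ⊢
  generalize inner ℂ (V g) (M (adjoint V (V g))) = s at *
  generalize inner ℂ e g * inner ℂ (M z + V z) e = r at *
  have h9 : ((‖z‖ : ℂ) ^ 2) = ((‖z‖ ^ 2 : ℝ) : ℂ) := by push_cast; rfl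
  rw [h9]
  generalize ‖z‖ ^ 2 = n at *
  generalize inner ℂ z e = t at *
  simp only [Complex.add_im, Complex.sub_im, Complex.sub_re, Complex.mul_im, Complex.mul_re,
    Complex.conj_re, Complex.conj_im, Complex.I_re, Complex.I_im, Complex.ofReal_re,
    Complex.ofReal_im, Complex.neg_re, Complex.neg_im] at h3 ⊢
  linear_combination (-σ) * h3

/-- The term with `‖R g‖²` is purely imaginary and drops out. This shows that the summand `C‖V x‖²`
of the modified energy adds only a cross term between the trace at `0` and the state. -/
theorem re_inner_apply (hσ : σ ^ 2 = 1) (g : E) :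
    (inner ℂ (V g) (V (solOp q σ e V g))).re =
    σ * ((q⁻¹ : ℂ) * inner ℂ e g * inner ℂ (solOp q σ e V g) e).im := by
  rw [← inner_conj_symm, inner_apply_apply hσ, Complex.conj_re]
  have h9 : ((‖solOp q σ e V g‖ : ℂ) ^ 2) = ((‖solOp q σ e V g‖ ^ 2 : ℝ) : ℂ) := by
    push_cast; rfl
  rw [h9]
  generalize (q⁻¹ : ℂ) * inner ℂ e g * inner ℂ (solOp q σ e V g) e = r
  simp only [Complex.sub_im, Complex.sub_re, Complex.mul_im, Complex.mul_re,
    Complex.I_re, Complex.I_im, Complex.ofReal_re, Complex.ofReal_im]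
  ring

/-- The modified energy `‖x‖² - 4qσ Im ⟪V x, M x⟫ + C ‖V x‖²`. -/
def energyForm (q σ C : ℝ) (V M : E →L[ℂ] E) : E →L[ℂ] E :=
  1 - (2 * q * σ * Complex.I) • (M * V - adjoint (M * V)) + (C : ℂ) • (adjoint V * V)

theorem inner_energyForm (h : VolterraRel e V M) (q σ C : ℝ) (x y : E) :
    inner ℂ (energyForm q σ C V M x) y = inner ℂ x y +
      2 * q * σ * Complex.I * (inner ℂ (V x) (M y) - inner ℂ x (M (V y))) +
      C * inner ℂ (V x) (V y) := by
  change inner ℂ (x - (2 * q * σ * Complex.I) • (M (V x) - adjoint (M * V) x) +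
    (C : ℂ) • adjoint V (V x)) y = _
  rw [inner_add_left, inner_sub_left, inner_smul_left, inner_smul_left, inner_sub_left,
    adjoint_inner_left, adjoint_inner_left, h.symm]
  simp only [map_mul, Complex.conj_I, Complex.conj_ofReal, Complex.conj_ofNat]
  change _ - _ * (_ - inner ℂ x (M (V y))) + _ = _
  ring

/-- Let `z = R g` have trace `a` at `0`. The plain energy contributes `q|a|²` and the multiplier `1
- x` contributes `-2q|a|²`. The surplus `-q|a|²` absorbs all cross terms of size `|a| ‖z‖`. The
summand `C‖V x‖²` only serves to keep the form coercive. -/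
theorem quasiDissipative (h : VolterraRel e V M) (hq : 0 < q) (hσ : σ ^ 2 = 1) :
    ∃ G w, QuasiDissipative (solOp q σ e V) G w := by
  -- `C` comes from `4q‖M‖‖V x‖‖x‖ ≤ ‖x‖²/2 + C‖V x‖²`. `N` adds up the coefficients of the three
  -- cross terms in `‖a‖ ‖z‖`.
  set C := 8 * q ^ 2 * ‖M‖ ^ 2 with hC
  set N := 2 * q + 2 * q ^ 2 * (‖M‖ + ‖V‖) + C with hN
  have hσ1 : |σ| = 1 := by
    rw [← sq_eq_sq₀ (abs_nonneg _) zero_le_one, sq_abs, hσ, one_pow]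
  have hre : ∀ x y, (inner ℂ (energyForm q σ C V M x) y).re = (inner ℂ x y).re -
      2 * q * σ * (inner ℂ (V x) (M y) + inner ℂ (V y) (M x)).im +
      C * (inner ℂ (V x) (V y)).re := by
    intro x y
    have h1 : (inner ℂ (V y) (M x)).im = -(inner ℂ (M x) (V y)).im := by
      rw [← inner_conj_symm, Complex.conj_im]
    rw [h.inner_energyForm, ← h.symm x, Complex.add_im, h1]
    simp [Complex.mul_re, Complex.mul_im]
    ring
  -- Here `4q` stems from the term `-2‖z‖²` of the multiplier identity, and `N²/(4q)` from Young's
  -- inequality against `q‖a‖²`.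
  refine ⟨energyForm q σ C V M, 4 * q + N ^ 2 / (4 * q), by positivity, ?_, ?_, ?_⟩
  · intro x y
    rw [← inner_conj_symm x, h.inner_energyForm, h.inner_energyForm, ← h.symm x, ← h.symm y]
    simp only [map_add, map_mul, map_sub, inner_conj_symm, Complex.conj_I, Complex.conj_ofReal,
      Complex.conj_ofNat]
    ring
  · intro x
    rw [hre]
    have h1 : (inner ℂ x x).re = ‖x‖ ^ 2 := inner_self_eq_norm_sq (𝕜 := ℂ) x
    have h2 : (inner ℂ (V x) (V x)).re = ‖V x‖ ^ 2 := inner_self_eq_norm_sq (𝕜 := ℂ) (V x)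
    have h3 : |(inner ℂ (V x) (M x)).im| ≤ ‖V x‖ * (‖M‖ * ‖x‖) :=
      (Complex.abs_im_le_norm _).trans ((norm_inner_le_norm _ _).trans
        (by gcongr; exact M.le_opNorm x))
    have h4 : σ * (inner ℂ (V x) (M x)).im ≤ ‖V x‖ * (‖M‖ * ‖x‖) := by
      refine (le_abs_self _).trans ?_
      rwa [abs_mul, hσ1, one_mul]
    rw [h1, h2, Complex.add_im]
    have h5 := sq_nonneg (‖x‖ - 4 * q * ‖M‖ * ‖V x‖)
    have h6 := mul_le_mul_of_nonneg_left h4 hq.le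
    rw [hC]
    nlinarith
  · intro g
    rw [hre, re_inner_solOp, re_inner_apply hσ]
    have h1 : (inner ℂ (V g) (M (solOp q σ e V g)) +
        inner ℂ (V (solOp q σ e V g)) (M g)).im = _ := h.im_inner_mul_add_inner hσ g
    rw [h1]
    set z := solOp q σ e V g
    set a := (q⁻¹ : ℂ) * inner ℂ e g with ha
    have ha' : inner ℂ e g = q * a := by
      rw [ha, ← mul_assoc, mul_inv_cancel₀ (by exact_mod_cast hq.ne'), one_mul]
    rw [ha']
    have hn : ∀ x : E, ‖inner ℂ x e‖ ≤ ‖x‖ := fun x => by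
      have := norm_inner_le_norm (𝕜 := ℂ) x e
      rwa [h.norm_one, mul_one] at this
    have b1 : |(a * inner ℂ z e).re| ≤ ‖a‖ * ‖z‖ := by
      refine (Complex.abs_re_le_norm _).trans ?_
      rw [norm_mul]; gcongr; exact hn z
    have b2 : |(a * inner ℂ z e).im| ≤ ‖a‖ * ‖z‖ := by
      refine (Complex.abs_im_le_norm _).trans ?_
      rw [norm_mul]; gcongr; exact hn z
    have b3 : |(a * inner ℂ (M z + V z) e).im| ≤ ‖a‖ * ((‖M‖ + ‖V‖) * ‖z‖) := by
      refine (Complex.abs_im_le_norm _).trans ?_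
      rw [norm_mul]; gcongr
      refine (hn _).trans ((norm_add_le _ _).trans ?_)
      rw [add_mul]
      gcongr
      · exact M.le_opNorm z
      · exact V.le_opNorm z
    have b4 : |σ * (a * inner ℂ z e).im| ≤ ‖a‖ * ‖z‖ := by rwa [abs_mul, hσ1, one_mul]
    have b5 : |σ * (a * inner ℂ (M z + V z) e).im| ≤ ‖a‖ * ((‖M‖ + ‖V‖) * ‖z‖) := by
      rwa [abs_mul, hσ1, one_mul]
    rw [norm_mul, Complex.norm_real, Real.norm_eq_abs, abs_of_pos hq, mul_assoc (q : ℂ),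
      Complex.im_ofReal_mul]
    have e1 : q⁻¹ * (q * ‖a‖) ^ 2 = q * ‖a‖ ^ 2 := by field_simp
    rw [e1]
    have hC0 : 0 ≤ C := by positivity
    have c1 := mul_le_mul_of_nonneg_left (abs_le.1 b1).1 hq.le
    have c2 := mul_le_mul_of_nonneg_left (abs_le.1 b4).2 hC0
    have c3 := mul_le_mul_of_nonneg_left (abs_le.1 b5).1 (sq_nonneg q)
    have key : q * ‖a‖ ^ 2 - 2 * q * σ * (σ * (‖a‖ ^ 2 - 2 * ‖z‖ ^ 2 + (a * inner ℂ z e).re) +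
        q * (a * inner ℂ (M z + V z) e).im) + C * (σ * (a * inner ℂ z e).im) ≤
        - (q * ‖a‖ ^ 2) + 4 * q * ‖z‖ ^ 2 + N * (‖a‖ * ‖z‖) := by
      have : 2 * q * σ * (σ * (‖a‖ ^ 2 - 2 * ‖z‖ ^ 2 + (a * inner ℂ z e).re)) =
          2 * q * (‖a‖ ^ 2 - 2 * ‖z‖ ^ 2 + (a * inner ℂ z e).re) := by
        linear_combination 2 * q * (‖a‖ ^ 2 - 2 * ‖z‖ ^ 2 + (a * inner ℂ z e).re) * hσ
      rw [mul_add, this, hN]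
      nlinarith
    refine key.trans ?_
    have h8 : N * (‖a‖ * ‖z‖) ≤ q * ‖a‖ ^ 2 + N ^ 2 / (4 * q) * ‖z‖ ^ 2 := by
      have h9 : q * ‖a‖ ^ 2 + N ^ 2 / (4 * q) * ‖z‖ ^ 2 - N * (‖a‖ * ‖z‖) =
          (2 * q * ‖a‖ - N * ‖z‖) ^ 2 / (4 * q) := by field_simp; ring
      have : 0 ≤ (2 * q * ‖a‖ - N * ‖z‖) ^ 2 / (4 * q) := by positivity
      linarith
    linarith

theorem exists_isGroupOf (h : VolterraRel e V M) (hq : 0 < q) (hσ : σ ^ 2 = 1) :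
    ∃ T, IsGroupOf (solOp q σ e V) T := by
  obtain ⟨G, w, hG⟩ := h.quasiDissipative (q := q) hq hσ
  obtain ⟨G', w', hG'⟩ := h.quasiDissipative (q := q) (σ := -σ) hq (by rw [neg_sq, hσ])
  refine exists_isGroupOf_of_quasiDissipative (h.denseRange hq hσ) hG (G' := G') (w' := w') ?_ ?_
  · rwa [adjoint_solOp]
  · intro g
    rw [re_inner_solOp]
    positivity

end VolterraRel

end Schrod

end

/-! ### Admissibility by duality: trace estimates and reachable states -/

open MeasureTheory Set Filter Topology

noncomputable section

namespace Schrod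

open ContinuousLinearMap

variable {E : Type*} [NormedAddCommGroup E] [InnerProductSpace ℂ E] [CompleteSpace E]

/-- A vector lies in the range of `R` if it is dominated by the adjoint of `R`. -/
theorem exists_apply_eq_of_norm_inner_le {R : E →L[ℂ] E} (hR : Function.Injective (adjoint R))
    {w : E} {c : ℝ} (hw : ∀ y, ‖inner ℂ w y‖ ≤ c * ‖adjoint R y‖) (hc : 0 ≤ c) :
    ∃ x, R x = w ∧ ‖x‖ ≤ c := by
  -- The functional `R* y ↦ ⟨w, y⟩` is well defined and bounded by `c` on the range of `R*`. Its
  -- Hahn-Banach extension is represented by the vector sought.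
  set L := LinearEquiv.ofInjective (adjoint R : E →ₗ[ℂ] E) hR
  set f : StrongDual ℂ (LinearMap.range (adjoint R : E →ₗ[ℂ] E)) :=
    LinearMap.mkContinuous ((innerSL ℂ w : E →ₗ[ℂ] ℂ).comp (L.symm : _ →ₗ[ℂ] E)) c (by
      intro p
      obtain ⟨y, rfl⟩ := L.surjective p
      simp only [LinearMap.comp_apply, LinearEquiv.coe_coe, LinearEquiv.symm_apply_apply]
      exact hw y) with hf
  obtain ⟨F, hF1, hF2⟩ := exists_extension_norm_eq _ f
  refine ⟨(InnerProductSpace.toDual ℂ E).symm F, ?_, ?_⟩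
  · refine ext_inner_right ℂ fun y => ?_
    rw [← adjoint_inner_right, InnerProductSpace.toDual_symm_apply]
    have := hF1 (L y)
    have e : ((L y : LinearMap.range (adjoint R : E →ₗ[ℂ] E)) : E) = adjoint R y := rfl
    rw [e] at this
    rw [this]
    simp [hf]
  · rw [LinearIsometryEquiv.norm_map, hF2]
    exact LinearMap.mkContinuous_norm_le _ hc _

theorem norm_intervalIntegral_mul_le {a b : ℝ} (hab : a ≤ b) {u v : ℝ → ℂ}
    (hu : MemLp u 2 (volume.restrict (Ioc a b))) (hv : MemLp v 2 (volume.restrict (Ioc a b))) :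
    ‖∫ s in a..b, u s * v s‖ ≤
      √(∫ s in a..b, ‖u s‖ ^ 2) * √(∫ s in a..b, ‖v s‖ ^ 2) := by
  have h2 : ENNReal.ofReal 2 = 2 := by simp
  have h := integral_mul_norm_le_Lp_mul_Lq (p := 2) (q := 2) Real.HolderConjugate.two_two
    (by rwa [h2]) (by rwa [h2]) (f := u) (g := v)
  rw [intervalIntegral.integral_of_le hab, intervalIntegral.integral_of_le hab,
    intervalIntegral.integral_of_le hab]
  refine (norm_integral_le_integral_norm _).trans ?_
  simp_rw [norm_mul]
  refine h.trans (le_of_eq ?_)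
  simp [Real.sqrt_eq_rpow]

/-- `g` is an admissible input direction for the group `T'`, in its dual formulation: the
observation `y ↦ ⟪g, y⟫` is bounded in `L²(0, τ)` by the norm of `R' y`. -/
def ObsBound (R' : E →L[ℂ] E) (T' : ℝ → E →L[ℂ] E) (g : E) : Prop :=
  ∀ τ : ℝ, 0 ≤ τ → ∃ C, 0 ≤ C ∧ ∀ y,
    ∫ r in (0 : ℝ)..τ, ‖inner ℂ g (T' (-r) y)‖ ^ 2 ≤ C * ‖R' y‖ ^ 2

theorem ObsBound.smul {E : Type*} [NormedAddCommGroup E] [InnerProductSpace ℂ E] {R' : E →L[ℂ] E} {T' : ℝ → E →L[ℂ] E} {g : E} (h : ObsBound R' T' g)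
    (a : ℂ) : ObsBound R' T' (a • g) := by
  intro τ hτ
  obtain ⟨C, hC, hb⟩ := h τ hτ
  refine ⟨‖a‖ ^ 2 * C, by positivity, fun y => ?_⟩
  simp_rw [inner_smul_left, norm_mul, RCLike.norm_conj, mul_pow]
  rw [intervalIntegral.integral_const_mul, mul_assoc]
  gcongr
  exact hb y

theorem IsL2loc.memLp_Ioc {u : ℝ → ℂ} (hu : IsL2loc u) {a b : ℝ} (ha : 0 ≤ a) :
    MemLp u 2 (volume.restrict (Ioc a b)) := by
  refine (hu (max b 1) (by positivity)).mono_measure (Measure.restrict_mono ?_ le_rfl)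
  exact fun s hs => ⟨ha.trans hs.1.le, hs.2.trans (le_max_left _ _)⟩

theorem IsL2loc.intervalIntegrable {u : ℝ → ℂ} (hu : IsL2loc u) {a b : ℝ} (ha : 0 ≤ a)
    (hab : a ≤ b) : IntervalIntegrable u volume a b :=
  (intervalIntegrable_iff_integrableOn_Ioc_of_le hab).2
    ((hu.memLp_Ioc ha).integrable (by norm_num))

theorem IsL2loc.intervalIntegrable_sq {u : ℝ → ℂ} (hu : IsL2loc u) {a b : ℝ} (ha : 0 ≤ a)
    (hab : a ≤ b) : IntervalIntegrable (fun s => ‖u s‖ ^ 2) volume a b :=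
  (intervalIntegrable_iff_integrableOn_Ioc_of_le hab).2 (hu.memLp_Ioc ha).norm.integrable_sq

namespace IsGroupOf

variable {R : E →L[ℂ] E} {T T' : ℝ → E →L[ℂ] E}

theorem intervalIntegrable_smul (h : IsGroupOf R T) {u : ℝ → ℂ} (hu : IsL2loc u) (g : E)
    {φ : ℝ → ℝ} (hφ : Continuous φ) {a b : ℝ} (ha : 0 ≤ a) (hab : a ≤ b) :
    IntervalIntegrable (fun s => u s • T (φ s) g) volume a b :=
  (hu.intervalIntegrable ha hab).smul_continuousOn ((h.cont g).comp hφ).continuousOn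

/-- The reachable states for an admissible input direction depend continuously on time. -/
theorem exists_reachable (h : IsGroupOf R T) (h' : IsGroupOf (adjoint R) T')
    (hR : Function.Injective R) (hR' : Function.Injective (adjoint R)) {g : E}
    (hg : ObsBound (adjoint R) T' g) {u : ℝ → ℂ} (hu : IsL2loc u) :
    ∃ Ψ : ℝ → E, ContinuousOn Ψ (Ici 0) ∧
      ∀ t, 0 ≤ t → R (Ψ t) = ∫ s in (0 : ℝ)..t, u s • T (-s) g := by
  have hint : ∀ {a b : ℝ}, 0 ≤ a → a ≤ b →
      IntervalIntegrable (fun s => u s • T (-s) g) volume a b := fun ha hab =>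
    h.intervalIntegrable_smul hu g continuous_neg ha hab
  -- Pairing the integral with `y` and applying Cauchy-Schwarz leaves the observation bound for the
  -- adjoint group. One constant serves all subintervals of `[0, τ]`, so the increments of `Ψ` are
  -- controlled by the `L²` mass of `u`, which gives continuity.
  have key : ∀ τ, 0 ≤ τ → ∃ C, 0 ≤ C ∧ ∀ a b, 0 ≤ a → a ≤ b → b ≤ τ →
      ∃ x, R x = ∫ s in a..b, u s • T (-s) g ∧ ‖x‖ ≤ √(∫ s in a..b, ‖u s‖ ^ 2) * √C := by
    intro τ hτ
    obtain ⟨C, hC, hb⟩ := hg τ hτ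
    refine ⟨C, hC, fun a b ha hab hbτ => ?_⟩
    refine exists_apply_eq_of_norm_inner_le hR' (fun y => ?_) (by positivity)
    have hc : Continuous fun s => inner ℂ (T (-s) g) y :=
      ((h.cont g).comp continuous_neg).inner continuous_const
    have hc' : Continuous fun s => inner ℂ y (T (-s) g) :=
      continuous_const.inner ((h.cont g).comp continuous_neg)
    have e1 : inner ℂ y (∫ s in a..b, u s • T (-s) g) =
        ∫ s in a..b, u s * inner ℂ y (T (-s) g) := by
      have := (innerSL ℂ y).intervalIntegral_comp_comm (hint ha hab)
      refine this.symm.trans ?_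
      simp
    rw [norm_inner_symm, e1]
    have hv : MemLp (fun s => inner ℂ y (T (-s) g)) 2 (volume.restrict (Ioc a b)) := by
      refine MemLp.mono_measure (Measure.restrict_mono Ioc_subset_Icc_self le_rfl) ?_
      exact (memLp_two_iff_integrable_sq_norm hc'.aestronglyMeasurable).2
        ((hc'.norm.pow 2).continuousOn.integrableOn_compact isCompact_Icc)
    refine (norm_intervalIntegral_mul_le hab (hu.memLp_Ioc ha) hv).trans ?_
    rw [mul_assoc]
    gcongr
    have e2 : ∫ s in a..b, ‖inner ℂ y (T (-s) g)‖ ^ 2 ≤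
        ∫ s in (0 : ℝ)..τ, ‖inner ℂ g (T' (-s) y)‖ ^ 2 := by
      simp_rw [norm_inner_symm y, h.inner_eq h' hR]
      have hcc : Continuous fun s => ‖inner ℂ g (T' (-s) y)‖ ^ 2 :=
        ((continuous_const.inner ((h'.cont y).comp continuous_neg)).norm).pow 2
      exact intervalIntegral.integral_mono_interval ha hab hbτ
        (Eventually.of_forall fun s => by positivity) (hcc.intervalIntegrable _ _)
    refine (Real.sqrt_le_sqrt (e2.trans (hb y))).trans (le_of_eq ?_)
    rw [Real.sqrt_mul hC, Real.sqrt_sq (norm_nonneg _)]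
  have hex : ∀ t : ℝ, 0 ≤ t → ∃ x, R x = ∫ s in (0 : ℝ)..t, u s • T (-s) g := by
    intro t ht
    obtain ⟨C, -, hx⟩ := key t ht
    obtain ⟨x, hx, -⟩ := hx 0 t le_rfl ht le_rfl
    exact ⟨x, hx⟩
  choose! Ψ hΨ using hex
  refine ⟨Ψ, fun t ht => ?_, hΨ⟩
  have ht0 : (0 : ℝ) ≤ t := ht
  obtain ⟨C, hC, hx⟩ := key (t + 1) (by linarith)
  set U : ℝ → ℝ := fun t => ∫ s in (0 : ℝ)..t, ‖u s‖ ^ 2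
  have hU : ContinuousOn U (Icc 0 (t + 1)) := by
    have := intervalIntegral.continuousOn_primitive_interval'
      (hu.intervalIntegrable_sq le_rfl (show (0 : ℝ) ≤ t + 1 by linarith)) (a := 0) (by simp)
    rwa [uIcc_of_le (by linarith)] at this
  have hdiff : ∀ a b, 0 ≤ a → a ≤ b → b ≤ t + 1 → ‖Ψ b - Ψ a‖ ≤ √|U b - U a| * √C := by
    intro a b ha hab hb
    obtain ⟨x, hx1, hx2⟩ := hx a b ha hab hb
    have e1 : x = Ψ b - Ψ a := by
      apply hR
      rw [hx1, map_sub, hΨ b (ha.trans hab), hΨ a ha,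
        intervalIntegral.integral_interval_sub_left (hint le_rfl (ha.trans hab)) (hint le_rfl ha)]
    have e2 : ∫ s in a..b, ‖u s‖ ^ 2 = U b - U a :=
      (intervalIntegral.integral_interval_sub_left
        (hu.intervalIntegrable_sq le_rfl (ha.trans hab)) (hu.intervalIntegrable_sq le_rfl ha)).symm
    rw [← e1]
    refine hx2.trans ?_
    rw [e2]
    gcongr
    exact le_abs_self _
  have hdiff2 : ∀ s ∈ Icc 0 (t + 1), ‖Ψ s - Ψ t‖ ≤ √|U s - U t| * √C := by
    intro s hs
    rcases le_total t s with hts | hts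
    · exact hdiff t s ht0 hts hs.2
    · rw [norm_sub_rev, abs_sub_comm]
      exact hdiff s t hs.1 hts (by linarith)
  have hcw : ContinuousWithinAt Ψ (Icc 0 (t + 1)) t := by
    rw [ContinuousWithinAt, tendsto_iff_norm_sub_tendsto_zero]
    have h1 : Tendsto (fun s => √|U s - U t| * √C) (𝓝[Icc 0 (t + 1)] t) (𝓝 0) := by
      have h2 := hU t ⟨ht0, by linarith⟩
      have h3 := ((h2.sub_const (U t)).abs.sqrt).mul_const (√C)
      simpa using h3
    refine squeeze_zero' (Eventually.of_forall fun _ => norm_nonneg _) ?_ h1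
    filter_upwards [self_mem_nhdsWithin] with s hs using hdiff2 s hs
  refine hcw.mono_of_mem_nhdsWithin ?_
  rw [← Ici_inter_Iic]
  exact inter_mem self_mem_nhdsWithin (mem_nhdsWithin_of_mem_nhds (Iic_mem_nhds (by linarith)))

end IsGroupOf

namespace VolterraRel

variable {e : E} {V M : E →L[ℂ] E} {q σ : ℝ} {T : ℝ → E →L[ℂ] E}

theorem hasDerivAt_orbit (hT : IsGroupOf (solOp q σ e V) T) (y : E) (r : ℝ) :
    HasDerivAt (fun r => T (-r) (solOp q σ e V y)) (-(T (-r) y)) r := by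
  refine ((hT.hasDerivAt y (-r)).scomp r (hasDerivAt_neg r)).congr_deriv ?_
  simp

theorem continuous_orbit (hT : IsGroupOf (solOp q σ e V) T) (y : E) :
    Continuous fun r => T (-r) y := (hT.cont y).comp continuous_neg

/-- Bound for the trace at `0`, from the energy identity. -/
theorem integral_trace_zero (hT : IsGroupOf (solOp q σ e V) T) (y : E) (τ : ℝ) :
    2 * q⁻¹ * ∫ r in (0 : ℝ)..τ, ‖inner ℂ e (T (-r) y)‖ ^ 2 =
      ‖solOp q σ e V y‖ ^ 2 - ‖T (-τ) (solOp q σ e V y)‖ ^ 2 := by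
  set z := solOp q σ e V y
  have hd : ∀ r, HasDerivAt (fun r => -‖T (-r) z‖ ^ 2)
      (2 * q⁻¹ * ‖inner ℂ e (T (-r) y)‖ ^ 2) r := by
    intro r
    have h1 := hasDerivAt_orbit hT y r
    have h2 := Complex.reCLM.hasFDerivAt.comp_hasDerivAt r (h1.inner ℂ h1)
    have h3 := re_inner_solOp q σ e V (T (-r) y)
    have h4 : T (-r) z = solOp q σ e V (T (-r) y) := hT.comm _ _
    have h5 : (fun r => -‖T (-r) z‖ ^ 2) =
        fun r => -(Complex.reCLM (inner ℂ (T (-r) z) (T (-r) z))) := by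
      funext r
      rw [Complex.reCLM_apply]
      congr 1
      exact (inner_self_eq_norm_sq (𝕜 := ℂ) _).symm
    rw [h5]
    refine h2.neg.congr_deriv ?_
    rw [Complex.reCLM_apply, h4, inner_neg_left, inner_neg_right, Complex.add_re, Complex.neg_re,
      Complex.neg_re, h3, ← inner_conj_symm, Complex.conj_re, h3]
    ring
  have hc : Continuous fun r => 2 * q⁻¹ * ‖inner ℂ e (T (-r) y)‖ ^ 2 :=
    (((continuous_const.inner (continuous_orbit hT y)).norm).pow 2).const_mul _
  have := intervalIntegral.integral_eq_sub_of_hasDerivAt (a := 0) (b := τ) (fun r _ => hd r)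
    (hc.intervalIntegrable _ _)
  rw [intervalIntegral.integral_const_mul] at this
  rw [this, neg_zero, hT.zero, one_apply_eq_self]
  ring

theorem integral_sq_trace_zero_le (hq : 0 < q) (hT : IsGroupOf (solOp q σ e V) T) (y : E)
    (τ : ℝ) : ∫ r in (0 : ℝ)..τ, ‖inner ℂ e (T (-r) y)‖ ^ 2 ≤
      q / 2 * ‖solOp q σ e V y‖ ^ 2 := by
  have h1 := integral_trace_zero hT y τ
  have h2 := sq_nonneg ‖T (-τ) (solOp q σ e V y)‖
  have h3 : q / 2 * (2 * q⁻¹ * ∫ r in (0 : ℝ)..τ, ‖inner ℂ e (T (-r) y)‖ ^ 2) ≤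
      q / 2 * ‖solOp q σ e V y‖ ^ 2 := by
    rw [h1]; gcongr; linarith
  refine le_trans (le_of_eq ?_) h3
  field_simp

theorem obsBound_one (hq : 0 < q) (hT : IsGroupOf (solOp q σ e V) T) :
    ObsBound (solOp q σ e V) T e :=
  fun τ _ => ⟨q / 2, by positivity, fun y => integral_sq_trace_zero_le hq hT y τ⟩

/-- Bound for the trace at `1`, from the multiplier `1`. -/
theorem obsBound_trace_one (h : VolterraRel e V M) (hq : 0 < q) (hσ : σ ^ 2 = 1)
    (hT : IsGroupOf (solOp q σ e V) T) :
    ObsBound (solOp q σ e V) T ((q⁻¹ : ℂ) • e + (Complex.I * σ) • adjoint V e) := by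
  intro τ hτ
  have hσ1 : |σ| = 1 := by
    rw [← sq_eq_sq₀ (abs_nonneg _) zero_le_one, sq_abs, hσ, one_pow]
  -- The three summands come from the trace at `0`, from `∫ ‖z‖²` over `[0, τ]`, and from the two
  -- endpoint values of `Im ⟪V z, z⟫`.
  refine ⟨(q⁻¹ ^ 2 + 1) * (q / 2) + τ + 2 * ‖V‖, by positivity, fun y => ?_⟩
  set z := solOp q σ e V y
  have hz : ∀ r, T (-r) z = solOp q σ e V (T (-r) y) := fun r => hT.comm _ _
  -- The backward evolution does not increase the norm, by the integrated energy identity.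
  have hzn : ∀ r, 0 ≤ r → ‖T (-r) z‖ ≤ ‖z‖ := by
    intro r hr
    have h1 := integral_trace_zero hT y r
    have h2 : 0 ≤ ∫ r in (0 : ℝ)..r, ‖inner ℂ e (T (-r) y)‖ ^ 2 :=
      intervalIntegral.integral_nonneg hr fun _ _ => by positivity
    have h3 : 0 ≤ 2 * q⁻¹ * ∫ r in (0 : ℝ)..r, ‖inner ℂ e (T (-r) y)‖ ^ 2 := by positivity
    exact abs_le_of_sq_le_sq' (by linarith) (norm_nonneg _) |>.2
  -- the derivative of `Im ⟪V z, z⟫`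
  set D : ℝ → ℝ := fun r => (inner ℂ (V (T (-r) y)) (T (-r) z) +
    inner ℂ (V (T (-r) z)) (T (-r) y)).im
  have hd : ∀ r, HasDerivAt (fun r => -(inner ℂ (V (T (-r) z)) (T (-r) z)).im) (D r) r := by
    intro r
    have h1 := hasDerivAt_orbit hT y r
    have h2 : HasDerivAt (fun r => V (T (-r) z)) (V (-(T (-r) y))) r :=
      (V.restrictScalars ℝ).hasFDerivAt.comp_hasDerivAt r h1
    have h3 := Complex.imCLM.hasFDerivAt.comp_hasDerivAt r (h2.inner ℂ h1)
    refine h3.neg.congr_deriv ?_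
    rw [Complex.imCLM_apply, inner_neg_right, map_neg, inner_neg_left]
    simp only [D, Complex.add_im, Complex.neg_im]
    ring
  have hcy := continuous_orbit hT y
  have hcz := continuous_orbit hT z
  have hDc : Continuous D := by
    refine Complex.continuous_im.comp ?_
    exact ((V.continuous.comp hcy).inner hcz).add ((V.continuous.comp hcz).inner hcy)
  have hDint := intervalIntegral.integral_eq_sub_of_hasDerivAt (a := 0) (b := τ)
    (fun r _ => hd r) (hDc.intervalIntegrable _ _)
  have hVz : ∀ r, 0 ≤ r → |(inner ℂ (V (T (-r) z)) (T (-r) z)).im| ≤ ‖V‖ * ‖z‖ ^ 2 := by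
    intro r hr
    refine (Complex.abs_im_le_norm _).trans ((norm_inner_le_norm _ _).trans ?_)
    have h1 := V.le_opNorm (T (-r) z)
    have h2 := hzn r hr
    calc _ ≤ (‖V‖ * ‖z‖) * ‖z‖ := by gcongr; exact h1.trans (by gcongr)
      _ = _ := by ring
  set β : ℝ → ℂ := fun r => inner ℂ ((q⁻¹ : ℂ) • e + (Complex.I * σ) • adjoint V e) (T (-r) y)
  have hβ : ∀ r, β r = (q⁻¹ : ℂ) * inner ℂ e (T (-r) y) -
      Complex.I * σ * inner ℂ e (V (T (-r) y)) := by
    intro r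
    simp only [β]
    rw [inner_add_left, inner_smul_left, inner_smul_left, adjoint_inner_left]
    simp only [map_mul, map_inv₀, Complex.conj_I, Complex.conj_ofReal]
    ring
  have hpt : ∀ r ∈ Icc 0 τ, ‖β r‖ ^ 2 ≤ (q⁻¹ ^ 2 + 1) * ‖inner ℂ e (T (-r) y)‖ ^ 2 +
      ‖z‖ ^ 2 - σ * D r := by
    intro r hr
    have h1 := h.im_inner_add_inner (q := q) hσ (T (-r) y)
    rw [← hz r, ← hβ r] at h1
    change D r = _ at h1
    have h2 : |σ * (inner ℂ e (T (-r) y) * inner ℂ (T (-r) z) e).im| ≤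
        ‖inner ℂ e (T (-r) y)‖ * ‖z‖ := by
      rw [abs_mul, hσ1, one_mul]
      refine (Complex.abs_im_le_norm _).trans ?_
      rw [norm_mul]
      gcongr
      refine (norm_inner_le_norm _ _).trans ?_
      rw [h.norm_one, mul_one]
      exact hzn r hr.1
    have h3 : ‖(q⁻¹ : ℂ) * inner ℂ e (T (-r) y)‖ ^ 2 = q⁻¹ ^ 2 * ‖inner ℂ e (T (-r) y)‖ ^ 2 := by
      rw [norm_mul, mul_pow, norm_inv, Complex.norm_real, Real.norm_eq_abs, abs_of_pos hq]
    rw [h3] at h1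
    have h4 : σ * D r = q⁻¹ ^ 2 * ‖inner ℂ e (T (-r) y)‖ ^ 2 - ‖β r‖ ^ 2 +
        σ * (inner ℂ e (T (-r) y) * inner ℂ (T (-r) z) e).im := by
      rw [h1]
      linear_combination (q⁻¹ ^ 2 * ‖inner ℂ e (T (-r) y)‖ ^ 2 - ‖β r‖ ^ 2) * hσ
    have h5 := (abs_le.1 h2).2
    have h6 := sq_nonneg (‖inner ℂ e (T (-r) y)‖ - ‖z‖)
    nlinarith [sq_nonneg ‖inner ℂ e (T (-r) y)‖, sq_nonneg ‖z‖]
  have hβc : Continuous fun r => ‖β r‖ ^ 2 := ((continuous_const.inner hcy).norm).pow 2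
  have hec : Continuous fun r => ‖inner ℂ e (T (-r) y)‖ ^ 2 :=
    ((continuous_const.inner hcy).norm).pow 2
  have hc1 : Continuous fun r => (q⁻¹ ^ 2 + 1) * ‖inner ℂ e (T (-r) y)‖ ^ 2 + ‖z‖ ^ 2 :=
    (hec.const_mul (q⁻¹ ^ 2 + 1)).add continuous_const
  have hc2 : Continuous fun r => (q⁻¹ ^ 2 + 1) * ‖inner ℂ e (T (-r) y)‖ ^ 2 + ‖z‖ ^ 2 -
      σ * D r := hc1.sub (hDc.const_mul σ)
  refine (intervalIntegral.integral_mono_on hτ (hβc.intervalIntegrable _ _)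
    (hc2.intervalIntegrable _ _) hpt).trans ?_
  rw [intervalIntegral.integral_sub (hc1.intervalIntegrable _ _)
      ((hDc.const_mul σ).intervalIntegrable _ _),
    intervalIntegral.integral_add ((hec.const_mul (q⁻¹ ^ 2 + 1)).intervalIntegrable _ _)
      (continuous_const.intervalIntegrable _ _), intervalIntegral.integral_const_mul,
    intervalIntegral.integral_const_mul, intervalIntegral.integral_const, hDint]
  have h1 : _ ≤ q / 2 * ‖z‖ ^ 2 := integral_sq_trace_zero_le hq hT y τ
  have h2 : |σ * (-(inner ℂ (V (T (-τ) z)) (T (-τ) z)).im -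
      -(inner ℂ (V (T (-0) z)) (T (-0) z)).im)| ≤ 2 * ‖V‖ * ‖z‖ ^ 2 := by
    rw [abs_mul, hσ1, one_mul]
    refine (abs_sub _ _).trans ?_
    rw [abs_neg, abs_neg]
    linarith [hVz τ hτ, hVz 0 le_rfl]
  have h3 := (abs_le.1 h2).1
  have h4 := mul_le_mul_of_nonneg_left h1 (show 0 ≤ q⁻¹ ^ 2 + 1 by positivity)
  rw [sub_zero, smul_eq_mul]
  refine (sub_le_sub (add_le_add h4 le_rfl) h3).trans (le_of_eq ?_)
  ring

end VolterraRel

end Schrod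

end

/-! ### The concrete model on `L²[0,1]` -/

open MeasureTheory Set Filter Topology

noncomputable section

namespace Schrod

open ContinuousLinearMap

local notation "μ₀" => (volume.restrict (Icc (0 : ℝ) 1) : Measure ℝ)

/-- The constant function `1`. -/
def oneL2 : H := indicatorConstLp 2 MeasurableSet.univ (measure_ne_top _ _) 1

theorem oneL2_ae : ∀ᵐ x ∂μ₀, oneL2 x = 1 := by
  filter_upwards [indicatorConstLp_coeFn (p := 2) (hs := MeasurableSet.univ)
    (hμs := measure_ne_top μ₀ univ) (c := (1 : ℂ))] with x hx
  rw [oneL2, hx]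
  simp

theorem inner_eq_integral (f g : H) :
    inner ℂ f g = ∫ x in (0 : ℝ)..1, starRingEnd ℂ (f x) * g x := by
  rw [L2.inner_def, intervalIntegral.integral_of_le zero_le_one, ← integral_Icc_eq_integral_Ioc]
  refine integral_congr_ae (Eventually.of_forall fun x => ?_)
  simp [mul_comm]

theorem integral_congr_of_ae {f g : ℝ → ℂ} (h : ∀ᵐ x ∂μ₀, f x = g x) {x : ℝ}
    (hx : x ∈ Icc (0 : ℝ) 1) : ∫ y in (0 : ℝ)..x, f y = ∫ y in (0 : ℝ)..x, g y := by
  rw [intervalIntegral.integral_of_le hx.1, intervalIntegral.integral_of_le hx.1]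
  refine integral_congr_ae ?_
  have hs : Ioc 0 x ⊆ Icc (0 : ℝ) 1 := fun y hy => ⟨hy.1.le, hy.2.trans hx.2⟩
  exact ae_restrict_of_ae_restrict_of_subset hs h

theorem inner_oneL2 (g : H) : inner ℂ oneL2 g = ∫ x in (0 : ℝ)..1, g x := by
  rw [inner_eq_integral]
  refine integral_congr_of_ae ?_ (by simp)
  filter_upwards [oneL2_ae] with x hx
  simp [hx]

theorem norm_oneL2 : ‖oneL2‖ = 1 := by
  have h : inner ℂ oneL2 oneL2 = 1 := by
    rw [inner_oneL2, integral_congr_of_ae oneL2_ae (by simp)]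
    simp
  rw [inner_self_eq_norm_sq_to_K] at h
  have h2 : ((‖oneL2‖ ^ 2 : ℝ) : ℂ) = 1 := by push_cast; exact h
  have h3 : ‖oneL2‖ ^ 2 = 1 := by exact_mod_cast h2
  exact (pow_eq_one_iff_of_nonneg (norm_nonneg _) two_ne_zero).1 h3

theorem memLp_of_continuousOn_of_bound {F : ℝ → ℂ} {C : ℝ} (hF : AEStronglyMeasurable F μ₀)
    (hC : ∀ x ∈ Icc (0 : ℝ) 1, ‖F x‖ ≤ C) : MemLp F 2 μ₀ :=
  MemLp.of_bound hF C ((ae_restrict_iff' measurableSet_Icc).2 (Eventually.of_forall hC))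

theorem memLp_primitive (g : H) : MemLp (fun x : ℝ => ∫ y in (0 : ℝ)..x, g y) 2 μ₀ := by
  refine memLp_of_continuousOn_of_bound ?_ fun x hx => norm_integral_le g hx
  have := continuousOn_primitive 0 g
  simp only [zero_add] at this
  exact this.aestronglyMeasurable measurableSet_Icc

/-- The integration operator `g ↦ ∫₀ˣ g`. -/
def primitive : H →L[ℂ] H :=
  LinearMap.mkContinuous
    { toFun := fun g => (memLp_primitive g).toLp
      map_add' := fun f g => by
        refine Lp.ext ?_
        filter_upwards [(memLp_primitive (f + g)).coeFn_toLp, (memLp_primitive f).coeFn_toLp,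
          (memLp_primitive g).coeFn_toLp, Lp.coeFn_add (memLp_primitive f).toLp
          (memLp_primitive g).toLp, ae_restrict_mem measurableSet_Icc] with x h1 h2 h3 h4 h5
        rw [h1, h4, Pi.add_apply, h2, h3, integral_add_of_mem f g h5]
      map_smul' := fun a g => by
        refine Lp.ext ?_
        filter_upwards [(memLp_primitive (a • g)).coeFn_toLp, (memLp_primitive g).coeFn_toLp,
          Lp.coeFn_smul a (memLp_primitive g).toLp, ae_restrict_mem measurableSet_Icc]
          with x h1 h2 h3 h4
        rw [h1, RingHom.id_apply, h3, Pi.smul_apply, h2, integral_smul_of_mem a g h4,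
          smul_eq_mul] }
    1 fun g => by
      rw [one_mul]
      have h := Lp.norm_le_of_ae_bound (f := (memLp_primitive g).toLp) (norm_nonneg g) (by
        filter_upwards [(memLp_primitive g).coeFn_toLp, ae_restrict_mem measurableSet_Icc]
          with x h1 h2
        rw [h1]
        exact norm_integral_le g h2)
      refine h.trans (le_of_eq ?_)
      simp [measureUnivNNReal]

theorem primitive_ae (g : H) : ∀ᵐ x ∂μ₀, primitive g x = ∫ y in (0 : ℝ)..x, g y :=
  (memLp_primitive g).coeFn_toLp

theorem memLp_mulX (g : H) : MemLp (fun x : ℝ => (x : ℂ) * g x) 2 μ₀ := by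
  refine (Lp.memLp g).mono ?_ ?_
  · exact (Complex.continuous_ofReal.aestronglyMeasurable).mul (Lp.aestronglyMeasurable g)
  · filter_upwards [ae_restrict_mem measurableSet_Icc] with x hx
    rw [norm_mul, Complex.norm_real, Real.norm_eq_abs, abs_of_nonneg hx.1]
    exact mul_le_of_le_one_left (norm_nonneg _) hx.2

/-- Multiplication by the independent variable. -/
def mulX : H →L[ℂ] H :=
  LinearMap.mkContinuous
    { toFun := fun g => (memLp_mulX g).toLp
      map_add' := fun f g => by
        refine Lp.ext ?_
        filter_upwards [(memLp_mulX (f + g)).coeFn_toLp, (memLp_mulX f).coeFn_toLp,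
          (memLp_mulX g).coeFn_toLp, Lp.coeFn_add (memLp_mulX f).toLp
          (memLp_mulX g).toLp, Lp.coeFn_add f g] with x h1 h2 h3 h4 h5
        rw [h1, h4, Pi.add_apply, h2, h3, h5, Pi.add_apply, mul_add]
      map_smul' := fun a g => by
        refine Lp.ext ?_
        filter_upwards [(memLp_mulX (a • g)).coeFn_toLp, (memLp_mulX g).coeFn_toLp,
          Lp.coeFn_smul a (memLp_mulX g).toLp, Lp.coeFn_smul a g]
          with x h1 h2 h3 h4
        rw [h1, RingHom.id_apply, h3, Pi.smul_apply, h2, h4, Pi.smul_apply, smul_eq_mul,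
          smul_eq_mul]
        ring }
    1 fun g => by
      rw [one_mul]
      refine Lp.norm_le_norm_of_ae_le ?_
      filter_upwards [(memLp_mulX g).coeFn_toLp, ae_restrict_mem measurableSet_Icc] with x h hx
      rw [LinearMap.coe_mk, AddHom.coe_mk, h, norm_mul, Complex.norm_real, Real.norm_eq_abs,
        abs_of_nonneg hx.1]
      exact mul_le_of_le_one_left (norm_nonneg _) hx.2

theorem mulX_ae (g : H) : ∀ᵐ x ∂μ₀, mulX g x = x * g x := (memLp_mulX g).coeFn_toLp

theorem inner_mulX (f g : H) : inner ℂ (mulX f) g = inner ℂ f (mulX g) := by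
  rw [inner_eq_integral, inner_eq_integral]
  refine integral_congr_of_ae ?_ (by simp)
  filter_upwards [mulX_ae f, mulX_ae g] with x h1 h2
  rw [h1, h2, map_mul, Complex.conj_ofReal]
  ring

theorem mulX_oneL2 : mulX oneL2 = primitive oneL2 := by
  refine Lp.ext ?_
  filter_upwards [mulX_ae oneL2, primitive_ae oneL2, oneL2_ae, ae_restrict_mem measurableSet_Icc]
    with x h1 h2 h3 h4
  rw [h1, h2, h3, integral_congr_of_ae oneL2_ae h4]
  simp

/-- Integration by parts against the independent variable. -/
theorem mulX_primitive (g : H) :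
    mulX (primitive g) - primitive (mulX g) = primitive (primitive g) := by
  refine Lp.ext ?_
  filter_upwards [Lp.coeFn_sub (mulX (primitive g)) (primitive (mulX g)),
    mulX_ae (primitive g), primitive_ae g, primitive_ae (mulX g), primitive_ae (primitive g),
    ae_restrict_mem measurableSet_Icc] with x h1 h2 h3 h4 h5 h6
  rw [h1, Pi.sub_apply, h2, h3, h4, h5, integral_congr_of_ae (primitive_ae g) h6,
    integral_congr_of_ae (mulX_ae g) h6]
  have hg := intervalIntegrable_of_mem g h6
  have h := integral_bilin_integral (ContinuousLinearMap.mul ℂ ℂ) h6.1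
    (f := fun _ => 1) (k := fun y => g y) intervalIntegrable_const hg
  simp only [mul_apply', one_mul, intervalIntegral.integral_const] at h
  rw [h, ← intervalIntegral.integral_const_mul, ← intervalIntegral.integral_sub (hg.const_mul _)]
  · refine intervalIntegral.integral_congr fun y _ => ?_
    simp [sub_mul]
  · exact hg.continuousOn_mul Complex.continuous_ofReal.continuousOn

/-- Exchanging the integrations turns the second term into `g` against the tail integral of the
conjugate of `f`. The first term has the initial integral instead, and the two add up to the full
integral. -/
theorem inner_primitive_add (f g : H) : inner ℂ (primitive f) g + inner ℂ f (primitive g) =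
    inner ℂ f oneL2 * inner ℂ oneL2 g := by
  have hf : IntervalIntegrable (fun x => starRingEnd ℂ (f x)) volume 0 1 := by
    have h := intervalIntegrable_of_mem f (x := 1) (by simp)
    exact ⟨(Complex.conjCLE : ℂ →L[ℝ] ℂ).integrable_comp h.1,
      (Complex.conjCLE : ℂ →L[ℝ] ℂ).integrable_comp h.2⟩
  have hg := intervalIntegrable_of_mem g (x := 1) (by simp)
  have hconj : ∀ x : ℝ, starRingEnd ℂ (∫ y in (0 : ℝ)..x, f y) =
      ∫ y in (0 : ℝ)..x, starRingEnd ℂ (f y) := fun x => by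
    simp only [intervalIntegral, map_sub, integral_conj]
  have h1 : inner ℂ f (primitive g) =
      ∫ r in (0 : ℝ)..1, (∫ s in r..1, starRingEnd ℂ (f s)) * g r := by
    have h := integral_bilin_integral (ContinuousLinearMap.mul ℂ ℂ) zero_le_one hf hg
    simp only [mul_apply'] at h
    rw [← h, inner_eq_integral]
    refine integral_congr_of_ae ?_ (by simp)
    filter_upwards [primitive_ae g] with x hx
    rw [hx]
  have h2 : inner ℂ (primitive f) g =
      ∫ r in (0 : ℝ)..1, (∫ s in (0 : ℝ)..r, starRingEnd ℂ (f s)) * g r := by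
    rw [inner_eq_integral]
    refine integral_congr_of_ae ?_ (by simp)
    filter_upwards [primitive_ae f] with x hx
    rw [hx, hconj]
  have hprim : ContinuousOn (fun r => ∫ s in (0 : ℝ)..r, starRingEnd ℂ (f s)) (uIcc 0 1) :=
    intervalIntegral.continuousOn_primitive_interval' hf (by simp)
  have hsplit : ∀ r ∈ uIcc (0 : ℝ) 1, ∫ s in r..1, starRingEnd ℂ (f s) =
      (∫ s in (0 : ℝ)..1, starRingEnd ℂ (f s)) - ∫ s in (0 : ℝ)..r, starRingEnd ℂ (f s) := by
    intro r hr
    rw [intervalIntegral.integral_interval_sub_left hf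
      (hf.mono_set (uIcc_subset_uIcc_left hr))]
  have h3 : ∫ r in (0 : ℝ)..1, (∫ s in r..1, starRingEnd ℂ (f s)) * g r =
      (∫ s in (0 : ℝ)..1, starRingEnd ℂ (f s)) * (∫ r in (0 : ℝ)..1, g r) -
        ∫ r in (0 : ℝ)..1, (∫ s in (0 : ℝ)..r, starRingEnd ℂ (f s)) * g r := by
    rw [← intervalIntegral.integral_const_mul, ← intervalIntegral.integral_sub (hg.const_mul _)
      (hg.continuousOn_mul hprim)]
    refine intervalIntegral.integral_congr fun r hr => ?_
    rw [hsplit r hr, sub_mul]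
  rw [h1, h2, h3, add_sub_cancel, ← inner_oneL2, ← hconj, ← inner_oneL2, inner_conj_symm]

/-- The integration operator `g ↦ ∫ₓ¹ g`. -/
def tailIntegral : H →L[ℂ] H := adjoint primitive

theorem adjoint_tailIntegral : adjoint tailIntegral = primitive := adjoint_adjoint _

theorem tailIntegral_add (g : H) :
    tailIntegral g + primitive g = inner ℂ oneL2 g • oneL2 := by
  refine ext_inner_left ℂ fun f => ?_
  rw [inner_add_right, tailIntegral, adjoint_inner_right, inner_primitive_add, inner_smul_right,
    mul_comm]

theorem tailIntegral_eq (g : H) :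
    tailIntegral g = inner ℂ oneL2 g • oneL2 - primitive g := by
  rw [← tailIntegral_add, add_sub_cancel_right]

theorem oneL2_add_primitive_ae (c : ℂ) (g : H) :
    ∀ᵐ x ∂μ₀, (c • oneL2 + primitive g : H) x = c + ∫ y in (0 : ℝ)..x, g y := by
  filter_upwards [Lp.coeFn_add (c • oneL2) (primitive g), Lp.coeFn_smul c oneL2, oneL2_ae,
    primitive_ae g] with x h1 h2 h3 h4
  rw [h1, Pi.add_apply, h2, Pi.smul_apply, h3, h4, smul_eq_mul, mul_one]

theorem hasDerivL2_add_primitive (c : ℂ) (g : H) : HasDerivL2 (c • oneL2 + primitive g) g :=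
  ⟨c, oneL2_add_primitive_ae c g⟩

theorem pointValue_add_primitive (c : ℂ) (g : H) {x : ℝ} (hx : x ∈ Icc (0 : ℝ) 1) :
    pointValue (c • oneL2 + primitive g) x = c + ∫ y in (0 : ℝ)..x, g y :=
  pointValue_eq (continuousOn_primitive c g) (oneL2_add_primitive_ae c g) hx

theorem pointValue_add_primitive_zero (c : ℂ) (g : H) :
    pointValue (c • oneL2 + primitive g) 0 = c := by
  rw [pointValue_add_primitive c g (by simp)]
  simp

theorem pointValue_add_primitive_one (c : ℂ) (g : H) :
    pointValue (c • oneL2 + primitive g) 1 = c + inner ℂ oneL2 g := by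
  rw [pointValue_add_primitive c g (by simp), inner_oneL2]

theorem HasDerivL2.eq {f g : H} (h : HasDerivL2 f g) :
    f = pointValue f 0 • oneL2 + primitive g := by
  refine Lp.ext ?_
  filter_upwards [h.ae_eq, oneL2_add_primitive_ae (pointValue f 0) g,
    ae_restrict_mem measurableSet_Icc] with x h1 h2 h3
  rw [h1, h2, h.pointValue_eq h3]

theorem tailIntegral_injective : Function.Injective tailIntegral := by
  rw [injective_iff_map_eq_zero]
  intro g hg
  refine HasDerivL2.eq_zero ?_
  have h := hasDerivL2_add_primitive (-inner ℂ oneL2 g) g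
  have h2 := tailIntegral_eq g
  rw [hg] at h2
  rwa [neg_smul, neg_add_eq_sub, ← neg_sub, ← h2, neg_zero] at h

/-- The commutation relation is `mulX_primitive` passed to adjoints, since the summand `1` of `1 -
mulX` drops out of the commutator. -/
theorem volterraRel : VolterraRel oneL2 tailIntegral (1 - mulX) where
  add_adjoint g := by rw [adjoint_tailIntegral, tailIntegral_add]
  comm g := by
    have h : tailIntegral (mulX g) - mulX (tailIntegral g) = tailIntegral (tailIntegral g) := by
      refine ext_inner_left ℂ fun f => ?_
      rw [inner_sub_right, ← inner_mulX]
      simp only [tailIntegral, adjoint_inner_right]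
      rw [← inner_mulX, ← inner_sub_left, mulX_primitive]
    rw [← h]
    change tailIntegral g - mulX (tailIntegral g) - tailIntegral (g - mulX g) = _
    rw [map_sub]
    abel
  apply_one := by
    change oneL2 - mulX oneL2 = _
    rw [tailIntegral_eq, inner_self_eq_norm_sq_to_K, norm_oneL2, mulX_oneL2]
    simp
  norm_one := norm_oneL2
  symm x y := by
    change inner ℂ (x - mulX x) y = inner ℂ x (y - mulX y)
    rw [inner_sub_left, inner_sub_right, inner_mulX]
  inj := tailIntegral_injective

/-- The inverse of `bvpOp (-iσ) (-iσq)`. -/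
def solR (q σ : ℝ) : H →L[ℂ] H := solOp q σ oneL2 tailIntegral

theorem solR_apply (q σ : ℝ) (g : H) : solR q σ g = ((q⁻¹ : ℂ) * inner ℂ oneL2 g) • oneL2 +
    primitive ((-(Complex.I * σ)) • tailIntegral g) := by
  rw [solR, solOp_apply, adjoint_tailIntegral, map_smul, neg_smul, sub_eq_add_neg]

theorem smul_tailIntegral (a : ℂ) (g : H) :
    (-a) • tailIntegral g = (-a * inner ℂ oneL2 g) • oneL2 + primitive (a • g) := by
  rw [tailIntegral_eq, map_smul, smul_sub, smul_smul, neg_smul a, sub_neg_eq_add]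

theorem adjoint_solR (q σ : ℝ) : adjoint (solR q σ) = solR q (-σ) := adjoint_solOp _ _ _ _

/-- `f = solR q σ g` as an element of `H²`, with its derivatives. -/
def solH2 (q σ : ℝ) : H →L[ℂ] H2 :=
  ((solR q σ).prod (((-(Complex.I * σ)) • tailIntegral).prod
    ((Complex.I * σ) • ContinuousLinearMap.id ℂ H))).codRestrict H2 fun g => by
    constructor
    · change HasDerivL2 (solR q σ g) ((-(Complex.I * σ)) • tailIntegral g)
      rw [solR_apply]
      exact hasDerivL2_add_primitive _ _
    · change HasDerivL2 ((-(Complex.I * σ)) • tailIntegral g) ((Complex.I * σ) • g)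
      rw [smul_tailIntegral]
      exact hasDerivL2_add_primitive _ _

theorem solH2_coe (q σ : ℝ) (g : H) : (solH2 q σ g : H × H × H) =
    (solR q σ g, (-(Complex.I * σ)) • tailIntegral g, (Complex.I * σ) • g) := rfl

theorem pointValue_solR_zero (q σ : ℝ) (g : H) :
    pointValue (solR q σ g) 0 = (q⁻¹ : ℂ) * inner ℂ oneL2 g := by
  rw [solR_apply, pointValue_add_primitive_zero]

theorem pointValue_solR_one (q σ : ℝ) (g : H) : pointValue (solR q σ g) 1 =
    (q⁻¹ : ℂ) * inner ℂ oneL2 g - Complex.I * σ * inner ℂ oneL2 (tailIntegral g) := by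
  rw [solR_apply, pointValue_add_primitive_one, inner_smul_right]
  ring

/-- The condition `f'(1) = 0` forces `f' = -∫ₓ¹ f''`, and the condition at `0` then fixes `f(0) =
q⁻¹ ∫ y`. Both conditions are thus built into `solR`. The cases `σ = 1` and `σ = -1` are `A` and
`A*`. -/
theorem mem_bvpGraph_iff {q σ : ℝ} (hq : 0 < q) (hσ : σ ^ 2 = 1) (x y : H) :
    (x, y) ∈ bvpGraph (-Complex.I * σ) (-Complex.I * σ * q) ↔ x = solR q σ y := by
  have hI : (Complex.I * σ) * (Complex.I * σ) = -1 := by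
    have : ((σ : ℂ)) ^ 2 = 1 := by exact_mod_cast hσ
    linear_combination Complex.I ^ 2 * this + Complex.I_sq
  have hq' : (q : ℂ) ≠ 0 := by exact_mod_cast hq.ne'
  constructor
  · rintro ⟨⟨f, f1, f2⟩, ⟨h1, h2⟩, hx, hy, h0, h3⟩
    simp only at h1 h2 hx hy h0 h3
    subst hx hy
    have e1 := h1.eq
    have e2 := h2.eq
    have e3 : pointValue f1 1 = pointValue f1 0 + inner ℂ oneL2 f2 := by
      rw [h2.pointValue_eq (by simp), inner_oneL2]
    rw [h3] at e3
    have e4 : pointValue f1 0 = -inner ℂ oneL2 f2 := eq_neg_of_add_eq_zero_left e3.symm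
    rw [e4] at e2 h0
    have e6 : f1 = -tailIntegral f2 := by
      rw [tailIntegral_eq, neg_sub]
      exact e2.trans (by rw [neg_smul, neg_add_eq_sub])
    have e7 : pointValue x 0 = (q⁻¹ : ℂ) * (-Complex.I * σ * inner ℂ oneL2 f2) := by
      rw [eq_inv_mul_iff_mul_eq₀ hq']
      linear_combination (-Complex.I * σ) * h0 + q * pointValue x 0 * hI
    rw [solR_apply, inner_smul_right, ← e7, map_smul tailIntegral, smul_smul]
    have e8 : -(Complex.I * σ) * (-Complex.I * σ) = -1 := by linear_combination hI
    rw [e8, neg_one_smul, ← e6]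
    exact e1
  · rintro rfl
    refine ⟨solH2 q σ y, (solH2 q σ y).2, rfl, ?_, ?_, ?_⟩
    · rw [solH2_coe, smul_smul]
      have : -Complex.I * σ * (Complex.I * σ) = 1 := by linear_combination -hI
      rw [this, one_smul]
    · rw [solH2_coe]
      simp only
      rw [pointValue_solR_zero, smul_tailIntegral, pointValue_add_primitive_zero]
      field_simp
    · rw [solH2_coe]
      simp only
      rw [smul_tailIntegral, pointValue_add_primitive_one, inner_smul_right]
      ring

end Schrod

end

/-! ### The operators `A` and `A*`, and the extrapolation space -/

open MeasureTheory Set Filter Topology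

noncomputable section

namespace Schrod

open ContinuousLinearMap

section Operators

variable {q : ℝ} (hq : 0 < q)

theorem mem_graph_A (hq : 0 < q) (x y : H) : (x, y) ∈ (A q).graph ↔ x = solR q 1 y := by
  have h := mem_bvpGraph_iff (σ := 1) hq (by norm_num) x y
  rw [Complex.ofReal_one, mul_one] at h
  rw [A, graph_bvpOp, h]

theorem mem_graph_Astar (hq : 0 < q) (x y : H) :
    (x, y) ∈ (Astar q).graph ↔ x = solR q (-1) y := by
  have h := mem_bvpGraph_iff (σ := -1) hq (by norm_num) x y
  have e : -Complex.I * ((-1 : ℝ) : ℂ) = Complex.I := by simp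
  rw [e] at h
  rw [Astar, graph_bvpOp, h]

theorem inner_solR_left (q : ℝ) (x y : H) :
    inner ℂ (solR q 1 x) y = inner ℂ x (solR q (-1) y) := inner_solOp_left _ _ _ _ _ _

theorem inner_solR_right (q : ℝ) (x y : H) :
    inner ℂ x (solR q 1 y) = inner ℂ (solR q (-1) x) y := by
  rw [← inner_conj_symm, inner_solR_left, inner_conj_symm]

theorem denseRange_solR (hq : 0 < q) : DenseRange (solR q 1) :=
  volterraRel.denseRange hq (by norm_num)

theorem solR_injective (hq : 0 < q) : Function.Injective (solR q 1) :=
  volterraRel.injective hq (by norm_num)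

theorem solR_neg_injective (hq : 0 < q) : Function.Injective (adjoint (solR q 1)) := by
  rw [adjoint_solR]
  exact volterraRel.injective hq (by norm_num)

theorem dense_domain_A (hq : 0 < q) : Dense ((A q).domain : Set H) := by
  refine (denseRange_solR hq).mono ?_
  rintro _ ⟨y, rfl⟩
  exact LinearPMap.mem_domain_iff.2 ⟨y, (mem_graph_A hq _ _).2 rfl⟩

/-- Both operators have bounded, everywhere defined inverses, so the claim reduces to `solR q (-1)`
being the adjoint of `solR q 1`. -/
theorem adjoint_A (hq : 0 < q) : (A q).adjoint = Astar q := by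
  refine LinearPMap.eq_of_eq_graph ?_
  rw [LinearPMap.adjoint_graph_eq_graph_adjoint (dense_domain_A hq)]
  ext ⟨y, w⟩
  rw [Submodule.mem_adjoint_iff, mem_graph_Astar hq]
  constructor
  · intro h
    refine ext_inner_left ℂ fun g => ?_
    have := h (solR q 1 g) g ((mem_graph_A hq _ _).2 rfl)
    rw [sub_eq_zero, inner_solR_left] at this
    exact this
  · rintro rfl a b hab
    rw [mem_graph_A hq] at hab
    rw [hab, inner_solR_left, sub_self]

/-- The point of the graph of `A*` given by its second component. -/
def graphPoint (hq : 0 < q) : H →L[ℂ] (Astar q).graph :=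
  ((solR q (-1)).prod (ContinuousLinearMap.id ℂ H)).codRestrict (Astar q).graph fun _ =>
    (mem_graph_Astar hq _ _).2 rfl

theorem graphPoint_snd (p : (Astar q).graph) : graphPoint hq p.1.2 = p := by
  refine Subtype.ext (Prod.ext ?_ rfl)
  exact ((mem_graph_Astar hq p.1.1 p.1.2).1 p.2).symm

theorem Aext_solR (hq : 0 < q) (x : H) : Aext q (solR q 1 x) = emb q x := by
  refine DFunLike.ext _ _ fun p => ?_
  rw [Aext_apply, emb_apply, inner_solR_right, ← (mem_graph_Astar hq p.1.1 p.1.2).1 p.2]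

/-- The graph of `A*` is parametrised boundedly by its second component. An element of `X₋₁` is
therefore a bounded functional of `A*ψ`, and Riesz represents it. -/
theorem Aext_surjective (hq : 0 < q) : Function.Surjective (Aext q) := by
  intro ℓ
  set φ : H →L[ℂ] ℂ := LinearMap.mkContinuous
    { toFun := fun ψ => starRingEnd ℂ (ℓ (graphPoint hq ψ))
      map_add' := fun ψ ψ' => by
        rw [map_add]
        exact (congrArg (starRingEnd ℂ) (ContinuousLinearMap.map_add
          (ℓ : (Astar q).graph →SL[starRingEnd ℂ] ℂ) _ _)).trans (map_add _ _ _)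
      map_smul' := fun a ψ => by
        rw [map_smul]
        refine (congrArg (starRingEnd ℂ) (ContinuousLinearMap.map_smulₛₗ
          (ℓ : (Astar q).graph →SL[starRingEnd ℂ] ℂ) _ _)).trans ?_
        rw [smul_eq_mul, map_mul, Complex.conj_conj]
        rfl }
    (‖ℓ‖ * ‖graphPoint hq‖) fun ψ => by
      refine (RCLike.norm_conj _).trans_le ?_
      rw [mul_assoc]
      exact (ContinuousLinearMap.le_opNorm
        (ℓ : (Astar q).graph →SL[starRingEnd ℂ] ℂ) _).trans
          (mul_le_mul_of_nonneg_left ((graphPoint hq).le_opNorm ψ) (norm_nonneg _))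
  refine ⟨(InnerProductSpace.toDual ℂ H).symm φ, DFunLike.ext _ _ fun p => ?_⟩
  rw [Aext_apply, ← inner_conj_symm, InnerProductSpace.toDual_symm_apply]
  have : φ p.1.2 = starRingEnd ℂ (ℓ p) := by
    change starRingEnd ℂ (ℓ (graphPoint hq p.1.2)) = _
    rw [graphPoint_snd]
  rw [this, Complex.conj_conj]

/-- The functional is tested on the graph point with second component `g`, where its value is
`‖g‖²`. -/
theorem norm_le_norm_Aext (hq : 0 < q) (g : H) :
    ‖g‖ ≤ (‖graphPoint hq‖) * ‖Aext q g‖ := by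
  have h1 : Aext q g (graphPoint hq g) = inner ℂ g g := rfl
  have h2 : ‖Aext q g (graphPoint hq g)‖ ≤ ‖Aext q g‖ * ‖graphPoint hq g‖ :=
    ContinuousLinearMap.le_opNorm (Aext q g : (Astar q).graph →SL[starRingEnd ℂ] ℂ) _
  rw [h1, inner_self_eq_norm_sq_to_K, norm_pow, RCLike.norm_ofReal, abs_norm] at h2
  have h3 : ‖g‖ ^ 2 ≤ ‖Aext q g‖ * (‖graphPoint hq‖ * ‖g‖) :=
    h2.trans (by gcongr; exact (graphPoint hq).le_opNorm g)
  rcases (norm_nonneg g).eq_or_lt with h | h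
  · rw [← h]; positivity
  · refine le_of_mul_le_mul_right ?_ h
    linarith

theorem Aext_injective (hq : 0 < q) : Function.Injective (Aext q) := by
  rw [injective_iff_map_eq_zero]
  intro g hg
  have := norm_le_norm_Aext hq g
  rw [hg, norm_zero, mul_zero] at this
  simpa using this

theorem denseRange_emb (hq : 0 < q) : DenseRange (emb q) := by
  have h : (emb q : H → Xm1 q) = Aext q ∘ solR q 1 := funext fun x => (Aext_solR hq x).symm
  rw [h]
  exact (Aext_surjective hq).denseRange.comp (denseRange_solR hq) (Aext q).continuous

theorem isResolvent_zero (hq : 0 < q) : IsResolvent (A q) 0 (-solR q 1) := by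
  intro x y
  rw [mem_graph_A hq, zero_smul, zero_sub, map_neg]
  exact eq_comm

/-- Since `emb = Aext ∘ solR` with `Aext` an isomorphism, the norm of `emb q x` is equivalent to
that of `solR q 1 x`. The resolvent identity between `0` and `β` bounds `R x` and `solR q 1 x` by
each other. -/
theorem norm_resolvent (hq : 0 < q) {β : ℂ} {R : H →L[ℂ] H} (hR : IsResolvent (A q) β R) :
    ∃ c : ℝ, ∀ x : H, ‖R x‖ ≤ c * ‖emb q x‖ ∧ ‖emb q x‖ ≤ c * ‖R x‖ := by
  have h1 : ∀ x y, R x = y ↔ y = solR q 1 (β • y - x) := fun x y => by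
    rw [hR x y, mem_graph_A hq]
  have h2 : ∀ x, R x = β • solR q 1 (R x) - solR q 1 x := fun x => by
    have := (h1 x (R x)).1 rfl
    rwa [map_sub, map_smul] at this
  have h3 : ∀ x, R (solR q 1 x) = solR q 1 (R x) := fun x => by
    rw [h1, ← map_smul, ← map_sub]
    refine congrArg (solR q 1) ((h2 x).trans ?_)
    rw [map_sub, map_smul]
  have h4 : ∀ x, R x = β • R (solR q 1 x) - solR q 1 x := fun x => by
    rw [h3]; exact h2 x
  have b1 : ∀ x, ‖R x‖ ≤ ((‖β‖ * ‖R‖ + 1) * ‖graphPoint hq‖) * ‖emb q x‖ := fun x => by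
    have := norm_le_norm_Aext hq (solR q 1 x)
    rw [Aext_solR hq] at this
    calc ‖R x‖ = ‖β • R (solR q 1 x) - solR q 1 x‖ := by rw [← h4]
      _ ≤ ‖β‖ * (‖R‖ * ‖solR q 1 x‖) + ‖solR q 1 x‖ := by
        refine (norm_sub_le _ _).trans ?_
        rw [norm_smul]
        gcongr
        exact R.le_opNorm _
      _ = (‖β‖ * ‖R‖ + 1) * ‖solR q 1 x‖ := by ring
      _ ≤ (‖β‖ * ‖R‖ + 1) * (‖graphPoint hq‖ * ‖emb q x‖) := by gcongr
      _ = _ := by ring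
  have b2 : ∀ x, ‖emb q x‖ ≤ (‖Aext q‖ * (‖β‖ * ‖solR q 1‖ + 1)) * ‖R x‖ := fun x => by
    have h5 : solR q 1 x = β • solR q 1 (R x) - R x := by
      have := h2 x
      rw [eq_sub_iff_add_eq] at this ⊢
      rw [← this, add_comm]
    rw [← Aext_solR hq]
    calc ‖Aext q (solR q 1 x)‖ ≤ ‖Aext q‖ * ‖solR q 1 x‖ := (Aext q).le_opNorm _
      _ ≤ ‖Aext q‖ * (‖β‖ * (‖solR q 1‖ * ‖R x‖) + ‖R x‖) := by
        rw [h5]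
        gcongr
        refine (norm_sub_le _ _).trans ?_
        rw [norm_smul]
        gcongr
        exact (solR q 1).le_opNorm _
      _ = _ := by ring
  refine ⟨(‖β‖ * ‖R‖ + 1) * ‖graphPoint hq‖ + ‖Aext q‖ * (‖β‖ * ‖solR q 1‖ + 1),
    fun x => ⟨(b1 x).trans ?_, (b2 x).trans ?_⟩⟩
  · gcongr
    exact le_add_of_nonneg_right (by positivity)
  · gcongr
    exact le_add_of_nonneg_left (by positivity)

end Operators

/-! ### Boundary controls and the inhomogeneous boundary value problem -/

section Boundary

variable {q : ℝ}

/-- The preimage of `B_l` under the extension of `A`, in `H²`. -/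
def leftH2 (q : ℝ) : H2 :=
  ⟨((Complex.I / q) • oneL2, 0, 0), by
    have h1 := hasDerivL2_add_primitive (Complex.I / q) 0
    rw [map_zero, add_zero] at h1
    exact ⟨h1, hasDerivL2_zero⟩⟩

/-- The preimage of `B_r` under the extension of `A`, in `H²`. -/
def rightH2 (q : ℝ) : H2 :=
  ⟨((-(Complex.I / q)) • oneL2 - primitive oneL2, -oneL2, 0), by
    have h1 := hasDerivL2_add_primitive (-(Complex.I / q)) (-oneL2)
    have h2 := hasDerivL2_add_primitive (-1) 0
    rw [map_neg, ← sub_eq_add_neg] at h1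
    rw [map_zero, add_zero, neg_one_smul] at h2
    exact ⟨h1, h2⟩⟩

/-- Writing `ψ = solR q (-1) (A*ψ)` expresses `ψ(0)` as an inner product with `A*ψ`, so `Aext⁻¹ B_l`
can be read off. The other end works the same way. -/
theorem Aext_left (hq : 0 < q) : Aext q (leftH2 q).1.1 = Bl hq := by
  refine DFunLike.ext _ _ fun p => ?_
  have hp := (mem_graph_Astar hq p.1.1 p.1.2).1 p.2
  have e : Bl hq p = Complex.I * starRingEnd ℂ (pointValue p.1.1 0) := rfl
  rw [Aext_apply, e, hp, pointValue_solR_zero]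
  change inner ℂ p.1.2 ((Complex.I / q) • oneL2) = _
  rw [inner_smul_right, map_mul, inner_conj_symm, map_inv₀, Complex.conj_ofReal]
  ring

theorem Aext_right (hq : 0 < q) : Aext q (rightH2 q).1.1 = Br hq := by
  refine DFunLike.ext _ _ fun p => ?_
  have hp := (mem_graph_Astar hq p.1.1 p.1.2).1 p.2
  have e : Br hq p = -Complex.I * starRingEnd ℂ (pointValue p.1.1 1) := rfl
  rw [Aext_apply, e, hp, pointValue_solR_one]
  change inner ℂ p.1.2 ((-(Complex.I / q)) • oneL2 - primitive oneL2) = _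
  have h1 : inner ℂ oneL2 (tailIntegral p.1.2) = inner ℂ (primitive oneL2) p.1.2 := by
    rw [tailIntegral, adjoint_inner_right]
  rw [inner_sub_right, inner_smul_right, h1]
  simp only [map_sub, map_mul, inner_conj_symm, map_inv₀, Complex.conj_ofReal, Complex.conj_I,
    Complex.ofReal_neg, Complex.ofReal_one, map_neg, map_one]
  linear_combination (-inner ℂ p.1.2 (primitive oneL2)) * Complex.I_sq

theorem rhs_eq (hq : 0 < q) (f : H) (a b : ℂ) :
    rhs hq f a b = Aext q (f + (a • (leftH2 q).1.1 + b • (rightH2 q).1.1)) := by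
  rw [rhs, map_add, map_add, map_smul, map_smul, Aext_left, Aext_right, add_assoc]

theorem rhs_eq_emb_iff (hq : 0 < q) (f h : H) (a b : ℂ) : rhs hq f a b = emb q h ↔
    f + (a • (leftH2 q).1.1 + b • (rightH2 q).1.1) = solR q 1 h := by
  rw [rhs_eq, ← Aext_solR hq, (Aext_injective hq).eq_iff]

/-- The element `ζ` of `H²` with `-i ζ'' = h`, `ζ'(0) = -iq ζ(0) + a`, `ζ'(1) = b`. -/
def bvpSol (q : ℝ) (h : H) (a b : ℂ) : H2 := solH2 q 1 h - (a • leftH2 q + b • rightH2 q)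

theorem bvpSol_fst (h : H) (a b : ℂ) : (bvpSol q h a b).1.1 =
    solR q 1 h - (a • (leftH2 q).1.1 + b • (rightH2 q).1.1) := rfl

theorem bvpSol_fst_eq (h : H) (a b : ℂ) : (bvpSol q h a b).1.1 =
    ((q⁻¹ : ℂ) * inner ℂ oneL2 h - a * (Complex.I / q) + b * (Complex.I / q)) • oneL2 +
      primitive ((-Complex.I) • tailIntegral h + b • oneL2) := by
  rw [bvpSol_fst, solR_apply]
  change _ - (a • ((Complex.I / q) • oneL2) +
    b • ((-(Complex.I / q)) • oneL2 - primitive oneL2)) = _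
  rw [Complex.ofReal_one, mul_one, map_add, map_smul primitive b]
  module

theorem bvpSol_snd_eq (h : H) (a b : ℂ) : (bvpSol q h a b).1.2.1 =
    (-Complex.I) • tailIntegral h + b • oneL2 := by
  change (-(Complex.I * (1 : ℝ))) • tailIntegral h - (a • (0 : H) + b • -oneL2) = _
  rw [Complex.ofReal_one, mul_one]
  module

theorem bvpSol_snd_eq' (h : H) (a b : ℂ) : (bvpSol q h a b).1.2.1 =
    (-Complex.I * inner ℂ oneL2 h + b) • oneL2 + primitive (Complex.I • h) := by
  rw [bvpSol_snd_eq, smul_tailIntegral]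
  module

theorem bvpSol_trd (h : H) (a b : ℂ) : (bvpSol q h a b).1.2.2 = Complex.I • h := by
  change (Complex.I * (1 : ℝ)) • h - (a • (0 : H) + b • (0 : H)) = _
  rw [Complex.ofReal_one, mul_one]
  module

theorem bvpSol_left (hq : 0 < q) (h : H) (a b : ℂ) : pointValue (bvpSol q h a b).1.2.1 0 =
    -Complex.I * q * pointValue (bvpSol q h a b).1.1 0 + a := by
  have hq' : (q : ℂ) ≠ 0 := by exact_mod_cast hq.ne'
  rw [bvpSol_snd_eq', bvpSol_fst_eq, pointValue_add_primitive_zero, pointValue_add_primitive_zero]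
  field_simp
  linear_combination (b - a) * Complex.I_sq

theorem bvpSol_right (h : H) (a b : ℂ) : pointValue (bvpSol q h a b).1.2.1 1 = b := by
  rw [bvpSol_snd_eq', pointValue_add_primitive_one, inner_smul_right]
  ring

theorem bvpSol_one (h : H) (a b : ℂ) : pointValue (bvpSol q h a b).1.1 1 =
    (q⁻¹ : ℂ) * inner ℂ oneL2 h - a * (Complex.I / q) + b * (Complex.I / q) +
      inner ℂ oneL2 ((-Complex.I) • tailIntegral h + b • oneL2) := by
  rw [bvpSol_fst_eq, pointValue_add_primitive_one]

/-- After applying `Aext⁻¹`, the left side says that `f` differs from an element of the range of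
`solR q 1` by the lifting of the boundary data, that is, `f` is a `bvpSol`. Conversely, `h = -i
f''`. -/
theorem exists_rhs_eq_emb_iff (hq : 0 < q) (f : H) (a b : ℂ) :
    (∃ h : H, rhs hq f a b = emb q h) ↔ ∃ ζ : H2, ζ.1.1 = f ∧
      pointValue ζ.1.2.1 0 = -Complex.I * q * pointValue ζ.1.1 0 + a ∧
      pointValue ζ.1.2.1 1 = b := by
  constructor
  · rintro ⟨h, hh⟩
    rw [rhs_eq_emb_iff] at hh
    refine ⟨bvpSol q h a b, ?_, bvpSol_left hq h a b, bvpSol_right h a b⟩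
    rw [bvpSol_fst, ← hh, add_sub_cancel_right]
  · rintro ⟨⟨⟨f, f1, f2⟩, h1, h2⟩, rfl, h3, h4⟩
    simp only at h1 h2 h3 h4 ⊢
    have hq' : (q : ℂ) ≠ 0 := by exact_mod_cast hq.ne'
    have e1 := h1.eq
    have e1' := h2.eq
    have e3 : pointValue f1 1 = pointValue f1 0 + inner ℂ oneL2 f2 := by
      rw [h2.pointValue_eq (by simp), inner_oneL2]
    rw [h4] at e3
    have e4 : pointValue f1 0 = b - inner ℂ oneL2 f2 := by rw [e3]; ring
    refine ⟨-Complex.I • f2, ?_⟩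
    have e5 : pointValue f 0 + a * (Complex.I / q) - b * (Complex.I / q) =
        (q⁻¹ : ℂ) * (-Complex.I * inner ℂ oneL2 f2) := by
      rw [h3] at e4
      field_simp
      linear_combination Complex.I * e4 + (q * pointValue f 0) * Complex.I_sq
    have e6 : (-Complex.I) • tailIntegral (-Complex.I • f2) = f1 - b • oneL2 := by
      rw [smul_tailIntegral, inner_smul_right, smul_smul, e1', e4]
      simp only [neg_mul, mul_neg, ← mul_assoc, Complex.I_mul_I, neg_neg, one_mul, one_smul]
      module
    rw [rhs_eq_emb_iff, solR_apply, Complex.ofReal_one, mul_one, inner_smul_right, e6, ← e5,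
      map_sub, map_smul]
    change f + (a • ((Complex.I / q) • oneL2) +
      b • ((-(Complex.I / q)) • oneL2 - primitive oneL2)) = _
    nth_rewrite 1 [e1]
    module

end Boundary

end Schrod

end

/-! ### The group generated by `A` and admissibility of the controls -/

open MeasureTheory Set Filter Topology

noncomputable section

namespace Schrod

open ContinuousLinearMap

theorem exists_isGroupOf_solR {q : ℝ} (hq : 0 < q) : ∃ T, IsGroupOf (solR q 1) T :=
  volterraRel.exists_isGroupOf hq (by norm_num)

theorem exists_isGroupOf_solR_neg {q : ℝ} (hq : 0 < q) : ∃ T, IsGroupOf (solR q (-1)) T :=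
  volterraRel.exists_isGroupOf hq (by norm_num)

theorem obsBound_left {q : ℝ} (hq : 0 < q) {T : ℝ → H →L[ℂ] H}
    (hT : IsGroupOf (solR q (-1)) T) : ObsBound (solR q (-1)) T (leftH2 q).1.1 :=
  (VolterraRel.obsBound_one hq hT).smul _

/-- The inner product of `(rightH2 q).1.1` with `y` is `i` times the value at `1` of `solR q (-1)
y`, so this is the trace bound at `1` up to a unimodular factor. -/
theorem obsBound_right {q : ℝ} (hq : 0 < q) {T : ℝ → H →L[ℂ] H}
    (hT : IsGroupOf (solR q (-1)) T) : ObsBound (solR q (-1)) T (rightH2 q).1.1 := by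
  have h := (volterraRel.obsBound_trace_one hq (by norm_num) hT).smul (-Complex.I)
  have e : (rightH2 q).1.1 = (-Complex.I) • ((q⁻¹ : ℂ) • oneL2 +
      (Complex.I * ((-1 : ℝ) : ℂ)) • adjoint tailIntegral oneL2) := by
    change (-(Complex.I / q)) • oneL2 - primitive oneL2 = _
    rw [adjoint_tailIntegral, smul_add, smul_smul, smul_smul]
    have e1 : -Complex.I * (Complex.I * ((-1 : ℝ) : ℂ)) = -1 := by
      push_cast
      linear_combination Complex.I_sq
    rw [e1, div_eq_mul_inv, neg_mul]
    module
  rw [e]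
  exact h

theorem exists_reachable_solR {q : ℝ} (hq : 0 < q) {T : ℝ → H →L[ℂ] H}
    (hT : IsGroupOf (solR q 1) T) {u : ℝ → ℂ} (hu : IsL2loc u) {g : H}
    (hg : ∀ T', IsGroupOf (solR q (-1)) T' → ObsBound (solR q (-1)) T' g) :
    ∃ Ψ : ℝ → H, ContinuousOn Ψ (Ici 0) ∧
      ∀ t, 0 ≤ t → solR q 1 (Ψ t) = ∫ s in (0 : ℝ)..t, u s • T (-s) g := by
  obtain ⟨T', hT'⟩ := exists_isGroupOf_solR_neg hq
  refine hT.exists_reachable (T' := T') ?_ (solR_injective hq) (solR_neg_injective hq) ?_ hu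
  · rwa [adjoint_solR]
  · rw [adjoint_solR]
    exact hg T' hT'

theorem IsGroupOf.isC0Group {R : H →L[ℂ] H} {T : ℝ → H →L[ℂ] H} (h : IsGroupOf R T)
    (hR : Function.Injective R) : IsC0Group T :=
  ⟨h.zero, h.add hR, h.cont⟩

theorem IsGroupOf.isGenerator {q : ℝ} (hq : 0 < q) {T : ℝ → H →L[ℂ] H}
    (h : IsGroupOf (solR q 1) T) : IsGenerator T (A q) := by
  have key : ∀ y, Tendsto (fun t : ℝ => t⁻¹ • (T t (solR q 1 y) - solR q 1 y)) (𝓝[>] 0)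
      (𝓝 y) := fun y => by
    have h1 := (h.hasDerivAt y 0).tendsto_slope_zero_right
    simpa only [zero_add, h.zero, one_apply_eq_self] using h1
  intro x y
  rw [mem_graph_A hq]
  refine ⟨fun e => e ▸ key y, fun hy => ?_⟩
  -- Applying `R` to the difference quotients of `x` gives those of `R x`. They tend to `R y` by
  -- hypothesis and to `x` by `key`.
  have h1 := ((solR q 1).continuous.tendsto y).comp hy
  refine tendsto_nhds_unique (key x) (h1.congr fun t => ?_)
  simp only [Function.comp_apply]
  rw [h.comm, ← map_sub, ContinuousLinearMap.map_smul_of_tower]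

/-- The extension of `A` as an isomorphism of `L²[0,1]` onto `X₋₁`. -/
def AextEquiv {q : ℝ} (hq : 0 < q) : H ≃L[ℂ] Xm1 q :=
  ContinuousLinearEquiv.ofBijective (Aext q)
    (LinearMap.ker_eq_bot.2 (Aext_injective hq)) (LinearMap.range_eq_top.2 (Aext_surjective hq))

theorem AextEquiv_apply {q : ℝ} (hq : 0 < q) (x : H) : AextEquiv hq x = Aext q x := rfl

theorem IsL2loc.of_memLp {u : ℝ → ℂ} (hu : MemLp u 2 (volume.restrict (Ici 0))) : IsL2loc u :=
  fun _ _ => hu.mono_measure (Measure.restrict_mono Icc_subset_Ici_self le_rfl)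

/-- The extension of `T_t` to `X₋₁` is its conjugate by `Aext`. The control integral becomes `Aext
(T_τ R Ψ(τ)) = emb (T_τ Ψ(τ))`, with `Ψ` the reachable states. -/
theorem IsGroupOf.isAdmissibleControl {q : ℝ} (hq : 0 < q) {T : ℝ → H →L[ℂ] H}
    (h : IsGroupOf (solR q 1) T) {g : H}
    (hg : ∀ T', IsGroupOf (solR q (-1)) T' → ObsBound (solR q (-1)) T' g) :
    IsAdmissibleControl T (Aext q g) := by
  refine ⟨fun t => (Aext q).comp ((T t).comp (AextEquiv hq).symm.toContinuousLinearMap),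
    fun t x => ?_, fun τ hτ u hu => ?_⟩
  · rw [← Aext_solR hq, ← AextEquiv_apply hq]
    simp only [ContinuousLinearMap.comp_apply, ContinuousLinearEquiv.coe_coe,
      ContinuousLinearEquiv.symm_apply_apply]
    rw [h.comm, Aext_solR hq]
  · have hu' := IsL2loc.of_memLp hu
    have e : (fun s => u s • ((Aext q).comp ((T (τ - s)).comp
        (AextEquiv hq).symm.toContinuousLinearMap)) (Aext q g)) =
        fun s => Aext q (u s • T (τ - s) g) := by
      funext s
      rw [← AextEquiv_apply hq]
      simp only [ContinuousLinearMap.comp_apply, ContinuousLinearEquiv.coe_coe,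
        ContinuousLinearEquiv.symm_apply_apply]
      rw [map_smul]
    have hi : IntervalIntegrable (fun s => u s • T (τ - s) g) volume 0 τ :=
      h.intervalIntegrable_smul hu' g (by fun_prop) le_rfl hτ.le
    simp only [e]
    refine ⟨intervalIntegrable_clm_comp _ hi, ?_⟩
    obtain ⟨Ψ, -, hΨ⟩ := exists_reachable_solR hq h hu' hg
    refine ⟨T τ (Ψ τ), ?_⟩
    rw [(Aext q).intervalIntegral_comp_comm hi, ← Aext_solR hq, ← h.comm, hΨ τ hτ.le,
      ← (T τ).intervalIntegral_comp_comm (h.intervalIntegrable_smul hu' g continuous_neg le_rfl hτ.le)]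
    congr 2
    funext s
    rw [map_smul, sub_eq_add_neg, h.add (solR_injective hq)]
    rfl

/-! ### Existence and uniqueness of solutions -/

section Solutions

variable {q : ℝ}

/-- The preimage of `d B_l + u B_r` under the extension of `A`. -/
def inputState (q : ℝ) (a b : ℂ) : H := a • (leftH2 q).1.1 + b • (rightH2 q).1.1

theorem intervalIntegrable_inputState {d u : ℝ → ℂ} (hd : IsL2loc d) (hu : IsL2loc u) {t : ℝ}
    (ht : 0 ≤ t) : IntervalIntegrable (fun s => inputState q (d s) (u s)) volume 0 t :=
  ((hd.intervalIntegrable le_rfl ht).smul_continuousOn continuousOn_const).add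
    ((hu.intervalIntegrable le_rfl ht).smul_continuousOn continuousOn_const)

/-- Applying `Aext⁻¹`, for which `Aext⁻¹ ∘ emb = R`, moves the equation from `X₋₁` to `L²[0,1]`. -/
theorem inputState_eqn_iff (hq : 0 < q) {d u : ℝ → ℂ} (hd : IsL2loc d) (hu : IsL2loc u)
    {z : ℝ → H} {t : ℝ} (ht : 0 ≤ t) (hz : IntervalIntegrable z volume 0 t) :
    (emb q (z t) - emb q (z 0) = ∫ s in (0 : ℝ)..t, rhs hq (z s) (d s) (u s)) ↔
      solR q 1 (z t) = solR q 1 (z 0) +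
        ∫ s in (0 : ℝ)..t, (z s + inputState q (d s) (u s)) := by
  simp_rw [rhs_eq]
  change _ = ∫ s in (0 : ℝ)..t, Aext q (z s + inputState q (d s) (u s)) ↔ _
  rw [← Aext_solR hq, ← Aext_solR hq, ← map_sub,
    (Aext q).intervalIntegral_comp_comm (hz.add (intervalIntegrable_inputState hd hu ht)),
    (Aext_injective hq).eq_iff, sub_eq_iff_eq_add']

theorem IsSolution.intervalIntegrable {hq : 0 < q} {d u : ℝ → ℂ} {z : ℝ → H}
    (h : IsSolution hq d u z) {t : ℝ} (ht : 0 ≤ t) : IntervalIntegrable z volume 0 t := by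
  rw [intervalIntegrable_iff_integrableOn_Ioc_of_le ht]
  exact (h.integrable (t + 1) (by linarith)).mono_set fun s hs => ⟨hs.1.le, by linarith [hs.2]⟩

theorem isSolution_of_continuousOn (hq : 0 < q) {d u : ℝ → ℂ} (hd : IsL2loc d) (hu : IsL2loc u)
    {z : ℝ → H} (hz : ContinuousOn z (Ici 0))
    (h : ∀ t, 0 ≤ t → solR q 1 (z t) = solR q 1 (z 0) +
      ∫ s in (0 : ℝ)..t, (z s + inputState q (d s) (u s))) : IsSolution hq d u z := by
  have hi : ∀ τ : ℝ, IntegrableOn z (Icc 0 τ) := fun τ =>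
    (hz.mono Icc_subset_Ici_self).integrableOn_Icc
  refine ⟨fun τ _ => hi τ, (emb q).continuous.comp_continuousOn hz, fun t ht => ?_⟩
  refine (inputState_eqn_iff hq hd hu ht ?_).2 (h t ht)
  exact (intervalIntegrable_iff_integrableOn_Icc_of_le ht).2 (hi t)

/-- The difference `v` of two solutions satisfies `R v(t) = ∫₀ᵗ v`. Local integrability is enough
for it to vanish, so no continuity in `L²[0,1]` is needed. -/
theorem IsSolution.eqOn (hq : 0 < q) {d u : ℝ → ℂ} (hd : IsL2loc d) (hu : IsL2loc u)
    {z w : ℝ → H} (hz : IsSolution hq d u z) (hw : IsSolution hq d u w) (h0 : w 0 = z 0) :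
    EqOn w z (Ici 0) := by
  obtain ⟨T, hT⟩ := exists_isGroupOf_solR hq
  intro t ht
  rw [← sub_eq_zero]
  refine hT.eq_zero_of_integral_eq (w := fun t => w t - z t) (solR_injective hq) (fun s hs => ?_)
    (fun s hs => (hw.intervalIntegrable hs).sub (hz.intervalIntegrable hs)) ht
  have hk := intervalIntegrable_inputState (q := q) hd hu hs
  have e1 := (inputState_eqn_iff hq hd hu hs (hw.intervalIntegrable hs)).1 (hw.eqn s hs)
  have e2 := (inputState_eqn_iff hq hd hu hs (hz.intervalIntegrable hs)).1 (hz.eqn s hs)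
  rw [intervalIntegral.integral_add (hw.intervalIntegrable hs) hk] at e1
  rw [intervalIntegral.integral_add (hz.intervalIntegrable hs) hk] at e2
  refine Eq.trans ?_ (intervalIntegral.integral_sub (hw.intervalIntegrable hs)
    (hz.intervalIntegrable hs)).symm
  rw [map_sub, e1, e2, h0]
  abel

/-- The solution is `T_t (z₀ + Ψd(t) + Ψu(t))`. It is continuous because the reachable states are
and the group acts jointly continuously. -/
theorem exists_isSolution (hq : 0 < q) (z₀ : H) {d u : ℝ → ℂ} (hd : IsL2loc d)
    (hu : IsL2loc u) : ∃ z, IsSolution hq d u z ∧ z 0 = z₀ ∧ ContinuousOn z (Ici 0) := by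
  obtain ⟨T, hT⟩ := exists_isGroupOf_solR hq
  obtain ⟨Ψd, hdc, hΨd⟩ := exists_reachable_solR hq hT hd fun T' => obsBound_left hq
  obtain ⟨Ψu, huc, hΨu⟩ := exists_reachable_solR hq hT hu fun T' => obsBound_right hq
  have hc : ContinuousOn (fun t => Ψd t + Ψu t) (Ici 0) := hdc.add huc
  have h0 : Ψd 0 + Ψu 0 = 0 := by
    refine solR_injective hq ?_
    rw [map_add, hΨd 0 le_rfl, hΨu 0 le_rfl]
    simp
  have hi1 : ∀ t : ℝ, 0 ≤ t →
      IntervalIntegrable (fun s => d s • T (-s) (leftH2 q).1.1) volume 0 t :=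
    fun t ht => hT.intervalIntegrable_smul hd _ continuous_neg le_rfl ht
  have hi2 : ∀ t : ℝ, 0 ≤ t →
      IntervalIntegrable (fun s => u s • T (-s) (rightH2 q).1.1) volume 0 t :=
    fun t ht => hT.intervalIntegrable_smul hu _ continuous_neg le_rfl ht
  have e : (fun s => T (-s) (inputState q (d s) (u s))) =
      fun s => d s • T (-s) (leftH2 q).1.1 + u s • T (-s) (rightH2 q).1.1 := by
    funext s
    rw [inputState, map_add, map_smul, map_smul]
  have hz0 : T 0 (z₀ + (Ψd 0 + Ψu 0)) = z₀ := by rw [h0, hT.zero, add_zero]; rfl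
  have hzc : ContinuousOn (fun t => T t (z₀ + (Ψd t + Ψu t))) (Ici 0) :=
    hT.continuousOn continuousOn_id (continuousOn_const.add hc)
  refine ⟨_, isSolution_of_continuousOn hq hd hu hzc fun t ht => ?_, hz0, hzc⟩
  rw [hz0]
  refine hT.variation_of_constants (solR_injective hq) z₀ hc (fun s hs => ?_) ht
    (intervalIntegrable_inputState hd hu ht) ?_
  · rw [e, map_add, hΨd s hs, hΨu s hs]
    exact (intervalIntegral.integral_add (hi1 s hs) (hi2 s hs)).symm
  · rw [e]
    exact (hi1 t ht).add (hi2 t ht)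

end Solutions

/-! ### Classical solutions for `H¹` inputs -/

section Classical

variable {q : ℝ}

theorem continuousOn_add_integral {X : Type*} [NormedAddCommGroup X] [NormedSpace ℝ X]
    {v : ℝ → X} (hv : ∀ t : ℝ, 0 ≤ t → IntervalIntegrable v volume 0 t) (c : X) :
    ContinuousOn (fun t => c + ∫ s in (0 : ℝ)..t, v s) (Ici 0) := by
  intro t ht
  have ht' : 0 ≤ t + 1 := by linarith [mem_Ici.1 ht]
  have h1 := intervalIntegral.continuousOn_primitive_interval' (hv (t + 1) ht') (a := 0)
    (by simp)
  rw [uIcc_of_le ht'] at h1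
  refine ContinuousWithinAt.add continuousWithinAt_const ?_
  refine (h1 t ⟨ht, by linarith⟩).mono_of_mem_nhdsWithin ?_
  rw [← Ici_inter_Iic]
  exact inter_mem_nhdsWithin _ (Iic_mem_nhds (by linarith))

theorem IsH1loc.continuousOn {u : ℝ → ℂ} (hu : IsH1loc u) : ContinuousOn u (Ici 0) := by
  obtain ⟨v, hv, h⟩ := hu
  exact (continuousOn_add_integral (fun t ht => hv.intervalIntegrable le_rfl ht) (u 0)).congr
    fun t ht => h t ht

theorem isL2loc_of_continuousOn {u : ℝ → ℂ} (hu : ContinuousOn u (Ici 0)) : IsL2loc u :=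
  fun τ _ => by
    have h : ContinuousOn u (Icc 0 τ) := hu.mono Icc_subset_Ici_self
    exact (memLp_two_iff_integrable_sq_norm (h.aestronglyMeasurable measurableSet_Icc)).2
      (h.norm.pow 2).integrableOn_Icc

/-- The velocity formally solves the same equation with inputs `d'`, `u'` and initial value `h`.
That problem has a continuous solution `w`, and `z(0) + ∫ w` solves the original equation, so by
uniqueness it equals `z`. -/
theorem IsSolution.exists_eq_integral (hq : 0 < q) {d u : ℝ → ℂ} (hd : IsH1loc d)
    (hu : IsH1loc u) {z : ℝ → H} (hz : IsSolution hq d u z) {h : H}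
    (hh : rhs hq (z 0) (d 0) (u 0) = emb q h) : ∃ w : ℝ → H, Continuous w ∧
      (∀ t, 0 ≤ t → z t = z 0 + ∫ s in (0 : ℝ)..t, w s) ∧
      ∀ t, 0 ≤ t → rhs hq (z t) (d t) (u t) = emb q (w t) := by
  have hdL := isL2loc_of_continuousOn hd.continuousOn
  have huL := isL2loc_of_continuousOn hu.continuousOn
  obtain ⟨vd, hvd, ed⟩ := hd
  obtain ⟨vu, hvu, eu⟩ := hu
  obtain ⟨w, hw, hw0, hwc⟩ := exists_isSolution hq h hvd hvu
  have hwm := continuous_comp_max hwc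
  set W : ℝ → H := fun t => w (max t 0)
  have hW : ∀ t, 0 ≤ t → W t = w t := fun t ht => by simp only [W, max_eq_left ht]
  set y : ℝ → H := fun t => z 0 + ∫ s in (0 : ℝ)..t, W s
  have hyd : ∀ t, HasDerivAt y (W t) t := fun t =>
    (intervalIntegral.integral_hasDerivAt_right (hwm.intervalIntegrable _ _)
      (hwm.stronglyMeasurableAtFilter _ _) hwm.continuousAt).const_add _
  have hy0 : y 0 = z 0 := by simp [y]
  have hyc : Continuous y := continuous_iff_continuousAt.2 fun t => (hyd t).continuousAt
  have hki : ∀ t : ℝ, 0 ≤ t → ∫ s in (0 : ℝ)..t, inputState q (vd s) (vu s) =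
      inputState q (d t) (u t) - inputState q (d 0) (u 0) := fun t ht => by
    have i1 := hvd.intervalIntegrable le_rfl ht
    have i2 := hvu.intervalIntegrable le_rfl ht
    simp only [inputState]
    rw [intervalIntegral.integral_add (i1.smul_continuousOn continuousOn_const)
      (i2.smul_continuousOn continuousOn_const), intervalIntegral.integral_smul_const,
      intervalIntegral.integral_smul_const, ed t ht, eu t ht]
    module
  -- In the integrated equation for `w`, the primitive of the differentiated inputs leaves a value
  -- at `t = 0`. The compatibility condition, in the form `R h = z(0) + inputState (d 0) (u 0)`,
  -- cancels it.
  have hRw : ∀ t, 0 ≤ t → solR q 1 (w t) = y t + inputState q (d t) (u t) := fun t ht => by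
    have e1 := (inputState_eqn_iff hq hvd hvu ht (hw.intervalIntegrable ht)).1 (hw.eqn t ht)
    rw [intervalIntegral.integral_add (hw.intervalIntegrable ht)
      (intervalIntegrable_inputState hvd hvu ht), hki t ht, hw0,
      ← (rhs_eq_emb_iff hq _ _ _ _).1 hh] at e1
    have e2 : ∫ s in (0 : ℝ)..t, W s = ∫ s in (0 : ℝ)..t, w s := by
      refine intervalIntegral.integral_congr fun s hs => hW s ?_
      rw [uIcc_of_le ht] at hs
      exact hs.1
    rw [e1]
    simp only [y, e2, inputState]
    abel
  have hysol : IsSolution hq d u y := by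
    refine isSolution_of_continuousOn hq hdL huL hyc.continuousOn fun t ht => ?_
    have e1 : solR q 1 (y t) = solR q 1 (y 0) + ∫ s in (0 : ℝ)..t, solR q 1 (W s) := by
      rw [(solR q 1).intervalIntegral_comp_comm (hwm.intervalIntegrable _ _), ← map_add, hy0]
    rw [e1]
    congr 1
    refine intervalIntegral.integral_congr fun s hs => ?_
    rw [uIcc_of_le ht] at hs
    exact (congrArg (solR q 1) (hW s hs.1)).trans (hRw s hs.1)
  have hzy := IsSolution.eqOn hq hdL huL hysol hz hy0.symm
  refine ⟨W, hwm, fun t ht => hzy ht, fun t ht => ?_⟩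
  rw [rhs_eq_emb_iff, hW t ht, hRw t ht, hzy ht]
  rfl

/-- The solution of the stationary problem depends boundedly and linearly, in the norm of `H²`, on
the right-hand side and the boundary data. Continuity of the velocity and of the inputs thus becomes
continuity of the state in `H²`. -/
theorem continuousOn_bvpSol {w : ℝ → H} {d u : ℝ → ℂ} {S : Set ℝ} (hw : ContinuousOn w S)
    (hd : ContinuousOn d S) (hu : ContinuousOn u S) :
    ContinuousOn (fun t => bvpSol q (w t) (d t) (u t)) S :=
  ((solH2 q 1).continuous.comp_continuousOn hw).sub
    ((hd.smul continuousOn_const).add (hu.smul continuousOn_const))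

theorem continuousOn_bvpSol_one {w : ℝ → H} {d u : ℝ → ℂ} {S : Set ℝ} (hw : ContinuousOn w S)
    (hd : ContinuousOn d S) (hu : ContinuousOn u S) :
    ContinuousOn (fun t => pointValue (bvpSol q (w t) (d t) (u t)).1.1 1) S := by
  simp_rw [bvpSol_one]
  have h1 : ContinuousOn (fun t => tailIntegral (w t)) S :=
    tailIntegral.continuous.comp_continuousOn hw
  have h2 : ∀ {v : ℝ → H}, ContinuousOn v S → ContinuousOn (fun t => inner ℂ oneL2 (v t)) S :=
    fun hv => (innerSL ℂ oneL2).continuous.comp_continuousOn hv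
  exact (((continuousOn_const.mul (h2 hw)).sub (hd.mul continuousOn_const)).add
    (hu.mul continuousOn_const)).add
      (h2 ((h1.const_smul (-Complex.I)).add (hu.smul continuousOn_const)))

theorem contDiffOn_one_of_eq_integral {z w : ℝ → H} (hw : Continuous w)
    (h : ∀ t, 0 ≤ t → z t = z 0 + ∫ s in (0 : ℝ)..t, w s) :
    ContDiffOn ℝ 1 z (Ici 0) ∧ ∀ t, 0 ≤ t → derivWithin z (Ici 0) t = w t := by
  have hd : ∀ t, HasDerivAt (fun t => z 0 + ∫ s in (0 : ℝ)..t, w s) (w t) t := fun t =>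
    (intervalIntegral.integral_hasDerivAt_right (hw.intervalIntegrable _ _)
      (hw.stronglyMeasurableAtFilter _ _) hw.continuousAt).const_add _
  have hderiv : deriv (fun t => z 0 + ∫ s in (0 : ℝ)..t, w s) = w := funext fun t => (hd t).deriv
  have hC : ContDiff ℝ 1 (fun t => z 0 + ∫ s in (0 : ℝ)..t, w s) := by
    rw [contDiff_one_iff_deriv]
    exact ⟨fun t => (hd t).differentiableAt, hderiv.symm ▸ hw⟩
  refine ⟨hC.contDiffOn.congr fun t ht => h t ht, fun t ht => ?_⟩
  exact ((hd t).hasDerivWithinAt.congr (fun s hs => h s hs) (h t ht)).derivWithin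
    (uniqueDiffOn_Ici 0 t ht)

theorem IsSolution.classical (hq : 0 < q) {d u : ℝ → ℂ} (hd : IsH1loc d)
    (hu : IsH1loc u) {z : ℝ → H} (hz : IsSolution hq d u z)
    (hh : ∃ h : H, rhs hq (z 0) (d 0) (u 0) = emb q h) :
    (∃ ζ : ℝ → H2, ContinuousOn ζ (Ici 0) ∧ ∀ t : ℝ, 0 ≤ t → (ζ t).1.1 = z t) ∧
    ContDiffOn ℝ 1 z (Ici 0) ∧
    ∀ Ce : H2 →L[ℂ] ℂ, ∃ y ym : ℝ → ℂ, IsClassicalAbstract hq Ce z d u y ym ∧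
      IsClassicalPDE q Ce (z 0) z d u y ym := by
  obtain ⟨h, hh⟩ := hh
  obtain ⟨w, hw, hzw, hwe⟩ := hz.exists_eq_integral hq hd hu hh
  obtain ⟨hC, hderiv⟩ := contDiffOn_one_of_eq_integral hw hzw
  -- At each time the state solves the stationary problem whose right-hand side is the velocity `w
  -- t`.
  have hζ : ∀ t, 0 ≤ t → (bvpSol q (w t) (d t) (u t)).1.1 = z t := fun t ht => by
    rw [bvpSol_fst, ← (rhs_eq_emb_iff hq _ _ _ _).1 (hwe t ht), add_sub_cancel_right]
  have hζc : ContinuousOn (fun t => bvpSol q (w t) (d t) (u t)) (Ici 0) :=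
    continuousOn_bvpSol hw.continuousOn hd.continuousOn hu.continuousOn
  have hym : ContinuousOn (fun t => pointValue (bvpSol q (w t) (d t) (u t)).1.1 1) (Ici 0) :=
    continuousOn_bvpSol_one hw.continuousOn hd.continuousOn hu.continuousOn
  refine ⟨⟨_, hζc, hζ⟩, hC, fun Ce => ⟨fun t => Ce (bvpSol q (w t) (d t) (u t)),
    fun t => pointValue (bvpSol q (w t) (d t) (u t)).1.1 1, ?_, ?_⟩⟩
  · exact
      { smooth := hC
        cont_d := hd.continuousOn
        cont_u := hu.continuousOn
        cont_y := Ce.continuous.comp_continuousOn hζc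
        cont_ym := hym
        mem := fun t ht => ⟨w t, hwe t ht⟩
        eqn := fun t ht => by rw [hderiv t ht, hwe t ht]
        out := fun t ht => ⟨_, hζ t ht, rfl, rfl⟩ }
  · exact
      { smooth := hC
        cont_d := hd.continuousOn
        cont_u := hu.continuousOn
        cont_y := Ce.continuous.comp_continuousOn hζc
        cont_ym := hym
        init := rfl
        eqn := fun t ht => ⟨_, hζ t ht, by
          rw [hderiv t ht, bvpSol_trd, smul_smul, neg_mul, Complex.I_mul_I, neg_neg, one_smul],
          bvpSol_left hq _ _ _, bvpSol_right _ _ _, rfl, rfl⟩ }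

end Classical

end Schrod

end

theorem proposition3p1 (q : ℝ) (hq : 0 < q) :
    -- the setting: `A*`, `A` extended to `L²[0,1]`, and `X₋₁` as the completion of `L²[0,1]` for `‖(β I - A)⁻¹ x‖`
    (Dense ((Schrod.A q).domain : Set Schrod.H) ∧ (Schrod.A q).adjoint = Schrod.Astar q ∧
      DenseRange (Schrod.emb q) ∧
      (∀ x y : Schrod.H, (x, y) ∈ (Schrod.A q).graph → Schrod.Aext q x = Schrod.emb q y) ∧
      (∃ (β : ℂ) (R : Schrod.H →L[ℂ] Schrod.H), Schrod.IsResolvent (Schrod.A q) β R) ∧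
      ∀ (β : ℂ) (R : Schrod.H →L[ℂ] Schrod.H), Schrod.IsResolvent (Schrod.A q) β R →
        ∃ c : ℝ, ∀ x : Schrod.H, ‖R x‖ ≤ c * ‖Schrod.emb q x‖ ∧ ‖Schrod.emb q x‖ ≤ c * ‖R x‖) ∧
    -- `A f + B_l a + B_r b ∈ L²` means that `f ∈ H²` satisfies the boundary conditions
    (∀ (f : Schrod.H) (a b : ℂ), (∃ h : Schrod.H, Schrod.rhs hq f a b = Schrod.emb q h) ↔
      ∃ ζ : Schrod.H2, ζ.1.1 = f ∧
        Schrod.pointValue ζ.1.2.1 0 = -Complex.I * q * Schrod.pointValue ζ.1.1 0 + a ∧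
        Schrod.pointValue ζ.1.2.1 1 = b) ∧
    -- `A` generates a group, for which `B_l` and `B_r` are admissible
    (∃ T : ℝ → Schrod.H →L[ℂ] Schrod.H, Schrod.IsC0Group T ∧
      Schrod.IsGenerator T (Schrod.A q) ∧
      Schrod.IsAdmissibleControl T (Schrod.Bl hq) ∧
      Schrod.IsAdmissibleControl T (Schrod.Br hq)) ∧
    -- existence, uniqueness and continuity of solutions for locally square integrable inputs
    (∀ (z₀ : Schrod.H) (d u : ℝ → ℂ), Schrod.IsL2loc d → Schrod.IsL2loc u →
      ∃ z : ℝ → Schrod.H, Schrod.IsSolution hq d u z ∧ z 0 = z₀ ∧ ContinuousOn z (Set.Ici 0) ∧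
        ∀ w : ℝ → Schrod.H, Schrod.IsSolution hq d u w → w 0 = z₀ → Set.EqOn w z (Set.Ici 0)) ∧
    -- classical solutions
    (∀ (z₀ : Schrod.H) (d u : ℝ → ℂ), Schrod.IsH1loc d → Schrod.IsH1loc u →
      (∃ h : Schrod.H, Schrod.rhs hq z₀ (d 0) (u 0) = Schrod.emb q h) →
      ∀ z : ℝ → Schrod.H, Schrod.IsSolution hq d u z → z 0 = z₀ →
        (∃ ζ : ℝ → Schrod.H2, ContinuousOn ζ (Set.Ici 0) ∧ ∀ t : ℝ, 0 ≤ t → (ζ t).1.1 = z t) ∧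
        ContDiffOn ℝ 1 z (Set.Ici 0) ∧
        ∀ Ce : Schrod.H2 →L[ℂ] ℂ, ∃ y ym : ℝ → ℂ,
          Schrod.IsClassicalAbstract hq Ce z d u y ym ∧
          Schrod.IsClassicalPDE q Ce z₀ z d u y ym) := by
  refine ⟨⟨Schrod.dense_domain_A hq, Schrod.adjoint_A hq, Schrod.denseRange_emb hq,
    fun x y h => ?_, ⟨0, _, Schrod.isResolvent_zero hq⟩, fun β R => Schrod.norm_resolvent hq⟩,
    Schrod.exists_rhs_eq_emb_iff hq, ?_, fun z₀ d u hd hu => ?_,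
    fun z₀ d u hd hu hh z hz h0 => ?_⟩
  · rw [(Schrod.mem_graph_A hq x y).1 h, Schrod.Aext_solR hq]
  · obtain ⟨T, hT⟩ := Schrod.exists_isGroupOf_solR hq
    refine ⟨T, hT.isC0Group (Schrod.solR_injective hq), hT.isGenerator hq, ?_, ?_⟩
    · rw [← Schrod.Aext_left hq]
      exact hT.isAdmissibleControl hq fun T' => Schrod.obsBound_left hq
    · rw [← Schrod.Aext_right hq]
      exact hT.isAdmissibleControl hq fun T' => Schrod.obsBound_right hq
  · obtain ⟨z, hz, h0, hc⟩ := Schrod.exists_isSolution hq z₀ hd hu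
    exact ⟨z, hz, h0, hc, fun w hw hw0 =>
      Schrod.IsSolution.eqOn hq hd hu hz hw (hw0.trans h0.symm)⟩
  · subst h0
    exact hz.classical hq hd hu hh
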